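/- Let $\theta>2$ be a real number and let $\mu_\theta$ be the Bernoulli convolution with parameter $\theta$, that is, the infinite convolution product over $k\ge 0$ of the measures $\frac12\delta_{-\theta^{-k}}+\frac12\delta_{\theta^{-k}}$ on $\mathbb{R}$ (equivalently, the law of $\sum_{k\ge0}\pm\theta^{-k}$ with independent fair signs). Let $\nu_\theta$ be the Cantor–Lebesgue measure with constant dissection ratio $\theta$, constructed on $[0,1)\simeq S^1=\mathbb{R}/\mathbb{Z}$: the image of $\mu_\theta$ under $x\mapsto \frac{\theta-1}{2\theta}x+\frac12 \pmod 1$. Then for every $1<p<\infty$ the spectrum of the convolution operator $$T f(x)=(\nu_\theta * f)(x)=\int_{S^1} f(x-y)\,d\nu_\theta(y)$$ on the complex space $L^p(S^1)$ is countable (that is, finite or countably infinite). -/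

import Mathlib

open MeasureTheory AddCircle
open scoped ENNReal

/-! ### Bernoulli convolutions and Cantor–Lebesgue measures -/

/-- The fair coin: mass `1/2` on each of `true` and `false`. -/
noncomputable def fairCoin : Measure Bool :=
  (2⁻¹ : ℝ≥0∞) • Measure.dirac true + (2⁻¹ : ℝ≥0∞) • Measure.dirac false

instance fairCoin_isProbabilityMeasure : IsProbabilityMeasure fairCoin := by
  constructor
  simp [fairCoin, ENNReal.inv_two_add_inv_two]

/-- The random series `∑ k ≥ 0, ± θ ^ (-k)`, as a function of the sequence of signs
(`true` is the sign `+`). -/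
noncomputable def signSeries (θ : ℝ) (ε : ℕ → Bool) : ℝ :=
  ∑' k : ℕ, (if ε k then (1 : ℝ) else -1) * (θ⁻¹) ^ k

/-- The Bernoulli convolution `μ_θ` with parameter `θ > 1`: the infinite convolution product over
`k ≥ 0` of the measures `(δ_{-θ^{-k}} + δ_{θ^{-k}}) / 2` on the line, that is, the law of the
series `∑ k ≥ 0, ± θ ^ (-k)` with independent fair signs. -/
noncomputable def bernoulliConvolution (θ : ℝ) : Measure ℝ :=
  (Measure.infinitePi fun _ : ℕ => fairCoin).map (signSeries θ)

instance bernoulliConvolution_isFiniteMeasure (θ : ℝ) :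
    IsFiniteMeasure (bernoulliConvolution θ) := by
  unfold bernoulliConvolution; infer_instance

/-- The Cantor–Lebesgue measure with constant dissection ratio `θ > 2`, constructed on the unit
interval: the Bernoulli convolution `μ_θ`, whose support has convex hull
`[-θ/(θ-1), θ/(θ-1)]`, is scaled by `(θ-1)/(2θ)` and then translated by `1/2`. -/
noncomputable def cantorLebesgue (θ : ℝ) : Measure ℝ :=
  (bernoulliConvolution θ).map fun x => (θ - 1) / (2 * θ) * x + 1 / 2

instance cantorLebesgue_isFiniteMeasure (θ : ℝ) : IsFiniteMeasure (cantorLebesgue θ) := by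
  unfold cantorLebesgue; infer_instance

/-- The Cantor–Lebesgue measure as a measure on the circle `ℝ / ℤ`. -/
noncomputable def cantorLebesgueCircle (θ : ℝ) : Measure UnitAddCircle :=
  (cantorLebesgue θ).map fun x : ℝ => (x : UnitAddCircle)

instance cantorLebesgueCircle_isFiniteMeasure (θ : ℝ) :
    IsFiniteMeasure (cantorLebesgueCircle θ) := by
  unfold cantorLebesgueCircle; infer_instance

/-! ### Convolution operators on `L^p` of the circle -/

section Convolution

/-- The convolution `ν * f` of a measure and a function on the circle. -/
noncomputable def measureConv (ν : Measure UnitAddCircle) (f : UnitAddCircle → ℂ)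
    (x : UnitAddCircle) : ℂ :=
  ∫ y, f (x - y) ∂ν

variable (ν : Measure UnitAddCircle) [IsFiniteMeasure ν]

theorem quasiMeasurePreserving_sub_circle :
    Measure.QuasiMeasurePreserving (fun z : UnitAddCircle × UnitAddCircle => z.1 - z.2)
      ((haarAddCircle (T := (1 : ℝ))).prod ν) haarAddCircle :=
  Measure.quasiMeasurePreserving_fst.comp
    (measurePreserving_sub_prod haarAddCircle ν).quasiMeasurePreserving

theorem aestronglyMeasurable_sub_circle {f : UnitAddCircle → ℂ}
    (hf : AEStronglyMeasurable f haarAddCircle) :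
    AEStronglyMeasurable (fun z : UnitAddCircle × UnitAddCircle => f (z.1 - z.2))
      ((haarAddCircle (T := (1 : ℝ))).prod ν) :=
  hf.comp_quasiMeasurePreserving (quasiMeasurePreserving_sub_circle ν)

theorem measureConv_congr {f g : UnitAddCircle → ℂ} (h : f =ᵐ[haarAddCircle] g) :
    measureConv ν f =ᵐ[haarAddCircle] measureConv ν g := by
  have h1 := Measure.ae_ae_of_ae_prod ((quasiMeasurePreserving_sub_circle ν).ae h)
  filter_upwards [h1] with x hx
  exact integral_congr_ae hx

theorem eLpNorm_section_le {p : ℝ≥0∞} (hp : 1 ≤ p) {f : UnitAddCircle → ℂ}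
    (hf : AEStronglyMeasurable f haarAddCircle) :
    eLpNorm (fun x => (eLpNorm (fun y => f (x - y)) p ν)) p haarAddCircle
      ≤ eLpNorm f p haarAddCircle * ν Set.univ ^ (1 / p.toReal) := by
  have hp0 : p ≠ 0 := (zero_lt_one.trans_le hp).ne'
  by_cases hpt : p = ∞
  · subst hpt
    simp only [ENNReal.toReal_top, div_zero, ENNReal.rpow_zero, mul_one, eLpNorm_exponent_top]
    refine eLpNormEssSup_le_of_ae_enorm_bound ?_
    have h1 := Measure.ae_ae_of_ae_prod
      ((quasiMeasurePreserving_sub_circle ν).ae (enorm_ae_le_eLpNormEssSup f haarAddCircle))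
    filter_upwards [h1] with x hx
    simpa using eLpNormEssSup_le_of_ae_enorm_bound hx
  · have hpos : 0 < p.toReal := ENNReal.toReal_pos hp0 hpt
    have hm : AEMeasurable (fun z : UnitAddCircle × UnitAddCircle =>
        ‖f (z.1 - z.2)‖ₑ ^ p.toReal) ((haarAddCircle (T := (1 : ℝ))).prod ν) :=
      (aestronglyMeasurable_sub_circle ν hf).enorm.pow_const _
    rw [eLpNorm_eq_lintegral_rpow_enorm_toReal hp0 hpt,
      eLpNorm_eq_lintegral_rpow_enorm_toReal (f := f) hp0 hpt,
      ← ENNReal.mul_rpow_of_nonneg _ _ (by positivity)]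
    refine ENNReal.rpow_le_rpow (le_of_eq ?_) (by positivity)
    have h2 : ∀ x, ‖eLpNorm (fun y => f (x - y)) p ν‖ₑ ^ p.toReal
        = ∫⁻ y, ‖f (x - y)‖ₑ ^ p.toReal ∂ν := by
      intro x
      rw [eLpNorm_eq_lintegral_rpow_enorm_toReal hp0 hpt, enorm_eq_self, ← ENNReal.rpow_mul,
        one_div, inv_mul_cancel₀ hpos.ne', ENNReal.rpow_one]
    simp_rw [h2]
    rw [lintegral_lintegral_swap hm]
    have h3 : ∀ y : UnitAddCircle, ∫⁻ x, ‖f (x - y)‖ₑ ^ p.toReal ∂haarAddCircle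
        = ∫⁻ x, ‖f x‖ₑ ^ p.toReal ∂haarAddCircle := fun y =>
      lintegral_sub_right_eq_self (fun x => ‖f x‖ₑ ^ p.toReal) y
    simp_rw [h3]
    rw [lintegral_const]

theorem eLpNorm_measureConv_le {p : ℝ≥0∞} (hp : 1 ≤ p) {f : UnitAddCircle → ℂ}
    (hf : AEStronglyMeasurable f haarAddCircle) :
    eLpNorm (measureConv ν f) p haarAddCircle ≤ ν Set.univ * eLpNorm f p haarAddCircle := by
  have hsec : ∀ᵐ x ∂(haarAddCircle (T := (1 : ℝ))),
      AEStronglyMeasurable (fun y => f (x - y)) ν :=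
    (aestronglyMeasurable_sub_circle ν hf).prodMk_left
  have h1 : (1 : ℝ) / p.toReal ≤ 1 := by
    by_cases hpt : p = ∞
    · simp [hpt]
    · have : 1 ≤ p.toReal := by
        simpa using ENNReal.toReal_mono hpt hp
      exact (div_le_one (by linarith)).2 this
  have hfin : ν Set.univ ^ (1 - 1 / p.toReal) ≠ ∞ :=
    ENNReal.rpow_ne_top_of_nonneg (by linarith) (measure_ne_top _ _)
  have hx1 : ∀ᵐ x ∂(haarAddCircle (T := (1 : ℝ))), ‖measureConv ν f x‖ₑ
      ≤ (ν Set.univ ^ (1 - 1 / p.toReal)).toNNReal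
          * ‖eLpNorm (fun y => f (x - y)) p ν‖ₑ := by
    filter_upwards [hsec] with x hx
    calc ‖measureConv ν f x‖ₑ ≤ ∫⁻ y, ‖f (x - y)‖ₑ ∂ν := enorm_integral_le_lintegral_enorm _
      _ = eLpNorm (fun y => f (x - y)) 1 ν := eLpNorm_one_eq_lintegral_enorm.symm
      _ ≤ _ := eLpNorm_le_eLpNorm_mul_rpow_measure_univ hp hx
      _ = _ := by
        rw [enorm_eq_self, ENNReal.coe_toNNReal hfin, mul_comm]
        simp
  refine (eLpNorm_le_nnreal_smul_eLpNorm_of_ae_le_mul' hx1 p).trans ?_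
  rw [ENNReal.smul_def, ENNReal.coe_toNNReal hfin, smul_eq_mul]
  refine (mul_le_mul_right (eLpNorm_section_le ν hp hf) _).trans (le_of_eq ?_)
  rw [mul_left_comm, ← ENNReal.rpow_add_of_nonneg _ _ (by linarith) (by positivity),
    sub_add_cancel, ENNReal.rpow_one, mul_comm]

theorem memLp_measureConv {p : ℝ≥0∞} (hp : 1 ≤ p) {f : UnitAddCircle → ℂ}
    (hf : MemLp f p haarAddCircle) : MemLp (measureConv ν f) p haarAddCircle :=
  ⟨(aestronglyMeasurable_sub_circle ν hf.1).integral_prod_right',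
    (eLpNorm_measureConv_le ν hp hf.1).trans_lt
      (ENNReal.mul_lt_top (measure_lt_top _ _) hf.2)⟩

theorem ae_integrable_section {p : ℝ≥0∞} (hp : 1 ≤ p) {f : UnitAddCircle → ℂ}
    (hf : MemLp f p haarAddCircle) :
    ∀ᵐ x ∂(haarAddCircle (T := (1 : ℝ))), Integrable (fun y => f (x - y)) ν := by
  have h1 : Integrable (fun z : UnitAddCircle × UnitAddCircle => f z.1)
      ((haarAddCircle (T := (1 : ℝ))).prod ν) := (hf.integrable hp).comp_fst ν
  exact ((measurePreserving_sub_prod haarAddCircle ν).integrable_comp_of_integrable h1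
    ).prod_right_ae

/-- The operator `f ↦ ν * f` on the complex space `L^p` of the circle, as a linear map. -/
noncomputable def convLinearMap (p : ℝ≥0∞) [hp : Fact (1 ≤ p)] :
    Lp ℂ p (haarAddCircle (T := (1 : ℝ))) →ₗ[ℂ] Lp ℂ p (haarAddCircle (T := (1 : ℝ))) where
  toFun f := (memLp_measureConv ν hp.out (Lp.memLp f)).toLp (measureConv ν f)
  map_add' f g := by
    rw [← MemLp.toLp_add]
    refine MemLp.toLp_congr _ _ ?_
    filter_upwards [measureConv_congr ν (Lp.coeFn_add f g),
      ae_integrable_section ν hp.out (Lp.memLp f),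
      ae_integrable_section ν hp.out (Lp.memLp g)] with x h1 h2 h3
    rw [h1]
    exact integral_add h2 h3
  map_smul' c f := by
    rw [RingHom.id_apply, ← MemLp.toLp_const_smul]
    refine MemLp.toLp_congr _ _ ?_
    filter_upwards [measureConv_congr ν (Lp.coeFn_smul c f)] with x h1
    rw [h1]
    exact integral_smul c _

theorem convLinearMap_ae_eq (p : ℝ≥0∞) [hp : Fact (1 ≤ p)]
    (f : Lp ℂ p (haarAddCircle (T := (1 : ℝ)))) :
    convLinearMap ν p f =ᵐ[haarAddCircle] measureConv ν f :=
  (memLp_measureConv ν hp.out (Lp.memLp f)).coeFn_toLp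

theorem norm_convLinearMap_le (p : ℝ≥0∞) [hp : Fact (1 ≤ p)]
    (f : Lp ℂ p (haarAddCircle (T := (1 : ℝ)))) :
    ‖convLinearMap ν p f‖ ≤ ν.real Set.univ * ‖f‖ := by
  rw [Lp.norm_def, Lp.norm_def, eLpNorm_congr_ae (convLinearMap_ae_eq ν p f), Measure.real,
    ← ENNReal.toReal_mul]
  exact ENNReal.toReal_mono (ENNReal.mul_ne_top (measure_ne_top _ _) (Lp.eLpNorm_ne_top f))
    (eLpNorm_measureConv_le ν hp.out (Lp.aestronglyMeasurable f))

/-- The convolution operator `T_ν f = ν * f` on the complex space `L^p` of the circle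
(with normalized Haar measure), where `(ν * f)(x) = ∫ f (x - y) dν(y)`, as a bounded operator. -/
noncomputable def convOperator (p : ℝ≥0∞) [Fact (1 ≤ p)] :
    Lp ℂ p (haarAddCircle (T := (1 : ℝ))) →L[ℂ] Lp ℂ p (haarAddCircle (T := (1 : ℝ))) :=
  (convLinearMap ν p).mkContinuous (ν.real Set.univ) (norm_convLinearMap_le ν p)

theorem convOperator_ae_eq (p : ℝ≥0∞) [Fact (1 ≤ p)]
    (f : Lp ℂ p (haarAddCircle (T := (1 : ℝ)))) :
    convOperator ν p f =ᵐ[haarAddCircle] fun x => ∫ y, f (x - y) ∂ν :=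
  convLinearMap_ae_eq ν p f

end Convolution

/-! Convolution by `ν` multiplies the `n`-th character by the Fourier–Stieltjes coefficient of `ν`
at `n`. Let `K` be the closure of the set of all coefficients. On `L²` the spectrum is controlled by
`K` alone; on the other `L^p` spaces a multiplier may have a larger spectrum. The proof shows that a
countable `K` rules this out, and that `K` is countable for the Cantor–Lebesgue measure.

Countable `K` contains the spectrum (`spectrum_convOperator_subset`). A countable compact set has
capacity zero, so for each small `ε` there is a monic `Q` with roots in `K`, of some degree `n`,
with `|Q| ≤ (2ε)^n` on `K`. Thus `Q(T)` has norm at most `(2ε)^n` on `L²`, and trivially at most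
`2^n` on `L¹` and `L^∞`. Interpolation bounds it on `L^p` by `C ((2ε)^a 2^b)^n` with `a > 0` and `C`
independent of `Q`. If `z` is in the spectrum at distance `d > 0` from `K`, then `d^n ≤ |Q(z)| ≤
‖Q(T)‖`. Applying this to powers of `Q` removes `C`, and a small `ε` gives a contradiction.

`K` is countable (`countable_closure_range_coeff`). Up to sign, the `n`-th coefficient is `∏ cos (π
n (θ-1) θ^{-k-1})`. A nonzero limit that is not itself a coefficient comes from infinitely many `n`
whose phases are `ℓ²`-close to the integers, uniformly in `n`. Rescaling such phases and passing to
a limit gives `x ≠ 0` with the distances of `x θ^k` to the integers in `ℓ²`; by Pisot's theorem `θ`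
is then a Pisot number.

For a Pisot number, the integers nearest to the phases satisfy the recurrence of the minimal
polynomial of `θ` except at boundedly many places, with bounded integer defects. Solving the
recurrence writes the reduced phases as boundedly many Green sequences plus `s θ^{-k}` with `s` in a
finite set (`exists_reducedPhase_expansion`). Along an ultrafilter the sources form clusters that
move infinitely far apart, and the cosine product splits into one factor per cluster
(`IsAsymptoticSum.tendsto_cosProd`). The factors come from a countable set, hence so do the limits.
-/

/-! ### Diagonalisation of convolution operators by characters. -/

/-- A bounded operator that is diagonal in a Hilbert basis is bounded by any bound for its
diagonal entries. -/
theorem HilbertBasis.norm_apply_le_of_diagonal {ι E : Type*} [NormedAddCommGroup E]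
    [InnerProductSpace ℂ E] (b : HilbertBasis ι ℂ E) (S : E →L[ℂ] E) (c : ι → ℂ)
    (hS : ∀ i, S (b i) = c i • b i) {B : ℝ} (hB : 0 ≤ B) (hc : ∀ i, ‖c i‖ ≤ B) (f : E) :
    ‖S f‖ ≤ B * ‖f‖ := by
  classical
  have hcoef : ∀ i, b.repr (S f) i = c i * b.repr f i := by
    intro i
    have h1 : HasSum (fun j => b.repr f j • c j • b j) (S f) := by
      simpa [hS] using S.hasSum (b.hasSum_repr f)
    have h2 := (innerSL ℂ (b i)).hasSum h1
    have h3 : HasSum (fun j => innerSL ℂ (b i) (b.repr f j • c j • b j))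
        (c i * b.repr f i) := by
      have := hasSum_single (f := fun j => innerSL ℂ (b i) (b.repr f j • c j • b j)) i (by
        intro j hj
        simp [orthonormal_iff_ite.1 b.orthonormal i j, hj.symm])
      convert this using 1
      simp [b.orthonormal.1 i, mul_comm]
    rw [b.repr_apply_apply]
    exact h2.unique h3
  have hsq : ∀ g : E, HasSum (fun i => ‖b.repr g i‖ ^ 2) (‖g‖ ^ 2) := by
    intro g
    rw [← b.repr.norm_map g]
    simpa using lp.hasSum_norm (p := 2) (by norm_num) (b.repr g)
  have h4 : ‖S f‖ ^ 2 ≤ (B * ‖f‖) ^ 2 := by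
    rw [mul_pow]
    refine hasSum_le (fun i => ?_) (hsq (S f)) ((hsq f).mul_left (B ^ 2))
    rw [hcoef, norm_mul, mul_pow]
    gcongr
    exact hc i
  exact le_of_sq_le_sq h4 (by positivity)

section

variable (ν : Measure UnitAddCircle) [IsFiniteMeasure ν]

/-- The Fourier–Stieltjes coefficients of a measure on the circle. -/
noncomputable def fourierStieltjesCoeff (ν : Measure UnitAddCircle) (n : ℤ) : ℂ :=
  ∫ y, fourier (-n) y ∂ν

theorem convOperator_fourierLp (p : ℝ≥0∞) [Fact (1 ≤ p)] (n : ℤ) :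
    convOperator ν p (fourierLp p n) = fourierStieltjesCoeff ν n • fourierLp p n := by
  refine Lp.ext ?_
  have h1 := coeFn_fourierLp (T := (1 : ℝ)) p n
  filter_upwards [convOperator_ae_eq ν p (fourierLp p n), measureConv_congr ν h1, h1,
    Lp.coeFn_smul (fourierStieltjesCoeff ν n) (fourierLp (T := (1 : ℝ)) p n)] with x h2 h3 h4 h5
  rw [h2, h5, Pi.smul_apply, h4]
  refine h3.trans ?_
  simp only [measureConv, fourierStieltjesCoeff, smul_eq_mul, ← integral_mul_const]
  refine integral_congr_ae (Filter.Eventually.of_forall fun y => ?_)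
  simp only [sub_eq_add_neg, fourier_apply, smul_add, AddCircle.toCircle_add, smul_neg, neg_smul]
  push_cast
  ring

theorem aeval_convOperator_fourierLp (p : ℝ≥0∞) [Fact (1 ≤ p)] (Q : Polynomial ℂ) (n : ℤ) :
    Polynomial.aeval (convOperator ν p) Q (fourierLp p n)
      = Q.eval (fourierStieltjesCoeff ν n) • fourierLp p n := by
  induction Q using Polynomial.induction_on' with
  | add P Q hP hQ => simp [hP, hQ, add_smul]
  | monomial k a =>
    have : ∀ k : ℕ, (convOperator ν p ^ k) (fourierLp p n)
        = fourierStieltjesCoeff ν n ^ k • fourierLp p n := by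
      intro k
      induction k with
      | zero => simp
      | succ k ih =>
        rw [pow_succ', mul_apply_eq_comp, ih, map_smul, convOperator_fourierLp,
          smul_smul, pow_succ]
    simp [Polynomial.aeval_monomial, this, smul_smul, Algebra.algebraMap_eq_smul_one]

theorem norm_aeval_convOperator_two_le (Q : Polynomial ℂ) {B : ℝ} (hB : 0 ≤ B)
    (hQ : ∀ n, ‖Q.eval (fourierStieltjesCoeff ν n)‖ ≤ B)
    (f : Lp ℂ 2 (haarAddCircle (T := (1 : ℝ)))) :
    ‖Polynomial.aeval (convOperator ν 2) Q f‖ ≤ B * ‖f‖ := by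
  refine (fourierBasis (T := (1 : ℝ))).norm_apply_le_of_diagonal _
    (fun n => Q.eval (fourierStieltjesCoeff ν n)) (fun n => ?_) hB hQ f
  rw [coe_fourierBasis]
  exact aeval_convOperator_fourierLp ν 2 Q n

/-- Polynomials in the convolution operators on different `L^p` spaces agree. -/
theorem aeval_convOperator_ae_eq (p q : ℝ≥0∞) [Fact (1 ≤ p)] [Fact (1 ≤ q)] (Q : Polynomial ℂ)
    (f : Lp ℂ p (haarAddCircle (T := (1 : ℝ)))) (g : Lp ℂ q (haarAddCircle (T := (1 : ℝ))))
    (h : f =ᵐ[haarAddCircle] g) :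
    Polynomial.aeval (convOperator ν p) Q f =ᵐ[haarAddCircle]
      Polynomial.aeval (convOperator ν q) Q g := by
  induction Q using Polynomial.induction_on' with
  | add P Q hP hQ =>
    simp only [map_add, add_apply]
    exact (Lp.coeFn_add _ _).trans ((hP.add hQ).trans (Lp.coeFn_add _ _).symm)
  | monomial k a =>
    have : ∀ k : ℕ, (convOperator ν p ^ k) f =ᵐ[haarAddCircle] (convOperator ν q ^ k) g := by
      intro k
      induction k with
      | zero => simpa using h
      | succ k ih =>
        rw [pow_succ', pow_succ', mul_apply_eq_comp, mul_apply_eq_comp]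
        exact (convOperator_ae_eq ν p _).trans
          ((measureConv_congr ν ih).trans (convOperator_ae_eq ν q _).symm)
    simp only [Polynomial.aeval_monomial, Algebra.algebraMap_eq_smul_one, smul_mul_assoc, one_mul,
      smul_apply]
    exact (Lp.coeFn_smul _ _).trans (((this k).const_smul a).trans (Lp.coeFn_smul _ _).symm)

theorem norm_convOperator_le (p : ℝ≥0∞) [Fact (1 ≤ p)] :
    ‖convOperator ν p‖ ≤ ν.real Set.univ :=
  LinearMap.mkContinuous_norm_le _ measureReal_nonneg _

end

/-- The crude end-point estimate for the interpolation, applied on `L¹` and `L^∞`, where nothing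
better than the triangle inequality is used. -/
theorem norm_aeval_prod_X_sub_C_le {A : Type*} [NormedRing A] [NormedAlgebra ℂ A]
    (h1 : ‖(1 : A)‖ ≤ 1) (T : A) {R : ℝ} (s : Multiset ℂ) (hs : ∀ x ∈ s, ‖T‖ + ‖x‖ ≤ R) :
    ‖Polynomial.aeval T (s.map fun x => Polynomial.X - Polynomial.C x).prod‖
      ≤ R ^ Multiset.card s := by
  induction s using Multiset.induction_on with
  | empty => simpa using h1
  | cons a s ih =>
    have ha := hs a (Multiset.mem_cons_self a s)
    have h2 : ‖T - algebraMap ℂ A a‖ ≤ R := by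
      refine (norm_sub_le _ _).trans (le_trans ?_ ha)
      rw [norm_algebraMap]
      nlinarith [norm_nonneg a]
    rw [Multiset.map_cons, Multiset.prod_cons, map_mul, Multiset.card_cons, pow_succ']
    refine (norm_mul_le _ _).trans ?_
    refine mul_le_mul (by simpa using h2) (ih fun x hx => hs x (Multiset.mem_cons_of_mem hx))
      (norm_nonneg _) ((norm_nonneg _).trans h2)

/-! ### Marcinkiewicz interpolation between `L¹`, `L²` and `L^∞`. -/

section Interpolation

variable {α : Type*} [MeasurableSpace α] {μ : Measure α}

/-- Layer-cake bound: a pointwise-in-`t` domination of the distribution function of `F` by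
`∫ K t (G x)` gives a bound for the `p`-th moment of `F`. -/
theorem lintegral_rpow_le_of_meas_lt_le [SFinite μ] {F G : α → ℝ} (hF0 : ∀ x, 0 ≤ F x)
    (hF : AEMeasurable F μ) (hG0 : ∀ x, 0 ≤ G x) (hG : Measurable G) {p : ℝ} (hp : 0 < p)
    (K : ℝ → ℝ → ℝ≥0∞) (hK : Measurable (Function.uncurry K)) (C : ℝ≥0∞)
    (hμ : ∀ t, 0 < t → μ {x | t < F x} ≤ ∫⁻ x, K t (G x) ∂μ)
    (hC : ∀ g, 0 ≤ g → ∫⁻ t in Set.Ioi (0 : ℝ), K t g * ENNReal.ofReal (t ^ (p - 1))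
      ≤ C * ENNReal.ofReal (g ^ p)) :
    ∫⁻ x, ENNReal.ofReal (F x ^ p) ∂μ
      ≤ ENNReal.ofReal p * C * ∫⁻ x, ENNReal.ofReal (G x ^ p) ∂μ := by
  have hm : Measurable fun z : ℝ × α => K z.1 (G z.2) :=
    hK.comp (measurable_fst.prodMk (hG.comp measurable_snd))
  have hm' : Measurable fun z : ℝ × α => K z.1 (G z.2) * ENNReal.ofReal (z.1 ^ (p - 1)) :=
    hm.mul ((measurable_fst.pow_const _).ennreal_ofReal)
  rw [lintegral_rpow_eq_lintegral_meas_lt_mul μ (Filter.Eventually.of_forall hF0) hF hp, mul_assoc]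
  gcongr
  calc ∫⁻ t in Set.Ioi (0 : ℝ), μ {a | t < F a} * ENNReal.ofReal (t ^ (p - 1))
      ≤ ∫⁻ t in Set.Ioi (0 : ℝ), ∫⁻ x, K t (G x) * ENNReal.ofReal (t ^ (p - 1)) ∂μ := by
        refine setLIntegral_mono' measurableSet_Ioi fun t ht => ?_
        have hmt : Measurable fun x => K t (G x) := hm.comp measurable_prodMk_left
        rw [lintegral_mul_const _ hmt]
        gcongr
        exact hμ t ht
    _ = ∫⁻ x, (∫⁻ t in Set.Ioi (0 : ℝ), K t (G x) * ENNReal.ofReal (t ^ (p - 1))) ∂μ :=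
        lintegral_lintegral_swap hm'.aemeasurable
    _ ≤ ∫⁻ x, C * ENNReal.ofReal (G x ^ p) ∂μ := lintegral_mono fun x => hC _ (hG0 x)
    _ = _ := lintegral_const_mul _ ((hG.pow_const _).ennreal_ofReal)

theorem lintegral_Ioo_zero_rpow {a r : ℝ} (ha : 0 ≤ a) (hr : -1 < r) :
    ∫⁻ t in Set.Ioo 0 a, ENNReal.ofReal (t ^ r) = ENNReal.ofReal (a ^ (r + 1) / (r + 1)) := by
  rcases ha.eq_or_lt with rfl | ha
  · simp [Real.zero_rpow (by linarith : r + 1 ≠ 0)]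
  rw [← ofReal_integral_eq_lintegral_ofReal
    ((intervalIntegral.integrableOn_Ioo_rpow_iff ha).2 hr)]
  · rw [← integral_Ioc_eq_integral_Ioo, ← intervalIntegral.integral_of_le ha.le,
      integral_rpow (Or.inl hr), Real.zero_rpow (by linarith), sub_zero]
  · filter_upwards [ae_restrict_mem measurableSet_Ioo] with t ht
    exact Real.rpow_nonneg ht.1.le _

theorem lintegral_Ioi_rpow {a r : ℝ} (ha : 0 < a) (hr : r < -1) :
    ∫⁻ t in Set.Ioi a, ENNReal.ofReal (t ^ r) = ENNReal.ofReal (-a ^ (r + 1) / (r + 1)) := by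
  rw [← ofReal_integral_eq_lintegral_ofReal (integrableOn_Ioi_rpow_of_lt hr ha),
    integral_Ioi_rpow_of_lt hr ha]
  filter_upwards [ae_restrict_mem measurableSet_Ioi] with t ht
  exact Real.rpow_nonneg (ha.trans ht).le _

/-- An operator on `L¹` is bounded by `B` on the functions that lie in `L^r`. -/
def BoundedOnLp (S : Lp ℂ 1 μ →ₗ[ℂ] Lp ℂ 1 μ) (r : ℝ≥0∞) (B : ℝ) : Prop :=
  ∀ f : Lp ℂ 1 μ, MemLp f r μ → eLpNorm (S f) r μ ≤ ENNReal.ofReal B * eLpNorm f r μ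

/-- Chebyshev's inequality for an operator bounded on `L^n`. -/
theorem BoundedOnLp.meas_lt_le {S : Lp ℂ 1 μ →ₗ[ℂ] Lp ℂ 1 μ} {n : ℕ} (hn : n ≠ 0) {B : ℝ}
    (hB : 0 ≤ B) (hS : BoundedOnLp S n B) (f : Lp ℂ 1 μ) (hf : MemLp f n μ) {t : ℝ} (ht : 0 < t) :
    μ {x | t < ‖S f x‖} ≤ ∫⁻ x, ENNReal.ofReal ((B / t) ^ n * ‖f x‖ ^ n) ∂μ := by
  have hn0 : (n : ℝ≥0∞) ≠ 0 := by exact_mod_cast hn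
  have hn1 : (n : ℝ≥0∞) ≠ ∞ := by simp
  have htn : ENNReal.ofReal (t ^ n) ≠ 0 := by simpa using pow_pos ht n
  have e1 : ∀ g : α → ℂ, eLpNorm g n μ ^ n = ∫⁻ x, ENNReal.ofReal (‖g x‖ ^ n) ∂μ := by
    intro g
    rw [eLpNorm_eq_lintegral_rpow_enorm_toReal hn0 hn1, ENNReal.toReal_natCast,
      ← ENNReal.rpow_natCast, ← ENNReal.rpow_mul, one_div,
      inv_mul_cancel₀ (by exact_mod_cast hn), ENNReal.rpow_one]
    refine lintegral_congr fun x => ?_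
    rw [ENNReal.rpow_natCast, ENNReal.ofReal_pow (norm_nonneg _), ofReal_norm]
  have h1 := mul_meas_ge_le_pow_eLpNorm μ hn0 hn1 (Lp.aestronglyMeasurable (S f))
    (ENNReal.ofReal (t ^ n))
  rw [ENNReal.toReal_natCast, ENNReal.rpow_natCast] at h1
  have h2 : μ {x | t < ‖S f x‖}
      ≤ μ {x | ENNReal.ofReal (t ^ n) ≤ ‖S f x‖ₑ ^ (n : ℝ)} := by
    refine measure_mono fun x hx => ?_
    simp only [Set.mem_ofPred_eq] at hx ⊢
    rw [ENNReal.rpow_natCast, ← ofReal_norm, ← ENNReal.ofReal_pow (norm_nonneg _)]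
    exact ENNReal.ofReal_le_ofReal (pow_le_pow_left₀ ht.le hx.le n)
  have h3 : ENNReal.ofReal (t ^ n) * μ {x | t < ‖S f x‖}
      ≤ ENNReal.ofReal (B ^ n) * ∫⁻ x, ENNReal.ofReal (‖f x‖ ^ n) ∂μ := by
    rw [← e1, ENNReal.ofReal_pow hB, ← mul_pow]
    exact (mul_le_mul_right h2 _).trans (h1.trans (pow_le_pow_left₀ zero_le (hS f hf) n))
  simp_rw [ENNReal.ofReal_mul (pow_nonneg (div_nonneg hB ht.le) n)]
  rw [lintegral_const_mul' _ _ ENNReal.ofReal_ne_top, div_pow,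
    ENNReal.ofReal_div_of_pos (pow_pos ht n), ENNReal.div_eq_inv_mul, mul_assoc]
  rw [← ENNReal.mul_le_mul_iff_right htn ENNReal.ofReal_ne_top, ← mul_assoc (ENNReal.ofReal _),
    ENNReal.mul_inv_cancel htn ENNReal.ofReal_ne_top, one_mul]
  exact h3

/-- Splitting of an `L¹` function at height `s`. -/
theorem exists_split_at_height [IsFiniteMeasure μ] (f : Lp ℂ 1 μ) (s : ℝ) :
    ∃ lo hi : Lp ℂ 1 μ, f = lo + hi ∧
      (lo =ᵐ[μ] {x | ‖f x‖ ≤ s}.indicator f) ∧ (hi =ᵐ[μ] {x | s < ‖f x‖}.indicator f) := by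
  have hm : Measurable fun x => ‖f x‖ := (Lp.stronglyMeasurable f).norm.measurable
  have h1 : MeasurableSet {x | ‖f x‖ ≤ s} := measurableSet_le hm measurable_const
  have h2 : MeasurableSet {x | s < ‖f x‖} := measurableSet_lt measurable_const hm
  have m1 := (Lp.memLp f).indicator h1
  have m2 := (Lp.memLp f).indicator h2
  refine ⟨m1.toLp _, m2.toLp _, ?_, m1.coeFn_toLp, m2.coeFn_toLp⟩
  refine Lp.ext ?_
  filter_upwards [Lp.coeFn_add (m1.toLp _) (m2.toLp _), m1.coeFn_toLp, m2.coeFn_toLp]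
    with x h3 h4 h5
  rw [h3, Pi.add_apply, h4, h5]
  by_cases hx : ‖f x‖ ≤ s
  · simp [Set.indicator, hx]
  · simp [Set.indicator, hx, not_le.1 hx]

theorem memLp_lo [IsFiniteMeasure μ] {f lo : Lp ℂ 1 μ} {s : ℝ}
    (h : lo =ᵐ[μ] {x | ‖f x‖ ≤ s}.indicator f) (hs : 0 ≤ s) (r : ℝ≥0∞) : MemLp lo r μ := by
  refine MemLp.of_bound (Lp.aestronglyMeasurable lo) s ?_
  filter_upwards [h] with x hx
  rw [hx]
  by_cases h : ‖f x‖ ≤ s <;> simp [h, hs]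

theorem memLp_hi {f hi : Lp ℂ 1 μ} {s : ℝ}
    (h : hi =ᵐ[μ] {x | s < ‖f x‖}.indicator f) {r : ℝ≥0∞} (hf : MemLp f r μ) :
    MemLp hi r μ := by
  refine (memLp_congr_ae h).2 (hf.indicator ?_)
  exact measurableSet_lt measurable_const (Lp.stronglyMeasurable f).norm.measurable

/-- The Marcinkiewicz interpolation between `L²` and `L^∞`. -/
theorem BoundedOnLp.lintegral_rpow_le_of_two_lt [IsFiniteMeasure μ] {p : ℝ} (hp : 2 < p)
    {S : Lp ℂ 1 μ →ₗ[ℂ] Lp ℂ 1 μ} {A B : ℝ} (hA : 0 < A) (hB : 0 < B)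
    (hS2 : BoundedOnLp S 2 B) (hSt : BoundedOnLp S ∞ A) (f : Lp ℂ 1 μ)
    (hf : MemLp f 2 μ) :
    ∫⁻ x, ENNReal.ofReal (‖S f x‖ ^ p) ∂μ ≤
      ENNReal.ofReal (p * (4 * 2 ^ (p - 2) / (p - 2)) * B ^ 2 * A ^ (p - 2)) *
        ∫⁻ x, ENNReal.ofReal (‖f x‖ ^ p) ∂μ := by
  have hGm : Measurable fun x => ‖f x‖ := (Lp.stronglyMeasurable f).norm.measurable
  have key := lintegral_rpow_le_of_meas_lt_le (μ := μ) (F := fun x => ‖S f x‖)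
    (G := fun x => ‖f x‖) (fun _ => norm_nonneg _) (Lp.aestronglyMeasurable _).norm.aemeasurable
    (fun _ => norm_nonneg _) hGm (p := p) (by linarith)
    (fun t g => if t < 2 * A * g then ENNReal.ofReal ((2 * B / t) ^ 2 * g ^ 2) else 0)
    (by
      refine Measurable.ite (measurableSet_lt measurable_fst (measurable_snd.const_mul _)) ?_
        measurable_const
      fun_prop)
    (ENNReal.ofReal ((4 * 2 ^ (p - 2) / (p - 2)) * B ^ 2 * A ^ (p - 2))) ?_ ?_
  · rw [← ENNReal.ofReal_mul (by linarith)] at key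
    convert key using 3
    ring
  · intro t ht
    -- The height `t / (2A)` makes `S lo` at most `t / 2` almost everywhere, so only `S hi` can
    -- carry `S f` above `t`; Chebyshev in `L²` handles `hi`.
    obtain ⟨lo, hi, h1, h2, h3⟩ := exists_split_at_height f (t / (2 * A))
    have hs : 0 ≤ t / (2 * A) := by positivity
    have hlo : ∀ᵐ x ∂μ, ‖S lo x‖ ≤ t / 2 := by
      have h4 := hSt lo (memLp_lo h2 hs _)
      have h5 : eLpNorm lo ∞ μ ≤ ENNReal.ofReal (t / (2 * A)) := by
        rw [eLpNorm_exponent_top]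
        refine eLpNormEssSup_le_of_ae_bound ?_
        filter_upwards [h2] with x hx
        rw [hx]
        by_cases h : ‖f x‖ ≤ t / (2 * A)
        · simp [h]
        · simp [h, hs]
      have h6 : eLpNorm (S lo) ∞ μ ≤ ENNReal.ofReal (t / 2) := by
        refine h4.trans ((mul_le_mul_right h5 _).trans (le_of_eq ?_))
        rw [← ENNReal.ofReal_mul hA.le]
        congr 1
        field_simp
      rw [eLpNorm_exponent_top] at h6
      filter_upwards [ae_le_eLpNormEssSup (f := S lo) (μ := μ)] with x hx
      have := hx.trans h6
      rwa [← ofReal_norm, ENNReal.ofReal_le_ofReal_iff (by positivity)] at this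
    have hle : μ {x | t < ‖S f x‖} ≤ μ {x | t / 2 < ‖S hi x‖} := by
      refine measure_mono_ae ?_
      filter_upwards [hlo, Lp.coeFn_add (S lo) (S hi)] with x hx1 hx2 hx3
      change t < ‖S f x‖ at hx3
      change t / 2 < ‖S hi x‖
      rw [h1, map_add, hx2, Pi.add_apply] at hx3
      linarith [norm_add_le (S lo x) (S hi x)]
    refine hle.trans ((BoundedOnLp.meas_lt_le (n := 2) two_ne_zero hB.le (by simpa using hS2) hi
      (by simpa using memLp_hi h3 hf) (half_pos ht)).trans (le_of_eq (lintegral_congr_ae ?_)))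
    filter_upwards [h3] with x hx
    rw [hx]
    have : t / (2 * A) < ‖f x‖ ↔ t < 2 * A * ‖f x‖ := by
      rw [div_lt_iff₀ (by positivity), mul_comm]
    by_cases h : t < 2 * A * ‖f x‖
    · rw [Set.indicator_of_mem (show x ∈ {x | t / (2 * A) < ‖f x‖} from this.2 h), if_pos h]
      congr 2
      field_simp
    · rw [Set.indicator_of_notMem
        (show x ∉ {x | t / (2 * A) < ‖f x‖} from fun h' => h (this.1 h')), if_neg h]
      simp
  · intro g hg
    have e : ∀ t ∈ Set.Ioi (0 : ℝ), (if t < 2 * A * g then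
        ENNReal.ofReal ((2 * B / t) ^ 2 * g ^ 2) else 0) * ENNReal.ofReal (t ^ (p - 1))
        = (Set.Ioo 0 (2 * A * g)).indicator
          (fun t => ENNReal.ofReal (4 * B ^ 2 * g ^ 2) * ENNReal.ofReal (t ^ (p - 3))) t := by
      intro t ht
      have ht : 0 < t := ht
      by_cases h : t < 2 * A * g
      · rw [if_pos h, Set.indicator_of_mem (show t ∈ Set.Ioo 0 (2 * A * g) from ⟨ht, h⟩), ← ENNReal.ofReal_mul (by positivity),
          ← ENNReal.ofReal_mul (by positivity)]
        congr 1
        rw [show p - 1 = (p - 3) + 2 by ring, Real.rpow_add ht, Real.rpow_two]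
        field_simp
        ring
      · rw [if_neg h, Set.indicator_of_notMem (fun h' => h h'.2), zero_mul]
    rw [setLIntegral_congr_fun measurableSet_Ioi e, lintegral_indicator measurableSet_Ioo,
      Measure.restrict_restrict measurableSet_Ioo,
      Set.inter_eq_self_of_subset_left Set.Ioo_subset_Ioi_self,
      lintegral_const_mul' _ _ ENNReal.ofReal_ne_top,
      lintegral_Ioo_zero_rpow (by positivity) (by linarith), ← ENNReal.ofReal_mul (by positivity),
      ← ENNReal.ofReal_mul (by have := sub_pos.2 hp; positivity)]
    refine ENNReal.ofReal_le_ofReal (le_of_eq ?_)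
    rcases hg.eq_or_lt with rfl | hg
    · simp [Real.zero_rpow (by linarith : p ≠ 0)]
    rw [show p - 3 + 1 = p - 2 by ring, Real.mul_rpow (by positivity) hg.le,
      Real.mul_rpow (by positivity) hA.le]
    have : g ^ p = g ^ 2 * g ^ (p - 2) := by
      rw [← Real.rpow_two, ← Real.rpow_add hg]; congr 1; ring
    rw [this]
    ring

/-- The Marcinkiewicz interpolation between `L¹` and `L²`. -/
theorem BoundedOnLp.lintegral_rpow_le_of_lt_two [IsFiniteMeasure μ] {p : ℝ} (hp1 : 1 < p)
    (hp : p < 2) {S : Lp ℂ 1 μ →ₗ[ℂ] Lp ℂ 1 μ} {A B : ℝ} (hA : 0 < A) (hB : 0 < B)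
    (hS1 : BoundedOnLp S 1 A) (hS2 : BoundedOnLp S 2 B) (f : Lp ℂ 1 μ) :
    ∫⁻ x, ENNReal.ofReal (‖S f x‖ ^ p) ∂μ ≤
      ENNReal.ofReal (p * (2 / (p - 1) + 4 / (2 - p)) * A ^ (2 - p) * B ^ (2 * (p - 1))) *
        ∫⁻ x, ENNReal.ofReal (‖f x‖ ^ p) ∂μ := by
  have hGm : Measurable fun x => ‖f x‖ := (Lp.stronglyMeasurable f).norm.measurable
  have hp1' := sub_pos.2 hp1
  have hp' := sub_pos.2 hp
  -- Cutting at height `t / D` leaves the terms `A D^(p-1)` and `B² D^(p-2)`, from `L¹` and `L²`.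
  -- They are equal exactly when `D = B² / A`, which yields the interpolated power of `A` and `B`.
  set D : ℝ := B ^ 2 / A with hD
  have hD0 : 0 < D := by positivity
  have key := lintegral_rpow_le_of_meas_lt_le (μ := μ) (F := fun x => ‖S f x‖)
    (G := fun x => ‖f x‖) (fun _ => norm_nonneg _) (Lp.aestronglyMeasurable _).norm.aemeasurable
    (fun _ => norm_nonneg _) hGm (p := p) (by linarith)
    (fun t g => if t < D * g then ENNReal.ofReal (2 * A / t * g)
      else ENNReal.ofReal ((2 * B / t) ^ 2 * g ^ 2))
    (by
      refine Measurable.ite (measurableSet_lt measurable_fst (measurable_snd.const_mul _)) ?_ ?_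
      all_goals fun_prop)
    (ENNReal.ofReal ((2 / (p - 1) + 4 / (2 - p)) * A ^ (2 - p) * B ^ (2 * (p - 1)))) ?_ ?_
  · rw [← ENNReal.ofReal_mul (by linarith)] at key
    convert key using 3
    ring
  · intro t ht
    obtain ⟨lo, hi, h1, h2, h3⟩ := exists_split_at_height f (t / D)
    have hs : 0 ≤ t / D := by positivity
    have hle : μ {x | t < ‖S f x‖} ≤ μ {x | t / 2 < ‖S hi x‖} + μ {x | t / 2 < ‖S lo x‖} := by
      refine (measure_mono_ae ?_).trans (measure_union_le _ _)
      filter_upwards [Lp.coeFn_add (S lo) (S hi)] with x hx2 hx3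
      change t < ‖S f x‖ at hx3
      change t / 2 < ‖S hi x‖ ∨ t / 2 < ‖S lo x‖
      rw [h1, map_add, hx2, Pi.add_apply] at hx3
      by_contra! hcon
      linarith [norm_add_le (S lo x) (S hi x)]
    refine hle.trans ((add_le_add
      (BoundedOnLp.meas_lt_le (n := 1) one_ne_zero hA.le (by simpa using hS1) hi
        (by simpa using Lp.memLp hi) (half_pos ht))
      (BoundedOnLp.meas_lt_le (n := 2) two_ne_zero hB.le (by simpa using hS2) lo
        (memLp_lo h2 hs _) (half_pos ht))).trans ?_)
    rw [← lintegral_add_left']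
    · refine le_of_eq (lintegral_congr_ae ?_)
      filter_upwards [h2, h3] with x hx2 hx3
      have : t / D < ‖f x‖ ↔ t < D * ‖f x‖ := by
        rw [div_lt_iff₀ (by positivity), mul_comm]
      rw [hx2, hx3]
      by_cases h : t < D * ‖f x‖
      · rw [Set.indicator_of_mem (show x ∈ {x | t / D < ‖f x‖} from this.2 h),
          Set.indicator_of_notMem
            (show x ∉ {x | ‖f x‖ ≤ t / D} from fun h' => absurd (this.2 h) (not_lt.2 h')),
          if_pos h]
        simp only [norm_zero, pow_one]
        rw [zero_pow two_ne_zero, mul_zero, ENNReal.ofReal_zero, add_zero]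
        congr 2
        field_simp
      · rw [Set.indicator_of_notMem
            (show x ∉ {x | t / D < ‖f x‖} from fun h' => h (this.1 h')),
          Set.indicator_of_mem
            (show x ∈ {x | ‖f x‖ ≤ t / D} from not_lt.1 fun h' => h (this.1 h')), if_neg h]
        simp only [norm_zero, pow_one, mul_zero, ENNReal.ofReal_zero, zero_add]
        congr 2
        field_simp
    · exact (((Lp.aestronglyMeasurable hi).norm.aemeasurable.pow_const _).const_mul _).ennreal_ofReal
  · intro g hg
    rcases hg.eq_or_lt with rfl | hg
    · simp
    have hDg : 0 < D * g := by positivity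
    have e1 : ∀ t ∈ Set.Ioo 0 (D * g), (if t < D * g then ENNReal.ofReal (2 * A / t * g)
      else ENNReal.ofReal ((2 * B / t) ^ 2 * g ^ 2)) * ENNReal.ofReal (t ^ (p - 1))
        = ENNReal.ofReal (2 * A * g) * ENNReal.ofReal (t ^ (p - 2)) := by
      rintro t ⟨ht, h⟩
      rw [if_pos h, ← ENNReal.ofReal_mul (by positivity), ← ENNReal.ofReal_mul (by positivity)]
      congr 1
      rw [show p - 1 = (p - 2) + 1 by ring, Real.rpow_add ht, Real.rpow_one]
      field_simp
    have e2 : ∀ t ∈ Set.Ioi (D * g), (if t < D * g then ENNReal.ofReal (2 * A / t * g)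
      else ENNReal.ofReal ((2 * B / t) ^ 2 * g ^ 2)) * ENNReal.ofReal (t ^ (p - 1))
        = ENNReal.ofReal (4 * B ^ 2 * g ^ 2) * ENNReal.ofReal (t ^ (p - 3)) := by
      intro t h
      have ht : 0 < t := hDg.trans h
      rw [if_neg (not_lt.2 (le_of_lt h)), ← ENNReal.ofReal_mul (by positivity),
        ← ENNReal.ofReal_mul (by positivity)]
      congr 1
      rw [show p - 1 = (p - 3) + 2 by ring, Real.rpow_add ht, Real.rpow_two]
      field_simp
      ring
    rw [← Set.Ioc_union_Ioi_eq_Ioi hDg.le, lintegral_union measurableSet_Ioi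
      (Set.disjoint_left.2 fun x hx hx' => not_lt.2 hx.2 hx'),
      setLIntegral_congr Ioo_ae_eq_Ioc.symm,
      setLIntegral_congr_fun measurableSet_Ioo e1, setLIntegral_congr_fun measurableSet_Ioi e2,
      lintegral_const_mul' _ _ ENNReal.ofReal_ne_top,
      lintegral_const_mul' _ _ ENNReal.ofReal_ne_top,
      lintegral_Ioo_zero_rpow hDg.le (by linarith), lintegral_Ioi_rpow hDg (by linarith),
      ← ENNReal.ofReal_mul (by positivity), ← ENNReal.ofReal_mul (by positivity),
      ← ENNReal.ofReal_mul (by positivity), show p - 2 + 1 = p - 1 by ring,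
      show p - 3 + 1 = p - 2 by ring,
      show -(D * g) ^ (p - 2) / (p - 2) = (D * g) ^ (p - 2) / (2 - p) by
        rw [← neg_div_neg_eq, neg_neg, neg_sub],
      ← ENNReal.ofReal_add (by positivity) (by positivity)]
    refine ENNReal.ofReal_le_ofReal (le_of_eq ?_)
    have hBA : (B ^ 2) ^ (p - 1) = B ^ (2 * (p - 1)) := by
      rw [← Real.rpow_natCast, ← Real.rpow_mul hB.le]; norm_num
    have d1 : D ^ (p - 1) * A = A ^ (2 - p) * B ^ (2 * (p - 1)) := by
      have : A ^ (2 - p) = A / A ^ (p - 1) := by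
        rw [show 2 - p = 1 - (p - 1) by ring, Real.rpow_sub hA, Real.rpow_one]
      rw [hD, Real.div_rpow (by positivity) hA.le, hBA, this]
      ring
    have d2 : D ^ (p - 2) * B ^ 2 = A ^ (2 - p) * B ^ (2 * (p - 1)) := by
      rw [← d1, show p - 1 = (p - 2) + 1 by ring, Real.rpow_add hD0, Real.rpow_one, hD]
      field_simp
    have g1 : g * g ^ (p - 1) = g ^ p := by
      rw [← Real.rpow_one_add' hg.le (by linarith)]; congr 1; ring
    have g2 : g ^ 2 * g ^ (p - 2) = g ^ p := by
      rw [← Real.rpow_two, ← Real.rpow_add hg]; congr 1; ring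
    rw [Real.mul_rpow hD0.le hg.le, Real.mul_rpow hD0.le hg.le]
    calc _ = 2 / (p - 1) * (D ^ (p - 1) * A) * (g * g ^ (p - 1))
          + 4 / (2 - p) * (D ^ (p - 2) * B ^ 2) * (g ^ 2 * g ^ (p - 2)) := by
            field_simp
      _ = _ := by rw [d1, d2, g1, g2]; ring

end Interpolation

/-! ### Capacity of countable compact sets. -/

/-- A countable compact set has capacity zero: there are monic polynomials with roots in the set
that are small on the set in comparison with their degree. -/
theorem IsCompact.exists_multiset_prod_sub_le {K : Set ℂ} (hK : IsCompact K) (hc : K.Countable)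
    (hne : K.Nonempty) {R : ℝ} (hR1 : 1 ≤ R)
    (hR : ∀ x ∈ K, ∀ y ∈ K, ‖x - y‖ ≤ R) {ε : ℝ} (hε : 0 < ε)
    (hε1 : ε ≤ 1) :
    ∃ s : Multiset ℂ, 0 < Multiset.card s ∧ (∀ x ∈ s, x ∈ K) ∧
      ∀ z ∈ K, ‖(s.map fun x => z - x).prod‖ ≤ (ε * R) ^ Multiset.card s := by
  obtain ⟨x, rfl⟩ := hc.exists_eq_range hne
  -- The `i`-th point gets a ball of radius `ε^(2^(i+1))` and, below, multiplicity `2^(I-i)`. Inside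
  -- any one of the chosen balls, the single factor of its centre is then at most `ε^(2^(I+1))`. The
  -- total degree is `2^(I+1) - 1`, so this pays for the whole product, and the other factors are
  -- bounded by `R`.
  obtain ⟨t, ht⟩ := hK.elim_finite_subcover
    (fun i : ℕ => Metric.ball (x i) (ε ^ (2 ^ (i + 1)))) (fun i => Metric.isOpen_ball) (by
      rintro _ ⟨i, rfl⟩
      exact Set.mem_iUnion.2 ⟨i, Metric.mem_ball_self (by positivity)⟩)
  set I := t.sup id
  set s : Multiset ℂ := ∑ i ∈ Finset.range (I + 1), Multiset.replicate (2 ^ (I - i)) (x i) with hs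
  have hcard : Multiset.card s = ∑ i ∈ Finset.range (I + 1), 2 ^ (I - i) := by
    simp [hs]
  have hcard' : Multiset.card s + 1 = 2 ^ (I + 1) := by
    have h1 := Finset.sum_range_reflect (fun i => 2 ^ i) (I + 1)
    rw [Nat.add_sub_cancel, Nat.geomSum_eq le_rfl] at h1
    have : 1 ≤ 2 ^ (I + 1) := Nat.one_le_two_pow
    rw [hcard, h1]
    omega
  refine ⟨s, ?_, ?_, ?_⟩
  · have : 2 ^ 1 ≤ 2 ^ (I + 1) := Nat.pow_le_pow_right (by norm_num) (by omega)
    omega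
  · intro y hy
    obtain ⟨i, _, hi⟩ := Multiset.mem_sum.1 hy
    exact ⟨i, (Multiset.eq_of_mem_replicate hi).symm⟩
  · intro z hz
    obtain ⟨i, hi, hzi⟩ := Set.mem_iUnion₂.1 (ht hz)
    have hiI : i ≤ I := Finset.le_sup (f := id) hi
    have hmem : i ∈ Finset.range (I + 1) := Finset.mem_range.2 (by omega)
    have e1 : ‖(s.map fun x => z - x).prod‖
        = ∏ j ∈ Finset.range (I + 1), ‖z - x j‖ ^ (2 ^ (I - j)) := by
      have : (s.map fun x => z - x).prod
          = ∏ j ∈ Finset.range (I + 1), (z - x j) ^ (2 ^ (I - j)) := by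
        rw [hs, ← Multiset.coe_mapAddMonoidHom, map_sum, Multiset.prod_sum]
        simp
      rw [this, norm_prod]
      simp
    rw [e1, ← Finset.mul_prod_erase _ _ hmem, mul_pow, hcard,
      ← Finset.prod_pow_eq_pow_sum (Finset.range (I + 1)) _ R, ← Finset.mul_prod_erase _ _ hmem, ← mul_assoc]
    have h1 : ‖z - x i‖ ^ (2 ^ (I - i)) ≤ ε ^ (2 ^ (I + 1)) := by
      calc ‖z - x i‖ ^ (2 ^ (I - i)) ≤ (ε ^ (2 ^ (i + 1))) ^ (2 ^ (I - i)) := by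
            gcongr
            exact (mem_ball_iff_norm.1 hzi).le
        _ = ε ^ (2 ^ (I + 1)) := by
            rw [← pow_mul, ← pow_add]; congr 2; omega
    have h2 : ε ^ (2 ^ (I + 1)) ≤ ε ^ (∑ i ∈ Finset.range (I + 1), 2 ^ (I - i)) :=
      pow_le_pow_of_le_one hε.le hε1 (by omega)
    have h3 : ∏ j ∈ (Finset.range (I + 1)).erase i, ‖z - x j‖ ^ (2 ^ (I - j))
        ≤ ∏ j ∈ (Finset.range (I + 1)).erase i, R ^ (2 ^ (I - j)) :=
      Finset.prod_le_prod (fun _ _ => by positivity)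
        fun j _ => pow_le_pow_left₀ (norm_nonneg _) (hR _ hz _ ⟨j, rfl⟩) _
    refine mul_le_mul ((h1.trans h2).trans ?_) h3 (by positivity) (by positivity)
    exact le_mul_of_one_le_right (by positivity) (one_le_pow₀ hR1)

/-! ### The spectrum on `L^p` when the coefficients have countable closure. -/

section

variable (ν : Measure UnitAddCircle) [IsFiniteMeasure ν]

/-- The circle has finite measure, so every `L^r` with `r ≥ 1` sits inside `L¹` and the operators
are given there by one formula. Interpolation can thus treat them all as restrictions of the `L¹`
operator. -/
theorem boundedOnLp_aeval_convOperator (r : ℝ≥0∞) [Fact (1 ≤ r)] (Q : Polynomial ℂ) {B : ℝ}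
    (hB : ‖Polynomial.aeval (convOperator ν r) Q‖ ≤ B) :
    BoundedOnLp (μ := haarAddCircle)
      (Polynomial.aeval (convOperator ν 1) Q).toLinearMap r B := by
  intro f hf
  have h1 := aeval_convOperator_ae_eq ν 1 r Q f (hf.toLp f) hf.coeFn_toLp.symm
  rw [← eLpNorm_congr_ae hf.coeFn_toLp]
  change eLpNorm (Polynomial.aeval (convOperator ν 1) Q f) r haarAddCircle ≤ _
  rw [eLpNorm_congr_ae h1, ← Lp.enorm_def, ← Lp.enorm_def, ← ofReal_norm, ← ofReal_norm,
    ← ENNReal.ofReal_mul ((norm_nonneg _).trans hB)]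
  exact ENNReal.ofReal_le_ofReal (ContinuousLinearMap.le_of_opNorm_le _ hB _)

theorem lintegral_ofReal_norm_rpow_eq {α : Type*} [MeasurableSpace α] {μ : Measure α} {p : ℝ≥0∞}
    [Fact (1 ≤ p)] (hp : p ≠ ∞) (f : Lp ℂ p μ) :
    ∫⁻ x, ENNReal.ofReal (‖f x‖ ^ p.toReal) ∂μ = ENNReal.ofReal (‖f‖ ^ p.toReal) := by
  have hp0 : p ≠ 0 := (zero_lt_one.trans_le (Fact.out : 1 ≤ p)).ne'
  have hpos : 0 < p.toReal := ENNReal.toReal_pos hp0 hp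
  rw [← ENNReal.ofReal_rpow_of_nonneg (norm_nonneg _) hpos.le, ofReal_norm, Lp.enorm_def,
    eLpNorm_eq_lintegral_rpow_enorm_toReal hp0 hp, ← ENNReal.rpow_mul, one_div,
    inv_mul_cancel₀ hpos.ne', ENNReal.rpow_one]
  refine lintegral_congr fun x => ?_
  rw [← ENNReal.ofReal_rpow_of_nonneg (norm_nonneg _) hpos.le, ofReal_norm]

theorem norm_le_of_lintegral_rpow_le {α : Type*} [MeasurableSpace α] {μ : Measure α} {p : ℝ≥0∞}
    [Fact (1 ≤ p)] (hp : p ≠ ∞) {f g : Lp ℂ p μ} {D : ℝ} (hD : 0 ≤ D)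
    (h : ∫⁻ x, ENNReal.ofReal (‖g x‖ ^ p.toReal) ∂μ
      ≤ ENNReal.ofReal D * ∫⁻ x, ENNReal.ofReal (‖f x‖ ^ p.toReal) ∂μ) :
    ‖g‖ ≤ D ^ (p.toReal)⁻¹ * ‖f‖ := by
  have hp0 : p ≠ 0 := (zero_lt_one.trans_le (Fact.out : 1 ≤ p)).ne'
  have hpos : 0 < p.toReal := ENNReal.toReal_pos hp0 hp
  rw [lintegral_ofReal_norm_rpow_eq hp, lintegral_ofReal_norm_rpow_eq hp, ← ENNReal.ofReal_mul hD,
    ENNReal.ofReal_le_ofReal_iff (by positivity)] at h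
  have h2 := Real.rpow_le_rpow (by positivity) h (inv_nonneg.2 hpos.le)
  rwa [Real.mul_rpow hD (by positivity), Real.rpow_rpow_inv (norm_nonneg _) hpos.ne',
    Real.rpow_rpow_inv (norm_nonneg _) hpos.ne'] at h2

/-- Interpolation is between `L¹` and `L²` for `p < 2`, and between `L²` and `L^∞` for `p > 2`. What
matters later is that the `L²` bound `B` enters with a positive exponent and that `C`, `a`, `b` do
not depend on `Q`. -/
theorem exists_norm_aeval_convOperator_le (p : ℝ≥0∞) [Fact (1 ≤ p)] (hp1 : 1 < p) (hp : p ≠ ∞) :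
    ∃ C a b : ℝ, 0 ≤ C ∧ 0 < a ∧ ∀ (Q : Polynomial ℂ) (A B : ℝ), 0 < A → 0 < B →
      (∀ n, ‖Q.eval (fourierStieltjesCoeff ν n)‖ ≤ B) →
      ‖Polynomial.aeval (convOperator ν 1) Q‖ ≤ A →
      ‖Polynomial.aeval (convOperator ν ∞) Q‖ ≤ A →
      ‖Polynomial.aeval (convOperator ν p) Q‖ ≤ C * B ^ a * A ^ b := by
  have hr1 : 1 < p.toReal := by
    rw [← ENNReal.toReal_one]; exact (ENNReal.toReal_lt_toReal (by simp) hp).2 hp1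
  have h2 : ∀ (Q : Polynomial ℂ) (B : ℝ), 0 < B →
      (∀ n, ‖Q.eval (fourierStieltjesCoeff ν n)‖ ≤ B) →
      ‖Polynomial.aeval (convOperator ν 2) Q‖ ≤ B := fun Q B hB h =>
    ContinuousLinearMap.opNorm_le_bound _ hB.le (norm_aeval_convOperator_two_le ν Q hB.le h)
  have hmem : ∀ f : Lp ℂ p (haarAddCircle (T := (1 : ℝ))), MemLp f 1 haarAddCircle :=
    fun f => (Lp.memLp f).mono_exponent Fact.out
  have hint : ∀ (Q : Polynomial ℂ) (f : Lp ℂ p (haarAddCircle (T := (1 : ℝ)))) (D : ℝ),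
      (∫⁻ x, ENNReal.ofReal
        (‖Polynomial.aeval (convOperator ν 1) Q ((hmem f).toLp f) x‖ ^ p.toReal) ∂haarAddCircle
        ≤ ENNReal.ofReal D *
          ∫⁻ x, ENNReal.ofReal (‖(hmem f).toLp f x‖ ^ p.toReal) ∂haarAddCircle) →
      ∫⁻ x, ENNReal.ofReal (‖Polynomial.aeval (convOperator ν p) Q f x‖ ^ p.toReal) ∂haarAddCircle
        ≤ ENNReal.ofReal D * ∫⁻ x, ENNReal.ofReal (‖f x‖ ^ p.toReal) ∂haarAddCircle := by
    intro Q f D h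
    have e1 := aeval_convOperator_ae_eq ν p 1 Q f ((hmem f).toLp f) (hmem f).coeFn_toLp.symm
    refine (le_of_eq (lintegral_congr_ae ?_)).trans (h.trans (le_of_eq ?_))
    · filter_upwards [e1] with x hx
      rw [hx]
    · congr 1
      refine lintegral_congr_ae ?_
      filter_upwards [(hmem f).coeFn_toLp] with x hx
      rw [hx]
  rcases lt_trichotomy p.toReal 2 with hlt | heq | hgt
  · have h1 := sub_pos.2 hr1
    have h3 := sub_pos.2 hlt
    refine ⟨(p.toReal * (2 / (p.toReal - 1) + 4 / (2 - p.toReal))) ^ (p.toReal)⁻¹,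
      2 * (p.toReal - 1) * (p.toReal)⁻¹, (2 - p.toReal) * (p.toReal)⁻¹, by positivity,
      by positivity, fun Q A B hA hB hQ hQ1 hQt => ?_⟩
    refine ContinuousLinearMap.opNorm_le_bound _ (by positivity) fun f => ?_
    have key := hint Q f _ ((boundedOnLp_aeval_convOperator ν 1 Q hQ1).lintegral_rpow_le_of_lt_two
      hr1 hlt hA hB (boundedOnLp_aeval_convOperator ν 2 Q (h2 Q B hB hQ)) ((hmem f).toLp f))
    refine (norm_le_of_lintegral_rpow_le hp (by positivity) key).trans (le_of_eq ?_)
    rw [Real.mul_rpow (by positivity) (by positivity), Real.mul_rpow (by positivity) (by positivity),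
      ← Real.rpow_mul hA.le, ← Real.rpow_mul hB.le]
    ring
  · have hp2 : p = 2 := by
      rw [← ENNReal.ofReal_toReal hp, heq]; simp
    subst hp2
    exact ⟨1, 1, 0, zero_le_one, zero_lt_one, fun Q A B hA hB hQ _ _ => by simpa using h2 Q B hB hQ⟩
  · have h1 := sub_pos.2 hgt
    refine ⟨(p.toReal * (4 * 2 ^ (p.toReal - 2) / (p.toReal - 2))) ^ (p.toReal)⁻¹,
      2 * (p.toReal)⁻¹, (p.toReal - 2) * (p.toReal)⁻¹, by positivity, by positivity,
      fun Q A B hA hB hQ hQ1 hQt => ?_⟩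
    refine ContinuousLinearMap.opNorm_le_bound _ (by positivity) fun f => ?_
    have hp2 : (2 : ℝ≥0∞) ≤ p := by
      rw [← ENNReal.ofReal_toReal hp]
      simpa using ENNReal.ofReal_le_ofReal hgt.le
    have hf2 : MemLp ((hmem f).toLp f) 2 haarAddCircle :=
      (memLp_congr_ae (hmem f).coeFn_toLp).2 ((Lp.memLp f).mono_exponent hp2)
    have key := hint Q f _
      ((boundedOnLp_aeval_convOperator ν 2 Q (h2 Q B hB hQ)).lintegral_rpow_le_of_two_lt
      hgt hA hB (boundedOnLp_aeval_convOperator ν ∞ Q hQt) ((hmem f).toLp f) hf2)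
    refine (norm_le_of_lintegral_rpow_le hp (by positivity) key).trans (le_of_eq ?_)
    rw [Real.mul_rpow (by positivity) (by positivity), Real.mul_rpow (by positivity) (by positivity),
      ← Real.rpow_two, ← Real.rpow_mul hA.le, ← Real.rpow_mul hB.le]

theorem norm_fourierStieltjesCoeff_le (n : ℤ) :
    ‖fourierStieltjesCoeff ν n‖ ≤ ν.real Set.univ := by
  refine (norm_integral_le_of_norm_le_const (C := 1) ?_).trans (by simp)
  exact Filter.Eventually.of_forall fun y => by rw [fourier_apply, Circle.norm_coe]

/-- If the closure of the Fourier–Stieltjes coefficients of a probability measure is countable,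
then it contains the spectrum of the convolution operator on `L^p`, `1 < p < ∞`. -/
theorem spectrum_convOperator_subset [IsProbabilityMeasure ν] (p : ℝ≥0∞) [Fact (1 ≤ p)]
    (hp1 : 1 < p) (hp : p ≠ ∞)
    (hc : (closure (Set.range (fourierStieltjesCoeff ν))).Countable) :
    spectrum ℂ (convOperator ν p) ⊆ closure (Set.range (fourierStieltjesCoeff ν)) := by
  intro z hz
  by_contra hzK
  set K := closure (Set.range (fourierStieltjesCoeff ν)) with hK
  have hν : ν.real Set.univ = 1 := by simp
  have hK1 : ∀ x ∈ K, ‖x‖ ≤ 1 := by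
    have : K ⊆ Metric.closedBall 0 1 := by
      refine closure_minimal ?_ Metric.isClosed_closedBall
      rintro _ ⟨n, rfl⟩
      simpa [hν] using norm_fourierStieltjesCoeff_le ν n
    exact fun x hx => by simpa using this hx
  have hcomp : IsCompact K := Metric.isCompact_of_isClosed_isBounded isClosed_closure
    ((Metric.isBounded_closedBall (x := (0 : ℂ)) (r := 1)).subset
      fun x hx => by simpa using hK1 x hx)
  have hne : K.Nonempty := (Set.range_nonempty _).closure
  set d := Metric.infDist z K with hd
  have hd0 : 0 < d := (isClosed_closure.notMem_iff_infDist_pos hne).1 hzK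
  obtain ⟨C, a, b, hC, ha, hb⟩ := exists_norm_aeval_convOperator_le ν p hp1 hp
  -- `K` lies in the closed unit disc, so `2` bounds both its diameter and `‖T‖ + ‖x‖`. The quantity
  -- compared with `d` is the growth per degree of the interpolated bound.
  obtain ⟨ε, ⟨hε0, hε1⟩, hεd⟩ : ∃ ε : ℝ, (0 < ε ∧ ε ≤ 1) ∧ (ε * 2) ^ a * 2 ^ b < d := by
    have ht : Filter.Tendsto (fun ε : ℝ => (ε * 2) ^ a * 2 ^ b) (nhdsWithin 0 (Set.Ioi 0))
        (nhds 0) := by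
      have : ContinuousAt (fun ε : ℝ => (ε * 2) ^ a * 2 ^ b) 0 :=
        ((continuousAt_id.mul continuousAt_const).rpow_const (Or.inr ha.le)).mul continuousAt_const
      have h := this.tendsto.mono_left (nhdsWithin_le_nhds (s := Set.Ioi (0 : ℝ)))
      simpa [Real.zero_rpow ha.ne'] using h
    have h1 := ht.eventually (gt_mem_nhds hd0)
    have h2 : ∀ᶠ ε : ℝ in nhdsWithin 0 (Set.Ioi 0), ε ∈ Set.Ioc (0 : ℝ) 1 :=
      Ioc_mem_nhdsGT zero_lt_one
    obtain ⟨ε, h3, h4⟩ := (h1.and h2).exists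
    exact ⟨ε, h4, h3⟩
  obtain ⟨s, hs0, hsK, hs⟩ := hcomp.exists_multiset_prod_sub_le hc hne one_le_two
    (fun x hx y hy => (norm_sub_le _ _).trans (by linarith [hK1 x hx, hK1 y hy])) hε0 hε1
  set n := Multiset.card s
  set X := (ε * 2) ^ a * 2 ^ b with hX
  have hX0 : 0 < X := by positivity
  have hT : ∀ r : ℝ≥0∞, ∀ [Fact (1 ≤ r)], ∀ x ∈ K, ‖convOperator ν r‖ + ‖x‖ ≤ 2 := by
    intro r _ x hx
    have := norm_convOperator_le ν r
    linarith [hK1 x hx]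
  -- Repeating the roots `m` times replaces the polynomial by its `m`-th power; the constant `C`
  -- stays fixed while the degree grows, which is incompatible with `d / X > 1`.
  have key : ∀ m : ℕ, (d / X) ^ (n * m) ≤ C := by
    intro m
    set Q : Polynomial ℂ := ((m • s).map fun x => Polynomial.X - Polynomial.C x).prod with hQ
    have hmem : ∀ x ∈ m • s, x ∈ K := fun x hx => hsK x (Multiset.mem_of_mem_nsmul hx)
    have hcard : Multiset.card (m • s) = n * m := by simp [n, mul_comm]
    have heval : ∀ w, Q.eval w = (s.map fun x => w - x).prod ^ m := by
      intro w
      rw [hQ, Multiset.map_nsmul, Multiset.prod_nsmul, Polynomial.eval_pow,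
        Polynomial.eval_multiset_prod, Multiset.map_map]
      simp
    have h1 : ‖Polynomial.aeval (convOperator ν p) Q‖
        ≤ C * ((ε * 2) ^ (n * m)) ^ a * ((2 : ℝ) ^ (n * m)) ^ b := by
      refine hb Q _ _ (by positivity) (by positivity) (fun k => ?_) ?_ ?_
      · rw [heval, norm_pow, pow_mul]
        exact pow_le_pow_left₀ (norm_nonneg _) (hs _ (subset_closure ⟨k, rfl⟩)) m
      · rw [← hcard]
        exact norm_aeval_prod_X_sub_C_le ContinuousLinearMap.norm_id_le _ _
          fun x hx => hT 1 x (hmem x hx)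
      · rw [← hcard]
        exact norm_aeval_prod_X_sub_C_le ContinuousLinearMap.norm_id_le _ _
          fun x hx => hT ∞ x (hmem x hx)
    have h2 : ‖Q.eval z‖ ≤ ‖Polynomial.aeval (convOperator ν p) Q‖ := by
      have h3 := spectrum.subset_polynomial_aeval (convOperator ν p) Q ⟨z, hz, rfl⟩
      refine (spectrum.norm_le_norm_mul_of_mem h3).trans ?_
      exact mul_le_of_le_one_right (norm_nonneg _) ContinuousLinearMap.norm_id_le
    have h3 : d ^ (n * m) ≤ ‖Q.eval z‖ := by
      rw [heval, norm_pow, pow_mul]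
      refine pow_le_pow_left₀ (by positivity) ?_ m
      have : ∀ t : Multiset ℂ, (∀ x ∈ t, x ∈ K) →
          d ^ Multiset.card t ≤ ‖(t.map fun x => z - x).prod‖ := by
        intro t
        induction t using Multiset.induction_on with
        | empty => simp
        | cons x t ih =>
          intro ht
          rw [Multiset.card_cons, Multiset.map_cons, Multiset.prod_cons, norm_mul, pow_succ']
          refine mul_le_mul ?_ (ih fun y hy => ht y (Multiset.mem_cons_of_mem hy)) (by positivity)
            (norm_nonneg _)
          rw [← dist_eq_norm]
          exact Metric.infDist_le_dist_of_mem (ht x (Multiset.mem_cons_self _ _))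
      exact this s hsK
    rw [div_pow, div_le_iff₀ (by positivity)]
    refine h3.trans (h2.trans (h1.trans (le_of_eq ?_)))
    rw [hX, mul_pow ((ε * 2) ^ a), Real.rpow_pow_comm (by positivity),
      Real.rpow_pow_comm (by positivity), mul_assoc]
  have hgt : 1 < d / X := (one_lt_div hX0).2 hεd
  obtain ⟨m, hm⟩ := pow_unbounded_of_one_lt C hgt
  have h4 : (d / X) ^ m ≤ (d / X) ^ (n * m) :=
    pow_le_pow_right₀ hgt.le (Nat.le_mul_of_pos_left m hs0)
  exact absurd (key m) (not_le.2 (hm.trans_le h4))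

end

/-! ### Fourier coefficients as infinite products of cosines. -/

section FourierTransform

open Filter Topology

theorem hasSum_signSeries {θ : ℝ} (hθ : 1 < θ) (ε : ℕ → Bool) :
    HasSum (fun k : ℕ => (if ε k then (1 : ℝ) else -1) * (θ⁻¹) ^ k) (signSeries θ ε) := by
  refine Summable.hasSum (Summable.of_norm_bounded (summable_geometric_of_lt_one
    (by positivity) (inv_lt_one_of_one_lt₀ hθ)) fun k => ?_)
  rw [norm_mul, Real.norm_of_nonneg (by positivity : (0 : ℝ) ≤ θ⁻¹ ^ k)]
  split_ifs <;> simp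

theorem measurable_signSeries_partial (θ : ℝ) (N : ℕ) : Measurable fun ε : ℕ → Bool =>
    ∑ k ∈ Finset.range N, (if ε k then (1 : ℝ) else -1) * (θ⁻¹) ^ k := by
  refine Finset.measurable_sum _ fun k _ => Measurable.mul_const ?_ _
  exact (measurable_of_countable fun b : Bool => if b then (1 : ℝ) else -1).comp
    (measurable_pi_apply k)

theorem measurable_signSeries {θ : ℝ} (hθ : 1 < θ) : Measurable (signSeries θ) :=
  measurable_of_tendsto_metrizable (measurable_signSeries_partial θ)
    (tendsto_pi_nhds.2 fun ε => (hasSum_signSeries hθ ε).tendsto_sum_nat)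

theorem integral_fairCoin (g : Bool → ℂ) :
    ∫ b, g b ∂fairCoin = (g true + g false) / 2 := by
  have h : ∀ b : Bool, Integrable g ((2⁻¹ : ℝ≥0∞) • Measure.dirac b) := fun b =>
    (integrable_dirac (by finiteness)).smul_measure (by simp)
  rw [fairCoin, integral_add_measure (h _) (h _), integral_smul_measure, integral_smul_measure]
  simp
  ring

/-- The characteristic function of the Bernoulli convolution as an infinite product of cosines. -/
theorem tendsto_prod_cos_integral_exp {θ : ℝ} (hθ : 1 < θ) (t : ℝ) :
    Tendsto (fun N => ∏ k ∈ Finset.range N, (Real.cos (t * θ⁻¹ ^ k) : ℂ)) atTop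
      (𝓝 (∫ x, Complex.exp (t * x * Complex.I) ∂(bernoulliConvolution θ))) := by
  have hc : Continuous fun x : ℝ => Complex.exp (t * x * Complex.I) := by fun_prop
  rw [bernoulliConvolution, integral_map (measurable_signSeries hθ).aemeasurable
    hc.aestronglyMeasurable]
  -- By independence, the product of the first `N` cosines is the characteristic function of the
  -- `N`-th partial sum. The limit in `N` is then dominated convergence.
  have hprod : ∀ N, ∏ k ∈ Finset.range N, (Real.cos (t * θ⁻¹ ^ k) : ℂ)
      = ∫ ε : ℕ → Bool, Complex.exp (t * (∑ k ∈ Finset.range N,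
          (if ε k then (1 : ℝ) else -1) * (θ⁻¹) ^ k : ℝ) * Complex.I)
          ∂(Measure.infinitePi fun _ : ℕ => fairCoin) := by
    intro N
    set g : ℕ → Bool → ℂ := fun k b =>
      Complex.exp (t * ((if b then (1 : ℝ) else -1) * (θ⁻¹) ^ k : ℝ) * Complex.I) with hg
    have e1 : ∀ ε : ℕ → Bool, Complex.exp (t * (∑ k ∈ Finset.range N,
        (if ε k then (1 : ℝ) else -1) * (θ⁻¹) ^ k : ℝ) * Complex.I)
        = (fun x : (k : Finset.range N) → Bool => ∏ k : Finset.range N, g k (x k))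
          ((Finset.range N).restrict ε) := by
      intro ε
      simp only [hg, Finset.restrict]
      rw [Finset.prod_coe_sort (Finset.range N) (fun k => Complex.exp
        (t * ((if ε k then (1 : ℝ) else -1) * (θ⁻¹) ^ k : ℝ) * Complex.I)), ← Complex.exp_sum]
      push_cast
      rw [Finset.mul_sum, Finset.sum_mul]
    have e2 := integral_restrict_infinitePi (μ := fun _ : ℕ => fairCoin) (s := Finset.range N)
      (f := fun x => ∏ k : Finset.range N, g k (x k))
      (measurable_of_countable _).aestronglyMeasurable
    rw [integral_congr_ae (Eventually.of_forall e1)]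
    refine Eq.trans ?_ e2.symm
    rw [integral_fintype_prod_eq_prod (fun (k : Finset.range N) b => g k b), Finset.prod_coe_sort (Finset.range N) (fun k => ∫ b, g k b ∂fairCoin)]
    refine Finset.prod_congr rfl fun k _ => ?_
    rw [integral_fairCoin, Complex.ofReal_cos, Complex.cos]
    simp [hg]
  simp_rw [hprod]
  refine tendsto_integral_of_dominated_convergence (fun _ => (1 : ℝ)) (fun N => ?_)
    (integrable_const _) (fun N => Eventually.of_forall fun ε => ?_)
    (Eventually.of_forall fun ε => ?_)
  · exact (hc.measurable.comp (measurable_signSeries_partial θ N)).aestronglyMeasurable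
  · rw [← Complex.ofReal_mul, Complex.norm_exp_ofReal_mul_I]
  · exact (hc.tendsto _).comp (hasSum_signSeries hθ ε).tendsto_sum_nat

/-- The Fourier–Stieltjes coefficients of the Cantor–Lebesgue measure. -/
theorem tendsto_prod_cos_fourierStieltjesCoeff {θ : ℝ} (hθ : 1 < θ) (n : ℤ) :
    Tendsto (fun N => Complex.exp (-(n * Real.pi) * Complex.I) * ∏ k ∈ Finset.range N,
        (Real.cos (Real.pi * (n * (θ - 1) * θ⁻¹ ^ (k + 1))) : ℂ)) atTop
      (𝓝 (fourierStieltjesCoeff (cantorLebesgueCircle θ) n)) := by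
  -- The frequency is `-2πn` times the scaling factor `(θ-1)/(2θ)`; the translation by `1/2`
  -- contributes the exponential in front.
  have h := (tendsto_prod_cos_integral_exp hθ
    (-(Real.pi * n * (θ - 1) * θ⁻¹))).const_mul (Complex.exp (-(n * Real.pi) * Complex.I))
  convert h using 1
  · funext N
    congr 1
    refine Finset.prod_congr rfl fun k _ => ?_
    rw [← Real.cos_neg]
    congr 2
    ring
  · congr 1
    have hm : Measurable fun x : ℝ => (x : UnitAddCircle) := AddCircle.measurable_mk'
    have hm2 : Measurable fun x : ℝ => (θ - 1) / (2 * θ) * x + 1 / 2 := by fun_prop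
    rw [fourierStieltjesCoeff, cantorLebesgueCircle, integral_map hm.aemeasurable
      (fourier (-n)).continuous.aestronglyMeasurable, cantorLebesgue,
      integral_map (φ := fun x : ℝ => (θ - 1) / (2 * θ) * x + 1 / 2)
        (f := fun x : ℝ => fourier (-n) (x : UnitAddCircle)) hm2.aemeasurable
        ((fourier (-n)).continuous.comp (AddCircle.continuous_mk' 1)).aestronglyMeasurable,
      ← integral_const_mul]
    refine integral_congr_ae (Eventually.of_forall fun x => ?_)
    simp only [fourier_coe_apply]
    rw [← Complex.exp_add]
    congr 1
    have : (θ : ℂ) ≠ 0 := by exact_mod_cast (by linarith : θ ≠ 0)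
    push_cast
    field_simp
    ring

end FourierTransform

/-! ### Cosine products and their decoupling along an ultrafilter. -/

section CosineProducts

open Filter Topology

theorem Finset.abs_prod_sub_prod_le {ι : Type*} (s : Finset ι) (x y : ι → ℝ)
    (hx : ∀ i, 0 ≤ x i ∧ x i ≤ 1) (hy : ∀ i, 0 ≤ y i ∧ y i ≤ 1) :
    |∏ i ∈ s, x i - ∏ i ∈ s, y i| ≤ ∑ i ∈ s, |x i - y i| := by
  classical
  induction s using Finset.induction_on with
  | empty => simp
  | insert a s ha ih =>
    rw [Finset.prod_insert ha, Finset.prod_insert ha, Finset.sum_insert ha]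
    have h1 : 0 ≤ ∏ i ∈ s, x i := Finset.prod_nonneg fun i _ => (hx i).1
    have h2 : ∏ i ∈ s, x i ≤ 1 := Finset.prod_le_one (fun i _ => (hx i).1) fun i _ => (hx i).2
    calc |x a * ∏ i ∈ s, x i - y a * ∏ i ∈ s, y i|
        = |(x a - y a) * ∏ i ∈ s, x i + y a * (∏ i ∈ s, x i - ∏ i ∈ s, y i)| := by
          congr 1; ring
      _ ≤ |x a - y a| * |∏ i ∈ s, x i| + |y a| * |∏ i ∈ s, x i - ∏ i ∈ s, y i| := by
          rw [← abs_mul, ← abs_mul]; exact abs_add_le _ _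
      _ ≤ |x a - y a| * 1 + 1 * |∏ i ∈ s, x i - ∏ i ∈ s, y i| := by
          rw [abs_of_nonneg h1, abs_of_nonneg (hy a).1]
          gcongr
          exact (hy a).2
      _ ≤ _ := by rw [mul_one, one_mul]; gcongr

/-- The function `|cos (π x)|`. -/
noncomputable def cosAbs (x : ℝ) : ℝ := |Real.cos (Real.pi * x)|

theorem cosAbs_mem (x : ℝ) : 0 ≤ cosAbs x ∧ cosAbs x ≤ 1 :=
  ⟨abs_nonneg _, Real.abs_cos_le_one _⟩

theorem cosAbs_zero : cosAbs 0 = 1 := by simp [cosAbs]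

theorem abs_cosAbs_sub_le (x y : ℝ) : |cosAbs x - cosAbs y| ≤ Real.pi * |x - y| := by
  refine (abs_abs_sub_abs_le_abs_sub _ _).trans ?_
  have h := Real.lipschitzWith_cos.dist_le_mul (Real.pi * x) (Real.pi * y)
  rw [Real.dist_eq, Real.dist_eq, ← mul_sub, abs_mul, abs_of_pos Real.pi_pos] at h
  simpa using h

theorem cosAbs_sub_intCast (x : ℝ) (n : ℤ) : cosAbs (x - n) = cosAbs x := by
  rw [cosAbs, mul_sub, mul_comm Real.pi (n : ℝ), Real.cos_sub_int_mul_pi, abs_mul]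
  simp [cosAbs]

/-- The difference vanishes when either variable is zero, because `cosAbs 0 = 1`, and it is
Lipschitz in each variable. A bound by the minimum is what makes sequences with little overlap
almost independent. -/
theorem abs_cosAbs_add_sub_mul_le (x y : ℝ) :
    |cosAbs (x + y) - cosAbs x * cosAbs y| ≤ 2 * Real.pi * min |x| |y| := by
  have key : ∀ x y : ℝ, |cosAbs (x + y) - cosAbs x * cosAbs y| ≤ 2 * Real.pi * |x| := by
    intro x y
    have h1 : |cosAbs (x + y) - cosAbs y| ≤ Real.pi * |x| := by
      simpa using abs_cosAbs_sub_le (x + y) y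
    have h2 : |cosAbs 0 - cosAbs x| ≤ Real.pi * |x| := by
      simpa using abs_cosAbs_sub_le 0 x
    rw [cosAbs_zero] at h2
    calc |cosAbs (x + y) - cosAbs x * cosAbs y|
        = |(cosAbs (x + y) - cosAbs y) + (1 - cosAbs x) * cosAbs y| := by congr 1; ring
      _ ≤ |cosAbs (x + y) - cosAbs y| + |1 - cosAbs x| * |cosAbs y| := by
          rw [← abs_mul]; exact abs_add_le _ _
      _ ≤ Real.pi * |x| + Real.pi * |x| * 1 := by
          gcongr
          rw [abs_of_nonneg (cosAbs_mem y).1]; exact (cosAbs_mem y).2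
      _ = _ := by ring
  rcases le_total |x| |y| with h | h
  · rw [min_eq_left h]; exact key x y
  · rw [min_eq_right h, add_comm, mul_comm (cosAbs x)]; exact key y x

/-- The infinite product `∏ |cos (π v k)|`. -/
noncomputable def cosProd (v : ℤ → ℝ) : ℝ := ⨅ s : Finset ℤ, ∏ k ∈ s, cosAbs (v k)

/-- All factors lie in `[0, 1]`, so the finite products decrease with the finite set. The infimum is
therefore the limit for every sequence, without any summability condition. -/
theorem tendsto_cosProd (v : ℤ → ℝ) :
    Tendsto (fun s : Finset ℤ => ∏ k ∈ s, cosAbs (v k)) atTop (𝓝 (cosProd v)) := by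
  refine tendsto_atTop_ciInf (fun s t hst => ?_)
    ⟨0, by rintro _ ⟨s, rfl⟩; exact Finset.prod_nonneg fun k _ => (cosAbs_mem _).1⟩
  change ∏ k ∈ t, cosAbs (v k) ≤ ∏ k ∈ s, cosAbs (v k)
  rw [← Finset.prod_sdiff hst]
  exact mul_le_of_le_one_left (Finset.prod_nonneg fun k _ => (cosAbs_mem _).1)
    (Finset.prod_le_one (fun k _ => (cosAbs_mem _).1) fun k _ => (cosAbs_mem _).2)

theorem cosProd_zero : cosProd 0 = 1 := by simp [cosProd, cosAbs_zero]

theorem cosProd_shift (v : ℤ → ℝ) (c : ℤ) : cosProd (fun k => v (k - c)) = cosProd v := by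
  refine (Equiv.subRight c).finsetCongr.iInf_congr fun s => ?_
  simp

theorem abs_cosProd_sub_le (a b : ℤ → ℝ) (h : Summable fun k => |a k - b k|) :
    |cosProd a - cosProd b| ≤ Real.pi * ∑' k, |a k - b k| := by
  refine le_of_tendsto' ((tendsto_cosProd a).sub (tendsto_cosProd b)).abs fun s => ?_
  refine (s.abs_prod_sub_prod_le _ _ (fun _ => cosAbs_mem _) fun _ => cosAbs_mem _).trans ?_
  refine (Finset.sum_le_sum fun k _ => abs_cosAbs_sub_le (a k) (b k)).trans ?_
  rw [← Finset.mul_sum]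
  exact mul_le_mul_of_nonneg_left (h.sum_le_tsum s fun _ _ => abs_nonneg _) Real.pi_pos.le

theorem abs_cosProd_add_sub_mul_le (a b : ℤ → ℝ) (h : Summable fun k => min |a k| |b k|) :
    |cosProd (fun k => a k + b k) - cosProd a * cosProd b|
      ≤ 2 * Real.pi * ∑' k, min |a k| |b k| := by
  refine le_of_tendsto' ((tendsto_cosProd fun k => a k + b k).sub
    ((tendsto_cosProd a).mul (tendsto_cosProd b))).abs fun s => ?_
  rw [← Finset.prod_mul_distrib]
  refine (s.abs_prod_sub_prod_le _ _ (fun _ => cosAbs_mem _) fun k => ?_).trans ?_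
  · exact ⟨mul_nonneg (cosAbs_mem _).1 (cosAbs_mem _).1,
      mul_le_one₀ (cosAbs_mem _).2 (cosAbs_mem _).1 (cosAbs_mem _).2⟩
  refine (Finset.sum_le_sum fun k _ => abs_cosAbs_add_sub_mul_le (a k) (b k)).trans ?_
  rw [← Finset.mul_sum]
  exact mul_le_mul_of_nonneg_left (h.sum_le_tsum s fun _ _ => by positivity)
    (by positivity)

theorem Summable.min_abs {a b : ℤ → ℝ} (ha : Summable fun k => |a k|) :
    Summable fun k => min |a k| |b k| :=
  ha.of_nonneg_of_le (fun _ => by positivity) fun _ => min_le_left _ _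

/-- Two summable sequences become disjoint when one of them is translated to infinity. -/
theorem tendsto_tsum_min_abs_shift {a b : ℤ → ℝ} (ha : Summable fun k => |a k|)
    (hb : Summable fun k => |b k|) :
    Tendsto (fun t : ℤ => ∑' k, min |a k| |b (k + t)|) cofinite (𝓝 0) := by
  have h := tendsto_tsum_of_dominated_convergence (𝓕 := (cofinite : Filter ℤ))
    (f := fun (t : ℤ) k => min |a k| |b (k + t)|) (g := fun _ => (0 : ℝ)) ha (fun k => ?_) ?_
  · simpa using h
  · have h1 : Tendsto (fun t : ℤ => |b (k + t)|) cofinite (𝓝 0) :=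
      hb.tendsto_cofinite_zero.comp (add_right_injective k).tendsto_cofinite
    exact squeeze_zero (fun _ => by positivity) (fun _ => min_le_right _ _) h1
  · refine Eventually.of_forall fun t k => ?_
    rw [Real.norm_of_nonneg (by positivity)]
    exact min_le_left _ _

variable {J : Type*} (U : Ultrafilter J) (𝒢 : Set (ℤ → ℝ))

/-- A family of sequences is asymptotic, along the ultrafilter, to a sum of finitely many
translates of fixed sequences, whose mutual distances tend to infinity. -/
def IsAsymptoticSum (x : J → ℤ → ℝ) : Prop :=
  ∃ (T : Finset (J → ℤ)) (G : (J → ℤ) → ℤ → ℝ), (∀ p ∈ T, G p ∈ 𝒢) ∧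
    (∀ p ∈ T, ∀ q ∈ T, p ≠ q → Tendsto (fun j => p j - q j) U cofinite) ∧
    (∀ᶠ j in (U : Filter J), Summable fun k => |x j k - ∑ p ∈ T, G p (k - p j)|) ∧
    Tendsto (fun j => ∑' k, |x j k - ∑ p ∈ T, G p (k - p j)|) U (𝓝 0)

variable {U 𝒢}

/-- The dichotomy that replaces repeated passage to subsequences: along an ultrafilter an index
either escapes from every finite set or is eventually constant. -/
theorem Ultrafilter.exists_eventually_eq_of_not_tendsto_cofinite {α : Type*} {t : J → α}
    (h : ¬ Tendsto t U cofinite) : ∃ c, ∀ᶠ j in (U : Filter J), t j = c := by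
  rw [tendsto_def] at h
  push Not at h
  obtain ⟨s, hs, hs'⟩ := h
  have h1 : t ⁻¹' sᶜ ∈ (U : Filter J) := by
    rw [Set.preimage_compl]; exact Ultrafilter.compl_mem_iff_notMem.2 hs'
  have hfin : sᶜ.Finite := hs
  rw [← Set.biUnion_of_singleton sᶜ, Set.preimage_iUnion₂] at h1
  obtain ⟨c, _, hc⟩ := (Ultrafilter.finite_biUnion_mem_iff hfin).1 h1
  exact ⟨c, hc⟩

theorem tendsto_tsum_abs_add {x y : J → ℤ → ℝ}
    (hx : ∀ᶠ j in (U : Filter J), Summable fun k => |x j k|)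
    (hx0 : Tendsto (fun j => ∑' k, |x j k|) U (𝓝 0))
    (hy : ∀ᶠ j in (U : Filter J), Summable fun k => |y j k|)
    (hy0 : Tendsto (fun j => ∑' k, |y j k|) U (𝓝 0)) :
    (∀ᶠ j in (U : Filter J), Summable fun k => |x j k + y j k|) ∧
      Tendsto (fun j => ∑' k, |x j k + y j k|) U (𝓝 0) := by
  have h1 : ∀ᶠ j in (U : Filter J), Summable fun k => |x j k + y j k| := by
    filter_upwards [hx, hy] with j h1 h2
    exact (h1.add h2).of_nonneg_of_le (fun _ => abs_nonneg _) fun _ => abs_add_le _ _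
  refine ⟨h1, squeeze_zero' (Eventually.of_forall fun j => tsum_nonneg fun _ => abs_nonneg _) ?_
    (by simpa using hx0.add hy0)⟩
  filter_upwards [hx, hy, h1] with j h2 h3 h4
  rw [← h2.tsum_add h3]
  exact h4.tsum_le_tsum (fun _ => abs_add_le _ _) (h2.add h3)

/-- The new centre either fails to escape from some old centre, in which case their offset is
eventually constant and the two profiles merge, or it escapes from all of them and starts a new
cluster. Merging is what needs `𝒢` closed under sums and translations. -/
theorem IsAsymptoticSum.add {x y : J → ℤ → ℝ} (hx : IsAsymptoticSum U 𝒢 x)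
    (hadd : ∀ a ∈ 𝒢, ∀ b ∈ 𝒢, a + b ∈ 𝒢) (hshift : ∀ a ∈ 𝒢, ∀ c : ℤ, (fun k => a (k - c)) ∈ 𝒢)
    (g : ℤ → ℝ) (hg : g ∈ 𝒢) (p₀ : J → ℤ)
    (hy : ∀ᶠ j in (U : Filter J), Summable fun k => |y j k - g (k - p₀ j)|)
    (hy0 : Tendsto (fun j => ∑' k, |y j k - g (k - p₀ j)|) U (𝓝 0)) :
    IsAsymptoticSum U 𝒢 (fun j k => x j k + y j k) := by
  classical
  obtain ⟨T, G, hG, hT, hs, h0⟩ := hx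
  have hsum := tendsto_tsum_abs_add hs h0 hy hy0
  have hfinish : ∀ (T' : Finset (J → ℤ)) (G' : (J → ℤ) → ℤ → ℝ),
      (∀ᶠ j in (U : Filter J), ∀ k, ∑ p ∈ T', G' p (k - p j)
        = ∑ p ∈ T, G p (k - p j) + g (k - p₀ j)) →
      (∀ᶠ j in (U : Filter J), Summable fun k => |x j k + y j k - ∑ p ∈ T', G' p (k - p j)|) ∧
      Tendsto (fun j => ∑' k, |x j k + y j k - ∑ p ∈ T', G' p (k - p j)|) U (𝓝 0) := by
    intro T' G' h
    have h1 : ∀ᶠ j in (U : Filter J), (fun k => |x j k - ∑ p ∈ T, G p (k - p j)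
        + (y j k - g (k - p₀ j))|) = fun k => |x j k + y j k - ∑ p ∈ T', G' p (k - p j)| := by
      filter_upwards [h] with j hj
      funext k
      rw [hj k]
      congr 1
      ring
    refine ⟨?_, hsum.2.congr' ?_⟩
    · filter_upwards [hsum.1, h1] with j h2 h3
      rwa [← h3]
    · filter_upwards [h1] with j h3
      rw [h3]
  by_cases hcase : ∃ q ∈ T, ¬ Tendsto (fun j => p₀ j - q j) U cofinite
  · obtain ⟨q, hq, hq'⟩ := hcase
    obtain ⟨c, hc⟩ := Ultrafilter.exists_eventually_eq_of_not_tendsto_cofinite hq'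
    refine ⟨T, Function.update G q (G q + fun k => g (k - c)), ?_, hT, hfinish _ _ ?_⟩
    · intro p hp
      rcases eq_or_ne p q with rfl | hpq
      · rw [Function.update_self]; exact hadd _ (hG _ hp) _ (hshift _ hg c)
      · rw [Function.update_of_ne hpq]; exact hG p hp
    · filter_upwards [hc] with j hj k
      rw [← Finset.add_sum_erase _ _ hq, ← Finset.add_sum_erase T _ hq, Function.update_self,
        Finset.sum_congr rfl fun p hp => by
          rw [Function.update_of_ne (Finset.ne_of_mem_erase hp)], Pi.add_apply]
      have : k - p₀ j = k - q j - c := by omega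
      rw [this]
      ring
  · push Not at hcase
    -- A centre in `T` would have to escape from itself, although the difference is zero.
    have hp₀ : p₀ ∉ T := by
      intro hmem
      have := hcase _ hmem
      simp only [sub_self] at this
      have h1 := this.eventually ((Set.finite_singleton (0 : ℤ)).compl_mem_cofinite)
      simpa using h1.exists
    refine ⟨insert p₀ T, Function.update G p₀ g, ?_, ?_, hfinish _ _ ?_⟩
    · intro p hp
      rcases eq_or_ne p p₀ with rfl | hpq
      · rwa [Function.update_self]
      · rw [Function.update_of_ne hpq]
        exact hG p ((Finset.mem_insert.1 hp).resolve_left hpq)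
    · intro p hp q hq hpq
      rcases Finset.mem_insert.1 hp with rfl | hp
      · exact hcase q ((Finset.mem_insert.1 hq).resolve_left hpq.symm)
      · rcases Finset.mem_insert.1 hq with rfl | hq
        · have := neg_injective.tendsto_cofinite.comp (hcase p ‹p ∈ T›)
          simpa [Function.comp_def] using this
        · exact hT p hp q hq hpq
    · refine Eventually.of_forall fun j k => ?_
      rw [Finset.sum_insert hp₀, Function.update_self, Finset.sum_congr rfl fun p hp => by
        rw [Function.update_of_ne (ne_of_mem_of_not_mem hp hp₀)]]
      ring

/-- The overlap is subadditive in the second sequence, `min |a| |b + c| ≤ min |a| |b| + min |a|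
|c|`, which reduces the claim to two profiles moving apart. -/
theorem tendsto_tsum_min_abs_sum (h𝒢 : ∀ a ∈ 𝒢, Summable fun k => |a k|) {a : ℤ → ℝ}
    (ha : a ∈ 𝒢) (p : J → ℤ) (T : Finset (J → ℤ)) (G : (J → ℤ) → ℤ → ℝ) (hG : ∀ q ∈ T, G q ∈ 𝒢)
    (hT : ∀ q ∈ T, Tendsto (fun j => p j - q j) U cofinite) :
    Tendsto (fun j => ∑' k, min |a (k - p j)| |∑ q ∈ T, G q (k - q j)|) U (𝓝 0) := by
  classical
  have hap : ∀ c : ℤ, Summable fun k => |a (k - c)| := fun c =>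
    (Equiv.subRight c).summable_iff.2 (h𝒢 a ha)
  induction T using Finset.induction_on with
  | empty => simp
  | insert q T hq ih =>
    have h1 := ih (fun r hr => hG r (Finset.mem_insert_of_mem hr))
      fun r hr => hT r (Finset.mem_insert_of_mem hr)
    have h2 := (tendsto_tsum_min_abs_shift (h𝒢 a ha) (h𝒢 _ (hG q (Finset.mem_insert_self q T)))).comp
      (hT q (Finset.mem_insert_self q T))
    have h3 : ∀ j, ∑' k, min |a k| |G q (k + (p j - q j))|
        = ∑' k, min |a (k - p j)| |G q (k - q j)| := by
      intro j
      rw [← (Equiv.subRight (p j)).tsum_eq]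
      refine tsum_congr fun k => ?_
      simp
    refine squeeze_zero (fun j => tsum_nonneg fun _ => by positivity) (fun j => ?_)
      (by simpa using h2.add h1)
    rw [h3, ← (hap _).min_abs.tsum_add (hap _).min_abs]
    refine (hap _).min_abs.tsum_le_tsum (fun k => ?_) ((hap _).min_abs.add (hap _).min_abs)
    rw [Finset.sum_insert hq]
    have := abs_add_le (G q (k - q j)) (∑ q ∈ T, G q (k - q j))
    rcases min_choice |a (k - p j)| |G q (k - q j)| with h | h <;>
    rcases min_choice |a (k - p j)| |∑ q ∈ T, G q (k - q j)| with h' | h' <;>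
    rw [h, h']
    · exact (min_le_left _ _).trans (by linarith [abs_nonneg (a (k - p j))])
    · exact (min_le_left _ _).trans (by linarith [abs_nonneg (∑ q ∈ T, G q (k - q j))])
    · exact (min_le_left _ _).trans (by linarith [abs_nonneg (G q (k - q j))])
    · exact (min_le_right _ _).trans this

/-- Along an asymptotic sum, the cosine products decouple. -/
theorem IsAsymptoticSum.tendsto_cosProd {x : J → ℤ → ℝ} (hx : IsAsymptoticSum U 𝒢 x)
    (h𝒢 : ∀ a ∈ 𝒢, Summable fun k => |a k|) :
    ∃ L ∈ Submonoid.closure (cosProd '' 𝒢), Tendsto (fun j => cosProd (x j)) U (𝓝 L) := by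
  classical
  obtain ⟨T, G, hG, hT, hs, h0⟩ := hx
  -- Clusters are split off one at a time. Each is far from the remaining ones, and its own product
  -- does not depend on its centre because `cosProd` is invariant under translation.
  have hmain : Tendsto (fun j => cosProd fun k => ∑ p ∈ T, G p (k - p j)) U
      (𝓝 (∏ p ∈ T, cosProd (G p))) := by
    clear h0 hs
    induction T using Finset.induction_on with
    | empty =>
      simp only [Finset.sum_empty, Finset.prod_empty]
      rw [← cosProd_zero]
      exact tendsto_const_nhds
    | insert p T hp ih =>
      have h1 := ih (fun r hr => hG r (Finset.mem_insert_of_mem hr)) fun r hr q hq =>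
        hT r (Finset.mem_insert_of_mem hr) q (Finset.mem_insert_of_mem hq)
      have hGp := hG p (Finset.mem_insert_self p T)
      have h2 := tendsto_tsum_min_abs_sum h𝒢 hGp p T G
        (fun r hr => hG r (Finset.mem_insert_of_mem hr)) (fun r hr => hT p
          (Finset.mem_insert_self p T) r (Finset.mem_insert_of_mem hr) (fun h => hp (h ▸ hr)))
      have hsum : ∀ c : ℤ, Summable fun k => |G p (k - c)| := fun c =>
        (Equiv.subRight c).summable_iff.2 (h𝒢 _ hGp)
      have h3 : Tendsto (fun j => cosProd (fun k => G p (k - p j) + ∑ q ∈ T, G q (k - q j))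
          - cosProd (fun k => G p (k - p j)) * cosProd fun k => ∑ q ∈ T, G q (k - q j)) U
          (𝓝 0) := by
        rw [tendsto_zero_iff_abs_tendsto_zero]
        exact squeeze_zero (fun _ => abs_nonneg _)
          (fun j => abs_cosProd_add_sub_mul_le _ _ (hsum _).min_abs)
          (by simpa using h2.const_mul (2 * Real.pi))
      have h4 := h3.add (h1.const_mul (cosProd (G p)))
      simp only [Finset.sum_insert hp, Finset.prod_insert hp]
      simpa [cosProd_shift (G p)] using h4
  refine ⟨_, Submonoid.prod_mem _ fun p hp => Submonoid.subset_closure ⟨_, hG p hp, rfl⟩, ?_⟩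
  have h1 : Tendsto (fun j => cosProd (x j) - cosProd fun k => ∑ p ∈ T, G p (k - p j)) U
      (𝓝 0) := by
    rw [tendsto_zero_iff_abs_tendsto_zero]
    refine squeeze_zero' (Eventually.of_forall fun _ => abs_nonneg _) ?_
      (by simpa using h0.const_mul Real.pi)
    filter_upwards [hs] with j hj
    exact abs_cosProd_sub_le _ _ hj
  simpa using h1.add hmain

theorem Submonoid.countable_closure {M : Type*} [Monoid M] {s : Set M} (hs : s.Countable) :
    (Submonoid.closure s : Set M).Countable := by
  rw [Submonoid.closure_eq_mrange]
  have : Countable s := hs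
  have : Countable (FreeMonoid s) := inferInstanceAs (Countable (List s))
  exact Set.countable_range _

theorem AddSubmonoid.countable_closure {M : Type*} [AddMonoid M] {s : Set M} (hs : s.Countable) :
    (AddSubmonoid.closure s : Set M).Countable := by
  rw [AddSubmonoid.closure_eq_mrange]
  have : Countable s := hs
  have : Countable (FreeAddMonoid s) := inferInstanceAs (Countable (List s))
  exact Set.countable_range _

end CosineProducts

/-! ### Hankel determinants and linear recurrences. -/

section Hankel

open Filter Topology Polynomial

/-- Hadamard's inequality. -/
theorem Matrix.abs_det_le_prod_norm_col {n : ℕ} (M : Matrix (Fin n) (Fin n) ℝ) :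
    |M.det| ≤ ∏ j, Real.sqrt (∑ i, M i j ^ 2) := by
  have : Fact (Module.finrank ℝ (EuclideanSpace ℝ (Fin n)) = n) := ⟨by simp⟩
  set b := EuclideanSpace.basisFun (Fin n) ℝ
  set v : Fin n → EuclideanSpace ℝ (Fin n) := fun j => WithLp.toLp 2 fun i => M i j
  have h := b.toBasis.orientation.abs_volumeForm_apply_le v
  rw [Orientation.volumeForm_robust _ b rfl, Module.Basis.det_apply] at h
  have e1 : b.toBasis.toMatrix v = M := by
    ext i j
    simp [Module.Basis.toMatrix_apply, b, v]
  rw [e1] at h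
  refine h.trans (le_of_eq (Finset.prod_congr rfl fun j _ => ?_))
  rw [EuclideanSpace.norm_eq]
  simp [v]

/-- The Hankel matrices of a sequence. -/
def hankel {R : Type*} (z : ℕ → R) (n : ℕ) : Matrix (Fin n) (Fin n) R :=
  Matrix.of fun i j => z (i + j)

/-- The Hankel determinants of an almost geometric sequence tend to zero. -/
theorem tendsto_det_hankel {θ : ℝ} (hθ : 1 < θ) {z : ℕ → ℝ} {M : ℝ} (hM : ∀ k, |z k| ≤ M * θ ^ k)
    (hη : Summable fun k => (z (k + 1) - θ * z k) ^ 2) :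
    Tendsto (fun n => (hankel z (n + 1)).det) atTop (𝓝 0) := by
  have hθ0 : 0 < θ := by linarith
  set η : ℕ → ℝ := fun k => z (k + 1) - θ * z k with hηdef
  have hM0 : 0 ≤ M := by simpa using (abs_nonneg _).trans (hM 0)
  set ρ : ℕ → ℝ := fun j => Real.sqrt (∑' m, η (m + j) ^ 2) with hρ
  have hρ0 : Tendsto ρ atTop (𝓝 0) := by
    have := (Real.continuous_sqrt.tendsto 0).comp (tendsto_sum_nat_add fun k => η k ^ 2)
    simpa [Function.comp_def] using this
  have hbound : ∀ n, |(hankel z (n + 1)).det|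
      ≤ (n + 1) * M * θ ^ n * ∏ j ∈ Finset.range n, ρ j := by
    intro n
    -- Subtracting `θ` times the preceding column from each column preserves the determinant and
    -- replaces every column but the first by a segment of the square summable sequence `η`.
    set B : Matrix (Fin (n + 1)) (Fin (n + 1)) ℝ :=
      Matrix.of fun i j => Fin.cases (z i) (fun j : Fin n => η (i + j)) j with hB
    have h1 : (hankel z (n + 1)).det = B.det := by
      refine Matrix.det_eq_of_forall_col_eq_smul_add_pred (fun _ => θ) (fun i => ?_)
        fun i j => ?_
      · simp [hankel, hB]
      · simp [hankel, hB, hηdef, add_assoc]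
    rw [h1]
    refine (Matrix.abs_det_le_prod_norm_col B).trans ?_
    rw [Fin.prod_univ_succ, ← Fin.prod_univ_eq_prod_range]
    refine mul_le_mul ?_ (Finset.prod_le_prod (fun _ _ => Real.sqrt_nonneg _) fun j _ => ?_)
      (Finset.prod_nonneg fun _ _ => Real.sqrt_nonneg _) (by positivity)
    · refine Real.sqrt_le_iff.2 ⟨by positivity, ?_⟩
      have h2 : ∀ i : Fin (n + 1), B i 0 ^ 2 ≤ (M * θ ^ n) ^ 2 := by
        intro i
        rw [← sq_abs]
        refine pow_le_pow_left₀ (abs_nonneg _) ?_ 2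
        simp only [hB, Matrix.of_apply, Fin.cases_zero]
        refine (hM i).trans (mul_le_mul_of_nonneg_left ?_ hM0)
        exact pow_le_pow_right₀ hθ.le (by omega)
      refine (Finset.sum_le_sum fun i _ => h2 i).trans ?_
      rw [Finset.sum_const, Finset.card_univ, Fintype.card_fin, nsmul_eq_mul]
      push_cast
      have h3 : 0 ≤ (n : ℝ) * (n + 1) * (M * θ ^ n) ^ 2 := by positivity
      linear_combination h3
    · refine Real.sqrt_le_sqrt ?_
      have h2 : Summable fun m => η (m + j) ^ 2 :=
        (summable_nat_add_iff (f := fun m => η m ^ 2) (j : ℕ)).2 hη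
      have h3 := h2.sum_le_tsum (Finset.range (n + 1)) fun _ _ => by positivity
      refine le_trans (le_of_eq ?_) h3
      rw [← Fin.sum_univ_eq_sum_range (fun m => η (m + j) ^ 2)]
      simp [hB, hηdef]
  have hlim : Tendsto (fun n : ℕ => ((n : ℝ) + 1) * M * θ ^ n * ∏ j ∈ Finset.range n, ρ j) atTop
      (𝓝 0) := by
    refine (summable_of_ratio_norm_eventually_le (r := 1 / 2) (by norm_num) ?_).tendsto_atTop_zero
    -- The tails `ρ n` tend to zero, so their product beats `θ ^ n`. The threshold gives ratio at
    -- most `1/2`, since `(n + 2) / 4 ≤ (n + 1) / 2`.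
    have h4 : ∀ᶠ n in atTop, ρ n < 1 / (4 * θ) := hρ0.eventually (gt_mem_nhds (by positivity))
    filter_upwards [h4] with n hn
    have hP : 0 ≤ ∏ j ∈ Finset.range n, ρ j := Finset.prod_nonneg fun _ _ => Real.sqrt_nonneg _
    have hρn : 0 ≤ ρ n := Real.sqrt_nonneg _
    rw [Finset.prod_range_succ, Real.norm_of_nonneg (by positivity),
      Real.norm_of_nonneg (by positivity)]
    push_cast
    rw [lt_div_iff₀ (by positivity)] at hn
    have h5 : ((n : ℝ) + 1 + 1) * (θ * ρ n) ≤ 1 / 2 * (n + 1) := by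
      nlinarith [(Nat.cast_nonneg n : (0 : ℝ) ≤ n)]
    calc ((n : ℝ) + 1 + 1) * M * θ ^ (n + 1) * ((∏ j ∈ Finset.range n, ρ j) * ρ n)
        = (((n : ℝ) + 1 + 1) * (θ * ρ n)) * (M * θ ^ n * ∏ j ∈ Finset.range n, ρ j) := by ring
      _ ≤ (1 / 2 * (n + 1)) * (M * θ ^ n * ∏ j ∈ Finset.range n, ρ j) := by gcongr
      _ = _ := by ring
  exact squeeze_zero_norm hbound hlim

variable {F : Type*} [Field F]

/-- The linear functional on polynomials that sends `X ^ i` to `z i`. -/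
noncomputable def momentFunctional (z : ℕ → F) : F[X] →ₗ[F] F :=
  Polynomial.lsum fun i => z i • LinearMap.id

theorem momentFunctional_X_pow_mul (z : ℕ → F) (p : F[X]) (k : ℕ) {N : ℕ} (hN : p.natDegree < N) :
    momentFunctional z (X ^ k * p) = ∑ i ∈ Finset.range N, z (k + i) * p.coeff i := by
  conv_lhs => rw [p.as_sum_range' N hN, Finset.mul_sum, map_sum]
  refine Finset.sum_congr rfl fun i _ => ?_
  rw [X_pow_mul_monomial, momentFunctional, Polynomial.lsum_apply,
    Polynomial.sum_monomial_index _ _ (by simp)]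
  simp [add_comm]

/-- The Hankel matrix is the Gram matrix of the form `(p, q) ↦ momentFunctional z (p * q)` in the
basis of monomials, so a kernel vector is a polynomial orthogonal to all monomials up to degree `m`.
-/
theorem exists_orthogonal_of_det_hankel_eq_zero {z : ℕ → F} {m : ℕ}
    (h : (hankel z (m + 1)).det = 0) :
    ∃ b : F[X], b ≠ 0 ∧ b.natDegree ≤ m ∧ ∀ i ≤ m, momentFunctional z (X ^ i * b) = 0 := by
  classical
  obtain ⟨v, hv, hv0⟩ := Matrix.exists_mulVec_eq_zero_iff.2 h
  have hdeg : (ofFn (m + 1) v).natDegree < m + 1 := ofFn_natDegree_lt (by omega) v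
  refine ⟨ofFn (m + 1) v, fun h0 => hv ?_, by omega, fun i hi => ?_⟩
  · funext j
    have := congrArg (fun p => p.coeff j) h0
    simpa [ofFn_coeff_eq_val_of_lt v j.2] using this
  · rw [momentFunctional_X_pow_mul z _ i hdeg,
      ← Fin.sum_univ_eq_sum_range (fun j => z (i + j) * (ofFn (m + 1) v).coeff j)]
    have := congrFun hv0 ⟨i, by omega⟩
    refine Eq.trans (Finset.sum_congr rfl fun j _ => ?_) this
    rw [ofFn_coeff_eq_val_of_lt v j.2]
    rfl

theorem eq_zero_of_orthogonal_of_det_hankel_ne_zero {z : ℕ → F} {n : ℕ}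
    (h : (hankel z n).det ≠ 0) {r : F[X]} (hr : r.degree < n)
    (h0 : ∀ i < n, momentFunctional z (X ^ i * r) = 0) : r = 0 := by
  by_contra hne
  have hr' : r.natDegree < n := (natDegree_lt_iff_degree_lt hne).2 hr
  refine h (Matrix.exists_mulVec_eq_zero_iff.1 ⟨fun j => r.coeff j, fun hz => hne ?_, ?_⟩)
  · ext j
    by_cases hj : j < n
    · simpa using congrFun hz ⟨j, hj⟩
    · rw [coeff_zero, coeff_eq_zero_of_natDegree_lt (by omega)]
  · funext i
    have := h0 i i.2
    rw [momentFunctional_X_pow_mul z _ i hr',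
      ← Fin.sum_univ_eq_sum_range (fun j => z (i + j) * r.coeff j)] at this
    simpa [hankel, Matrix.mulVec, dotProduct] using this

/-- Kronecker's criterion: a sequence whose Hankel determinants vanish from some point on
satisfies a linear recurrence. -/
theorem exists_monic_recurrence_of_det_hankel_eq_zero {z : ℕ → F}
    (h : ∀ᶠ n in atTop, (hankel z n).det = 0) :
    ∃ a : F[X], a.Monic ∧ ∀ i, momentFunctional z (X ^ i * a) = 0 := by
  classical
  have hex : ∃ n, ∀ m, n ≤ m → (hankel z (m + 1)).det = 0 := by
    obtain ⟨n, hn⟩ := eventually_atTop.1 h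
    exact ⟨n, fun m hm => hn _ (by omega)⟩
  -- By minimality the Hankel matrix of size `n` is nonsingular and all larger ones are singular.
  -- The orthogonal polynomial found at size `n + 1` must then have degree exactly `n`.
  set n := Nat.find hex with hn
  have hspec : ∀ m, n ≤ m → (hankel z (m + 1)).det = 0 := Nat.find_spec hex
  have hdet : (hankel z n).det ≠ 0 := by
    rcases Nat.eq_zero_or_pos n with hn0 | hpos
    · rw [hn0]; simp
    · intro h1
      refine Nat.find_min hex (m := n - 1) (by omega) fun m hm => ?_
      rcases hm.eq_or_lt with h2 | h2
      · rw [← h2, Nat.sub_add_cancel hpos, h1]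
      · exact hspec m (by omega)
  obtain ⟨b, hb0, hbn, hb⟩ := exists_orthogonal_of_det_hankel_eq_zero (hspec n le_rfl)
  have hbdeg : b.natDegree = n := by
    by_contra hne
    exact hb0 (eq_zero_of_orthogonal_of_det_hankel_ne_zero hdet
      ((natDegree_lt_iff_degree_lt hb0).1 (lt_of_le_of_ne hbn hne)) fun i hi => hb i hi.le)
  set a : F[X] := C b.leadingCoeff⁻¹ * b with ha
  have hamonic : a.Monic := by
    rw [ha, mul_comm]; exact monic_mul_leadingCoeff_inv hb0
  have hadeg : a.natDegree = n := by
    rw [ha, natDegree_C_mul (inv_ne_zero (leadingCoeff_ne_zero.2 hb0)), hbdeg]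
  have ha1 : ∀ i ≤ n, momentFunctional z (X ^ i * a) = 0 := by
    intro i hi
    rw [ha, mul_left_comm, ← smul_eq_C_mul, map_smul, hb i hi, smul_zero]
  have hmul : ∀ (q : F[X]) (k : ℕ), momentFunctional z (X ^ k * (a * q))
      = ∑ l ∈ Finset.range (q.natDegree + 1),
          q.coeff l * momentFunctional z (X ^ (k + l) * a) := by
    intro q k
    conv_lhs => rw [q.as_sum_range_C_mul_X_pow, Finset.mul_sum, Finset.mul_sum, map_sum]
    refine Finset.sum_congr rfl fun l _ => ?_
    have : X ^ k * (a * (C (q.coeff l) * X ^ l)) = q.coeff l • (X ^ (k + l) * a) := by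
      rw [smul_eq_C_mul]
      ring
    rw [this, map_smul, smul_eq_mul]
  refine ⟨a, hamonic, fun m => ?_⟩
  induction m using Nat.strong_induction_on with
  | _ m ih =>
    rcases le_or_gt m n with hmn | hmn
    · exact ha1 m hmn
    -- Divide the orthogonal polynomial of size `m + 1` by `a`. Testing against `X ^ i` with `i < n`
    -- involves only moments of `a` of index below `m`, already zero, so the remainder is orthogonal
    -- too and vanishes.
    obtain ⟨b', hb0', hbm', hb'⟩ := exists_orthogonal_of_det_hankel_eq_zero (hspec m hmn.le)
    set q := b' /ₘ a with hq
    set r := b' %ₘ a with hr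
    have hbqr : r + a * q = b' := modByMonic_add_div b' a
    have hqdeg : q.natDegree ≤ m - n := by
      rw [hq, natDegree_divByMonic _ hamonic, hadeg]; omega
    have hr0 : r = 0 := by
      refine eq_zero_of_orthogonal_of_det_hankel_ne_zero hdet ?_ fun i hi => ?_
      · have := degree_modByMonic_lt b' hamonic
        rwa [degree_eq_natDegree hamonic.ne_zero, hadeg] at this
      · have h1 := hb' i (by omega)
        rw [← hbqr, mul_add, map_add, hmul] at h1
        rwa [Finset.sum_eq_zero, add_zero] at h1
        intro l hl
        rw [ih (i + l) (by have := Finset.mem_range.1 hl; omega), mul_zero]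
    rw [hr0, zero_add] at hbqr
    have hq0 : q ≠ 0 := by
      rintro h0
      exact hb0' (by rw [← hbqr, h0, mul_zero])
    -- With this exponent only the leading coefficient of `q` meets a moment not yet known to
    -- vanish, namely the `m`-th.
    have h2 := hb' (m - q.natDegree) (by omega)
    rw [← hbqr, hmul, Finset.sum_range_succ, Finset.sum_eq_zero, zero_add,
      Nat.sub_add_cancel (by omega)] at h2
    · exact (mul_eq_zero.1 h2).resolve_left (leadingCoeff_ne_zero.2 hq0)
    · intro l hl
      rw [ih _ (by have := Finset.mem_range.1 hl; omega), mul_zero]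

end Hankel

/-! ### Pisot's theorem. -/

section Pisot

open Filter Topology Polynomial

theorem tendsto_zero_of_summable_sq {e : ℕ → ℝ} (he : Summable fun k => e k ^ 2) :
    Tendsto e atTop (𝓝 0) := by
  have h := (Real.continuous_sqrt.tendsto 0).comp he.tendsto_atTop_zero
  rw [Real.sqrt_zero] at h
  refine tendsto_zero_iff_abs_tendsto_zero _ |>.2 (h.congr fun k => ?_)
  simp [Real.sqrt_sq_eq_abs]

/-- A sequence of integers that satisfies a linear recurrence over `ℚ` and is asymptotic to
`x θ ^ k` forces `θ` to be an algebraic integer. -/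
theorem isIntegral_of_recurrence {θ x : ℝ} (hθ : 1 < θ) (hx : x ≠ 0) {z : ℕ → ℤ}
    (hz : Tendsto (fun k => (z k : ℝ) * θ⁻¹ ^ k) atTop (𝓝 x)) {a : ℚ[X]} (ha : a.Monic)
    (hrec : ∀ i, momentFunctional (fun k => (z k : ℚ)) (X ^ i * a) = 0) : IsIntegral ℤ θ := by
  have hθ0 : θ ≠ 0 := by positivity
  set n := a.natDegree with hn
  -- `W` pairs each integer combination of shifts of `z` with its normalised limit. The sequence
  -- determines the limit, and the recurrence determines the sequence by its first `n` terms, so `W`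
  -- embeds in `ℤ^n`. Its projection, spanned by the `x θ^i`, is a finitely generated nonzero group
  -- stable under `θ`, which gives integrality even though `a` has rational coefficients.
  set W : Submodule ℤ ((ℕ → ℤ) × ℝ) :=
    Submodule.span ℤ (Set.range fun i : ℕ => ((fun k => z (k + i)), x * θ ^ i)) with hW
  have hWlim : ∀ w ∈ W, Tendsto (fun k => (w.1 k : ℝ) * θ⁻¹ ^ k) atTop (𝓝 w.2) := by
    intro w hw
    induction hw using Submodule.span_induction with
    | mem w hw =>
      obtain ⟨i, rfl⟩ := hw
      have h := ((tendsto_add_atTop_iff_nat i).2 hz).mul_const (θ ^ i)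
      refine h.congr fun k => ?_
      simp only [pow_add, inv_pow]
      field_simp
    | zero => simp
    | add u v _ _ hu hv =>
      refine (hu.add hv).congr fun k => ?_
      simp [add_mul]
    | smul c u _ hu =>
      have h := hu.const_mul (c : ℝ)
      rw [Prod.smul_snd, zsmul_eq_mul u.2 c]
      refine h.congr fun k => ?_
      simp [mul_assoc]
  have hWrec : ∀ w ∈ W, ∀ k, (w.1 (k + n) : ℚ) = -∑ i ∈ Finset.range n, (w.1 (k + i) : ℚ) * a.coeff i := by
    intro w hw
    induction hw using Submodule.span_induction with
    | mem w hw =>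
      obtain ⟨i, rfl⟩ := hw
      intro k
      have h := hrec (k + i)
      rw [momentFunctional_X_pow_mul _ _ _ (Nat.lt_succ_self _), Finset.sum_range_succ,
        ha.coeff_natDegree, mul_one] at h
      rw [eq_neg_iff_add_eq_zero, add_comm, ← h]
      congr 1
      · exact Finset.sum_congr rfl fun j _ => by rw [add_right_comm]
      · rw [add_right_comm]
    | zero => simp
    | add u v _ _ hu hv =>
      intro k
      simp [hu k, hv k, add_mul, Finset.sum_add_distrib]
      ring
    | smul c u _ hu =>
      intro k
      simp [hu k, mul_assoc, Finset.mul_sum]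
  set φ : W →ₗ[ℤ] (Fin n → ℤ) :=
    (LinearMap.funLeft ℤ ℤ (fun i : Fin n => (i : ℕ))).comp
      ((LinearMap.fst ℤ (ℕ → ℤ) ℝ).comp W.subtype) with hφ
  have hφinj : Function.Injective φ := by
    rw [← LinearMap.ker_eq_bot, LinearMap.ker_eq_bot']
    rintro ⟨w, hw⟩ h0
    have h1 : ∀ k, w.1 k = 0 := by
      intro k
      induction k using Nat.strong_induction_on with
      | _ k ih =>
        rcases lt_or_ge k n with hk | hk
        · simpa [hφ] using congrFun h0 ⟨k, hk⟩
        · have h2 := hWrec w hw (k - n)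
          rw [Nat.sub_add_cancel hk, Finset.sum_eq_zero, neg_zero] at h2
          · exact_mod_cast h2
          · intro i hi
            rw [ih _ (by have := Finset.mem_range.1 hi; omega)]
            simp
    have h2 : w.2 = 0 := by
      refine tendsto_nhds_unique (hWlim w hw) ?_
      simp [h1]
    refine Subtype.ext (Prod.ext (funext h1) h2)
  have hWfin : Module.Finite ℤ W := Module.Finite.of_injective φ hφinj
  have hWfg : W.FG := Module.Finite.iff_fg.1 hWfin
  set N : Submodule ℤ ℝ := Submodule.span ℤ (Set.range fun i : ℕ => x * θ ^ i) with hN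
  have hNW : W.map (LinearMap.snd ℤ (ℕ → ℤ) ℝ) = N := by
    rw [hW, hN, Submodule.map_span, ← Set.range_comp]
    rfl
  have hxN : x ∈ N := Submodule.subset_span ⟨0, by simp⟩
  refine isIntegral_of_smul_mem_submodule N ?_ (hNW ▸ hWfg.map _) θ fun y hy => ?_
  · intro h
    rw [h] at hxN
    exact hx (by simpa using hxN)
  · induction hy using Submodule.span_induction with
    | mem y hy =>
      obtain ⟨i, rfl⟩ := hy
      exact Submodule.subset_span ⟨i + 1, by simp only [smul_eq_mul, pow_succ]; ring⟩
    | zero => simp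
    | add u v _ _ hu hv => rw [smul_add]; exact N.add_mem hu hv
    | smul c u _ hu => rw [smul_comm]; exact N.smul_mem c hu

variable {θ x : ℝ} {z : ℕ → ℤ} {e : ℕ → ℝ}

/-- Pisot's theorem: if the distances of `x θ ^ k` to the integers are square summable, then `θ`
is an algebraic integer. -/
theorem isIntegral_of_summable_sq (hθ : 1 < θ) (hx : x ≠ 0) (hz : ∀ k, (z k : ℝ) = x * θ ^ k - e k)
    (he : Summable fun k => e k ^ 2) : IsIntegral ℤ θ := by
  have hθ0 : 0 < θ := by linarith
  have he0 := tendsto_zero_of_summable_sq he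
  obtain ⟨E, hE⟩ := he0.abs.bddAbove_range
  have hE' : ∀ k, |e k| ≤ E := fun k => hE ⟨k, rfl⟩
  have hM : ∀ k, |(z k : ℝ)| ≤ (|x| + E) * θ ^ k := by
    intro k
    rw [hz k]
    have h1 : 1 ≤ θ ^ k := one_le_pow₀ hθ.le
    have h2 : |x * θ ^ k - e k| ≤ |x * θ ^ k| + |e k| := abs_sub _ _
    rw [abs_mul, abs_of_pos (pow_pos hθ0 k)] at h2
    have h3 : E ≤ E * θ ^ k := le_mul_of_one_le_right ((abs_nonneg _).trans (hE' 0)) h1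
    linarith [hE' k]
  have hη : Summable fun k => ((z (k + 1) : ℝ) - θ * z k) ^ 2 := by
    have h1 := ((he.mul_left (2 * θ ^ 2)).add
      (((summable_nat_add_iff (f := fun k => e k ^ 2) 1).2 he).mul_left 2))
    refine h1.of_nonneg_of_le (fun _ => by positivity) fun k => ?_
    have h2 : (z (k + 1) : ℝ) - θ * z k = θ * e k - e (k + 1) := by rw [hz, hz]; ring
    rw [h2]
    nlinarith [sq_nonneg (θ * e k + e (k + 1))]
  have hdet := tendsto_det_hankel hθ (z := fun k => (z k : ℝ)) hM hη
  -- The determinants are integers tending to zero.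
  have hdetZ : ∀ᶠ n in atTop, (hankel z n).det = 0 := by
    refine tendsto_pure.1 ((tendsto_add_atTop_iff_nat 1).1 (tendsto_pure.2 ?_))
    filter_upwards [hdet.abs.eventually (gt_mem_nhds (show |(0 : ℝ)| < 1 by simp))] with n hn
    have h1 : (hankel (fun k => (z k : ℝ)) (n + 1)).det = ((hankel z (n + 1)).det : ℝ) := by
      rw [Int.cast_det]; rfl
    rw [h1] at hn
    exact Int.abs_lt_one_iff.1 (by exact_mod_cast hn)
  obtain ⟨a, ha, hrec⟩ := exists_monic_recurrence_of_det_hankel_eq_zero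
    (z := fun k => (z k : ℚ)) (by
      filter_upwards [hdetZ] with n hn
      have h1 : (hankel (fun k => (z k : ℚ)) n).det = ((hankel z n).det : ℚ) := by
        rw [Int.cast_det]; rfl
      rw [h1, hn, Int.cast_zero])
  refine isIntegral_of_recurrence hθ hx ?_ ha hrec
  have h1 : Tendsto (fun k => x - e k * θ⁻¹ ^ k) atTop (𝓝 (x - 0 * 0)) :=
    tendsto_const_nhds.sub (he0.mul (tendsto_pow_atTop_nhds_zero_of_lt_one (by positivity)
      (inv_lt_one_of_one_lt₀ hθ)))
  rw [mul_zero, sub_zero] at h1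
  refine h1.congr fun k => ?_
  rw [hz, sub_mul, mul_assoc, ← mul_pow, mul_inv_cancel₀ hθ0.ne', one_pow, mul_one]

theorem minpoly_eq_of_aeval_minpoly_eq_zero (hint : IsIntegral ℤ θ) {w : ℂ}
    (hw : aeval w (minpoly ℤ θ) = 0) : minpoly ℤ w = minpoly ℤ θ := by
  have hwint : IsIntegral ℤ w := ⟨minpoly ℤ θ, minpoly.monic hint, by simpa [aeval_def] using hw⟩
  have hdvd := minpoly.isIntegrallyClosed_dvd hwint hw
  have hass := (minpoly.irreducible hwint).associated_of_dvd (minpoly.irreducible hint) hdvd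
  exact eq_of_monic_of_associated (minpoly.monic hwint) (minpoly.monic hint) hass

/-- Pisot's theorem: if the distances of `x θ ^ k` to the integers tend to zero, and `θ` is an
algebraic integer, then the other conjugates of `θ` lie in the open unit disc. -/
theorem norm_conjugate_lt_one (hθ : 1 < θ) (hx : x ≠ 0) (hz : ∀ k, (z k : ℝ) = x * θ ^ k - e k)
    (he : Tendsto e atTop (𝓝 0)) (hint : IsIntegral ℤ θ) {w : ℂ}
    (hw : aeval w (minpoly ℤ θ) = 0) (hne : w ≠ θ) : ‖w‖ < 1 := by
  set P := minpoly ℤ θ with hP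
  have hPm : P.Monic := minpoly.monic hint
  set d := P.natDegree with hd
  have hd0 : 0 < d := minpoly.natDegree_pos hint
  have hPθ : ∑ i ∈ Finset.range (d + 1), (P.coeff i : ℝ) * θ ^ i = 0 := by
    have := minpoly.aeval ℤ θ
    rw [aeval_eq_sum_range] at this
    simpa [zsmul_eq_mul] using this
  have hshift : ∀ i, Tendsto (fun k => e (k + i)) atTop (𝓝 0) := fun i =>
    (tendsto_add_atTop_iff_nat i).2 he
  -- The geometric part is killed by `P`, so the recurrence defect of `z` is an integer that tends
  -- to zero with the errors.
  have hrec : ∀ᶠ k in atTop, ∑ i ∈ Finset.range (d + 1), P.coeff i * z (k + i) = 0 := by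
    have h1 : Tendsto (fun k => ∑ i ∈ Finset.range (d + 1), (P.coeff i : ℝ) * e (k + i)) atTop
        (𝓝 (∑ i ∈ Finset.range (d + 1), (P.coeff i : ℝ) * 0)) :=
      tendsto_finsetSum _ fun i _ => (hshift i).const_mul _
    simp only [mul_zero, Finset.sum_const_zero] at h1
    filter_upwards [h1.abs.eventually (gt_mem_nhds (show |(0 : ℝ)| < 1 by simp))] with k hk
    have h2 : ((∑ i ∈ Finset.range (d + 1), P.coeff i * z (k + i) : ℤ) : ℝ)
        = -∑ i ∈ Finset.range (d + 1), (P.coeff i : ℝ) * e (k + i) := by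
      push_cast
      have h3 : ∀ i, (P.coeff i : ℝ) * z (k + i)
          = x * θ ^ k * (P.coeff i * θ ^ i) - P.coeff i * e (k + i) := fun i => by
        rw [hz, pow_add]; ring
      simp_rw [h3]
      rw [Finset.sum_sub_distrib, ← Finset.mul_sum, hPθ, mul_zero, zero_sub]
    refine Int.abs_lt_one_iff.1 ?_
    have h4 : |((∑ i ∈ Finset.range (d + 1), P.coeff i * z (k + i) : ℤ) : ℝ)| < 1 := by
      rw [h2, abs_neg]; exact hk
    exact_mod_cast h4
  have hzne : ∀ᶠ k in atTop, z k ≠ 0 := by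
    have h1 : ∀ᶠ k in atTop, |e k| < |x| :=
      he.abs.eventually (gt_mem_nhds (by simpa using hx))
    filter_upwards [h1] with k hk h0
    have h2 := hz k
    rw [h0, Int.cast_zero, eq_comm, sub_eq_zero] at h2
    rw [← h2, abs_mul] at hk
    have : 1 ≤ |θ ^ k| := (one_le_pow₀ hθ.le).trans (le_abs_self _)
    nlinarith [abs_nonneg x]
  obtain ⟨K, hK⟩ := eventually_atTop.1 (hrec.and hzne)
  set PC : ℂ[X] := P.map (Int.castRingHom ℂ) with hPC
  have hPCdeg : PC.natDegree = d := hPm.natDegree_map _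
  -- Applying `P / (X - w)` to the shifts of `z` leaves a sequence `u` with `u (k+1) = w u k`
  -- eventually. It tends to zero because `θ ≠ w` is still a root of the quotient. A nonzero term of
  -- `u` then forces `‖w‖ < 1`.
  set c : ℂ[X] := PC /ₘ (X - C w) with hc
  have hroot : PC.IsRoot w := by
    rw [IsRoot, hPC, eval_map]
    simpa [aeval_def] using hw
  have hmulc : (X - C w) * c = PC := mul_divByMonic_eq_iff_isRoot.2 hroot
  have hcdeg : c.natDegree = d - 1 := by
    rw [hc, natDegree_divByMonic _ (monic_X_sub_C w), hPCdeg, natDegree_X_sub_C]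
  have hcθ : ∑ i ∈ Finset.range d, c.coeff i * (θ : ℂ) ^ i = 0 := by
    have h1 : PC.eval (θ : ℂ) = 0 := by
      have h2 := congrArg (algebraMap ℝ ℂ) (minpoly.aeval ℤ θ)
      rw [map_zero, ← aeval_algebraMap_apply] at h2
      rw [hPC, eval_map]
      simpa [aeval_def] using h2
    rw [← hmulc, eval_mul] at h1
    have h3 := (mul_eq_zero.1 h1).resolve_left (by simpa [sub_eq_zero] using hne.symm)
    rwa [eval_eq_sum_range' (n := d) (by omega)] at h3
  set u : ℕ → ℂ := fun k => ∑ i ∈ Finset.range d, c.coeff i * (z (k + i) : ℂ) with hu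
  have hustep : ∀ k, K ≤ k → u (k + 1) = w * u k := by
    intro k hk
    have h1 := (hK k hk).1
    have h2 : ∑ i ∈ Finset.range (d + 1), PC.coeff i * (z (k + i) : ℂ) = 0 := by
      have := congrArg (Int.cast (R := ℂ)) h1
      push_cast at this
      simpa [hPC] using this
    have hcd : c.coeff d = 0 := coeff_eq_zero_of_natDegree_lt (by omega)
    have h3 : ∀ i, PC.coeff (i + 1) = c.coeff i - w * c.coeff (i + 1) := by
      intro i
      rw [← hmulc, sub_mul, coeff_sub, coeff_X_mul, coeff_C_mul]
    have h4 : PC.coeff 0 = -(w * c.coeff 0) := by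
      rw [← hmulc, sub_mul, coeff_sub, coeff_X_mul_zero, coeff_C_mul, zero_sub]
    rw [Finset.sum_range_succ', h4] at h2
    simp only [h3, sub_mul, Finset.sum_sub_distrib] at h2
    have h5 : u (k + 1) = ∑ i ∈ Finset.range d, c.coeff i * (z (k + (i + 1)) : ℂ) :=
      Finset.sum_congr rfl fun i _ => by rw [add_assoc, add_comm 1 i]
    have h6 : w * u k = ∑ i ∈ Finset.range d, w * c.coeff (i + 1) * (z (k + (i + 1)) : ℂ)
        + w * c.coeff 0 * z (k + 0) := by
      rw [← Finset.sum_range_succ' (fun i => w * c.coeff i * (z (k + i) : ℂ)) d,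
        Finset.sum_range_succ, hcd, hu, Finset.mul_sum]
      simp [mul_assoc]
    rw [h5, h6]
    linear_combination h2
  have hupow : ∀ j, u (K + j) = w ^ j * u K := by
    intro j
    induction j with
    | zero => simp
    | succ j ih => rw [← add_assoc, hustep _ (by omega), ih, pow_succ']; ring
  have hulim : Tendsto u atTop (𝓝 0) := by
    have h1 : Tendsto (fun k => -∑ i ∈ Finset.range d, c.coeff i * (e (k + i) : ℂ)) atTop
        (𝓝 (-∑ i ∈ Finset.range d, c.coeff i * ((0 : ℝ) : ℂ))) :=
      (tendsto_finsetSum _ fun i _ => ((Complex.continuous_ofReal.tendsto _).comp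
        (hshift i)).const_mul _).neg
    simp only [Complex.ofReal_zero, mul_zero, Finset.sum_const_zero, neg_zero] at h1
    refine h1.congr fun k => ?_
    have h2 : ∀ i, c.coeff i * (z (k + i) : ℂ)
        = x * θ ^ k * (c.coeff i * (θ : ℂ) ^ i) - c.coeff i * e (k + i) := by
      intro i
      have := congrArg (Complex.ofReal) (hz (k + i))
      push_cast at this
      rw [this, pow_add]
      ring
    simp only [hu]
    simp_rw [h2]
    rw [Finset.sum_sub_distrib, ← Finset.mul_sum, hcθ, mul_zero, zero_sub]
  have huK : u K ≠ 0 := by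
    intro h0
    -- Expanding the coefficients of the quotient in powers of `w` gives `u K = S(w)` with `S`
    -- integral of degree at most `d - 1`. Its coefficient at `d - 1` is `z K ≠ 0`, so vanishing
    -- would contradict that `w` has degree `d`.
    set S : ℤ[X] := ∑ i ∈ Finset.range d, ∑ j ∈ Finset.Icc (i + 1) d,
      monomial (j - (i + 1)) (z (K + i) * P.coeff j) with hS
    have hSw : aeval w S = 0 := by
      rw [← h0, hS, map_sum]
      simp only [hu]
      refine Finset.sum_congr rfl fun i _ => ?_
      rw [map_sum, hc, coeff_divByMonic_X_sub_C, Finset.sum_mul, hPCdeg]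
      refine Finset.sum_congr rfl fun j _ => ?_
      rw [aeval_monomial, hPC, coeff_map]
      simp
      ring
    have hScoeff : S.coeff (d - 1) = z K := by
      rw [hS, finsetSum_coeff, Finset.sum_eq_single 0]
      · rw [finsetSum_coeff, Finset.sum_eq_single d]
        · rw [coeff_monomial, if_pos (by omega), hd, hPm.coeff_natDegree]
          simp
        · intro j hj hjd
          have := Finset.mem_Icc.1 hj
          rw [coeff_monomial, if_neg (by omega)]
        · intro h
          exact absurd (Finset.mem_Icc.2 ⟨by omega, le_rfl⟩) h
      · intro i hi hi0
        rw [finsetSum_coeff]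
        refine Finset.sum_eq_zero fun j hj => ?_
        have := Finset.mem_Icc.1 hj
        rw [coeff_monomial, if_neg (by omega)]
      · intro h
        exact absurd (Finset.mem_range.2 hd0) h
    have hS0 : S ≠ 0 := by
      intro h
      rw [h, coeff_zero] at hScoeff
      exact (hK K le_rfl).2 hScoeff.symm
    have hSdeg : S.natDegree ≤ d - 1 := by
      refine natDegree_sum_le_of_forall_le _ _ fun i _ => natDegree_sum_le_of_forall_le _ _
        fun j hj => (natDegree_monomial_le _).trans ?_
      have := Finset.mem_Icc.1 hj
      omega
    have h1 := minpoly.IsIntegrallyClosed.degree_le_of_ne_zero hS0 hSw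
    rw [minpoly_eq_of_aeval_minpoly_eq_zero hint hw] at h1
    have h2 : d ≤ S.natDegree := natDegree_le_natDegree h1
    omega
  by_contra hw1
  have h1 : ∀ j, ‖u K‖ ≤ ‖u (K + j)‖ := fun j => by
    rw [hupow, norm_mul, norm_pow]
    exact le_mul_of_one_le_left (norm_nonneg _) (one_le_pow₀ (not_lt.1 hw1))
  have h2 : Tendsto (fun j => ‖u (K + j)‖) atTop (𝓝 0) := by
    have h3 := (hulim.comp (tendsto_add_atTop_nat K)).norm
    simpa [Function.comp_def, add_comm] using h3
  exact huK (norm_le_zero_iff.1 (ge_of_tendsto' h2 h1))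

end Pisot

/-! ### The fundamental solution of a Pisot recurrence. -/

section Green

open Filter Topology Polynomial

theorem Polynomial.reverse_prod_X_sub_C (s : Multiset ℂ) :
    (s.map fun w => X - C w).prod.reverse = (s.map fun w => 1 - C w * X).prod := by
  induction s using Multiset.induction_on with
  | empty => simpa using reverse_C (1 : ℂ)
  | cons w s ih =>
    have h1 : (X - C w : ℂ[X]).reverse = 1 - C w * X := by
      rw [reverse, natDegree_X_sub_C, reflect_sub, reflect_C, pow_one]
      congr 1
      simp
    rw [Multiset.map_cons, Multiset.prod_cons, reverse_mul_of_domain, ih, h1, Multiset.map_cons,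
      Multiset.prod_cons]

/-- The inverse of `∏ (1 - w X)`, with all `w` in the open unit disc, has summable
coefficients. -/
theorem exists_inverse_prod_one_sub_summable (s : Multiset ℂ) (hs : ∀ w ∈ s, ‖w‖ < 1) :
    ∃ q : PowerSeries ℂ, (s.map fun w => 1 - PowerSeries.C w * PowerSeries.X).prod * q = 1 ∧
      Summable fun n => ‖PowerSeries.coeff n q‖ := by
  induction s using Multiset.induction_on with
  | empty =>
    refine ⟨1, by simp, summable_of_ne_finset_zero (s := {0}) fun n hn => ?_⟩
    rw [PowerSeries.coeff_one, if_neg (by simpa using hn), norm_zero]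
  | cons w s ih =>
    obtain ⟨q, hq, hsum⟩ := ih fun v hv => hs v (Multiset.mem_cons_of_mem hv)
    have hw := hs w (Multiset.mem_cons_self w s)
    set G : PowerSeries ℂ := PowerSeries.mk fun n => w ^ n with hG
    have hGinv : (1 - PowerSeries.C w * PowerSeries.X) * G = 1 := by
      ext n
      rw [sub_mul, one_mul, map_sub, mul_assoc, PowerSeries.coeff_C_mul]
      cases n with
      | zero => simp [hG]
      | succ n => simp [hG, PowerSeries.coeff_succ_X_mul, PowerSeries.coeff_one, pow_succ']
    refine ⟨G * q, ?_, ?_⟩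
    · rw [Multiset.map_cons, Multiset.prod_cons]
      calc _ = ((1 - PowerSeries.C w * PowerSeries.X) * G) *
            ((s.map fun w => 1 - PowerSeries.C w * PowerSeries.X).prod * q) := by ring
        _ = 1 := by rw [hGinv, hq, one_mul]
    · have hGsum : Summable fun n => ‖PowerSeries.coeff n G‖ := by
        refine (summable_geometric_of_lt_one (norm_nonneg w) hw).congr fun n => ?_
        rw [hG, PowerSeries.coeff_mk, norm_pow]
      refine (summable_norm_sum_mul_antidiagonal_of_summable_norm
        (f := fun n => PowerSeries.coeff n G) (g := fun n => PowerSeries.coeff n q)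
        hGsum hsum).congr fun n => ?_
      rw [PowerSeries.coeff_mul]

variable {θ : ℝ}

/-- The roots of the minimal polynomial of `θ` other than `θ`. -/
theorem exists_roots_minpoly_eq_cons (hint : IsIntegral ℤ θ) :
    ∃ s : Multiset ℂ, (minpoly ℤ θ).map (Int.castRingHom ℂ)
        = (X - C (θ : ℂ)) * (s.map fun w => X - C w).prod ∧
      ∀ w ∈ s, aeval w (minpoly ℤ θ) = 0 ∧ w ≠ θ := by
  set PC := (minpoly ℤ θ).map (Int.castRingHom ℂ) with hPC
  have hm : PC.Monic := (minpoly.monic hint).map _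
  have hroot : ∀ w : ℂ, w ∈ PC.roots ↔ aeval w (minpoly ℤ θ) = 0 := by
    intro w
    rw [mem_roots hm.ne_zero, IsRoot, hPC, eval_map, aeval_def]
    rfl
  have hθ : (θ : ℂ) ∈ PC.roots := by
    rw [hroot]
    have h2 := congrArg (algebraMap ℝ ℂ) (minpoly.aeval ℤ θ)
    rwa [map_zero, ← aeval_algebraMap_apply] at h2
  -- In characteristic zero the minimal polynomial is separable, so `θ` is a simple root and does
  -- not reappear among the remaining ones.
  have hnodup : PC.roots.Nodup := by
    refine nodup_roots ?_
    have h1 : (minpoly ℚ θ).Separable :=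
      (minpoly.irreducible (hint.tower_top (A := ℚ))).separable
    rw [minpoly.isIntegrallyClosed_eq_field_fractions' ℚ hint] at h1
    have h2 := h1.map (f := algebraMap ℚ ℂ)
    rw [Polynomial.map_map] at h2
    rwa [RingHom.ext_int ((algebraMap ℚ ℂ).comp (algebraMap ℤ ℚ)) (Int.castRingHom ℂ)] at h2
  obtain ⟨s, hs⟩ := Multiset.exists_cons_of_mem hθ
  refine ⟨s, ?_, fun w hw => ⟨(hroot w).1 (hs ▸ Multiset.mem_cons_of_mem hw), ?_⟩⟩
  · have h1 := (IsAlgClosed.splits PC).eq_prod_roots_of_monic hm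
    rw [h1, hs, Multiset.map_cons, Multiset.prod_cons]
  · rintro rfl
    rw [hs, Multiset.nodup_cons] at hnodup
    exact hnodup.1 hw

/-- The fundamental solution of the linear recurrence with characteristic polynomial the minimal
polynomial of a Pisot number `θ` is a multiple of `θ ^ m` up to a summable error. -/
theorem exists_fundamental_solution (hθ : 1 < θ) (hint : IsIntegral ℤ θ)
    (hconj : ∀ w : ℂ, aeval w (minpoly ℤ θ) = 0 → w ≠ θ → ‖w‖ < 1) :
    ∃ (H : ℤ → ℤ) (b : ℤ → ℝ) (κ : ℝ),
      (∀ m, ∑ i ∈ Finset.range ((minpoly ℤ θ).natDegree + 1),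
        (minpoly ℤ θ).coeff ((minpoly ℤ θ).natDegree - i) * H (m - i) = if m = 0 then 1 else 0) ∧
      (∀ m, m < 0 → H m = 0) ∧
      (∀ m, (H m : ℝ) = κ * θ ^ m - b m) ∧ Summable fun m => |b m| := by
  have hθ0 : 0 < θ := by linarith
  set P := minpoly ℤ θ with hP
  set d := P.natDegree with hd
  have hPm : P.Monic := minpoly.monic hint
  have hrev0 : PowerSeries.constantCoeff (P.reverse : PowerSeries ℤ) = ((1 : ℤˣ) : ℤ) := by
    rw [← PowerSeries.coeff_zero_eq_constantCoeff_apply, Polynomial.coeff_coe,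
      coeff_zero_reverse, hPm.leadingCoeff, Units.val_one]
  -- The reversed polynomial has constant coefficient `1`, so its inverse power series has integer
  -- coefficients; these form the fundamental solution.
  set I : PowerSeries ℤ := PowerSeries.invOfUnit P.reverse 1 with hI
  have hPI : (P.reverse : PowerSeries ℤ) * I = 1 := PowerSeries.mul_invOfUnit _ _ hrev0
  set H : ℤ → ℤ := fun m => if 0 ≤ m then PowerSeries.coeff m.toNat I else 0 with hH
  have hHnat : ∀ m : ℕ, H m = PowerSeries.coeff m I := fun m => by simp [hH]
  have hHneg : ∀ m, m < 0 → H m = 0 := fun m hm => by simp [hH, not_le.2 hm]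
  have hrevcoeff : ∀ i, i ≤ d → P.reverse.coeff i = P.coeff (d - i) := fun i hi => by
    rw [coeff_reverse, revAt_le hi]
  have hrec : ∀ m, ∑ i ∈ Finset.range (d + 1), P.coeff (d - i) * H (m - i)
      = if m = 0 then 1 else 0 := by
    intro m
    rcases lt_or_ge m 0 with hm | hm
    · rw [if_neg (by omega)]
      exact Finset.sum_eq_zero fun i _ => by rw [hHneg _ (by omega), mul_zero]
    · lift m to ℕ using hm
      have h1 := congrArg (PowerSeries.coeff m) hPI
      rw [PowerSeries.coeff_mul, Finset.Nat.sum_antidiagonal_eq_sum_range_succ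
        (fun i j => PowerSeries.coeff i (P.reverse : PowerSeries ℤ) * PowerSeries.coeff j I),
        PowerSeries.coeff_one] at h1
      simp only [Polynomial.coeff_coe] at h1
      have h2 : ∑ i ∈ Finset.range (d + 1), P.coeff (d - i) * H (m - i)
          = ∑ i ∈ Finset.range (m + d + 1), P.reverse.coeff i * H (m - i) := by
        rw [← Finset.sum_subset (Finset.range_subset_range.2 (by omega : d + 1 ≤ m + d + 1))]
        · refine Finset.sum_congr rfl fun i hi => ?_
          rw [hrevcoeff i (by have := Finset.mem_range.1 hi; omega)]
        · intro i _ hi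
          rw [coeff_eq_zero_of_natDegree_lt, zero_mul]
          refine (reverse_natDegree_le P).trans_lt ?_
          have := mt Finset.mem_range.2 hi
          omega
      have h3 : ∑ i ∈ Finset.range (m + 1), P.reverse.coeff i * PowerSeries.coeff (m - i) I
          = ∑ i ∈ Finset.range (m + d + 1), P.reverse.coeff i * H (m - i) := by
        rw [← Finset.sum_subset (Finset.range_subset_range.2 (by omega : m + 1 ≤ m + d + 1))]
        · refine Finset.sum_congr rfl fun i hi => ?_
          rw [← hHnat, Nat.cast_sub (by have := Finset.mem_range.1 hi; omega)]
        · intro i _ hi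
          have := mt Finset.mem_range.2 hi
          rw [hHneg _ (by omega), mul_zero]
      rw [h2, ← h3, h1]
      simp
  obtain ⟨s, hs, hsroot⟩ := exists_roots_minpoly_eq_cons hint
  obtain ⟨q, hq, hqsum⟩ := exists_inverse_prod_one_sub_summable s
    fun w hw => hconj w (hsroot w hw).1 (hsroot w hw).2
  -- Removing the factor of `θ` from the inverse leaves the inverse of the product over the other
  -- conjugates. Hence `H m - θ H (m - 1)` is summable.
  have hIq : (1 - PowerSeries.C (θ : ℂ) * PowerSeries.X) *
      I.map (Int.castRingHom ℂ) = q := by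
    have h1 : ((P.map (Int.castRingHom ℂ)).reverse : PowerSeries ℂ)
        * I.map (Int.castRingHom ℂ) = 1 := by
      have h2 := congrArg (PowerSeries.map (Int.castRingHom ℂ)) hPI
      rw [map_mul, map_one, ← Polynomial.polynomial_map_coe] at h2
      rw [← h2]
      congr 2
      ext i
      rw [coeff_map, coeff_reverse, coeff_reverse, coeff_map, hPm.natDegree_map]
    rw [hs, reverse_mul_of_domain, Polynomial.reverse_prod_X_sub_C] at h1
    have h3 := Polynomial.reverse_prod_X_sub_C {(θ : ℂ)}
    simp only [Multiset.map_singleton, Multiset.prod_singleton] at h3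
    have h4 : (((s.map fun w => 1 - C w * X).prod : ℂ[X]) : PowerSeries ℂ)
        = (s.map fun w => 1 - PowerSeries.C w * PowerSeries.X).prod := by
      have := map_multiset_prod (Polynomial.coeToPowerSeries.ringHom (R := ℂ))
        (s.map fun w => 1 - C w * X)
      rw [Polynomial.coeToPowerSeries.ringHom_apply, Multiset.map_map] at this
      rw [this]
      simp [Function.comp_def]
    rw [h3, Polynomial.coe_mul, h4] at h1
    simp only [Polynomial.coe_sub, Polynomial.coe_one, Polynomial.coe_mul, Polynomial.coe_C,
      Polynomial.coe_X] at h1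
    calc _ = (1 - PowerSeries.C (θ : ℂ) * PowerSeries.X) * I.map (Int.castRingHom ℂ) *
          ((s.map fun w => 1 - PowerSeries.C w * PowerSeries.X).prod * q) := by rw [hq, mul_one]
      _ = ((1 - PowerSeries.C (θ : ℂ) * PowerSeries.X) *
          (s.map fun w => 1 - PowerSeries.C w * PowerSeries.X).prod *
          I.map (Int.castRingHom ℂ)) * q := by ring
      _ = q := by rw [h1, one_mul]
  set r : ℤ → ℝ := fun m => H m - θ * H (m - 1) with hr
  have hrq : ∀ m : ℕ, (r m : ℂ) = PowerSeries.coeff m q := by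
    intro m
    rw [← hIq, sub_mul, one_mul, map_sub, mul_assoc, PowerSeries.coeff_C_mul]
    cases m with
    | zero => simp [hr, hH]
    | succ m =>
      have : ((m + 1 : ℕ) : ℤ) - 1 = (m : ℤ) := by push_cast; ring
      rw [PowerSeries.coeff_succ_X_mul]
      simp only [hr, this, hHnat]
      simp
  have hrsum : Summable fun m => |r m| := by
    refine Summable.of_nat_of_neg_add_one ?_ ?_
    · refine hqsum.congr fun m => ?_
      rw [← hrq, Complex.norm_real, Real.norm_eq_abs]
    · refine summable_zero.congr fun m => ?_
      simp only [hr]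
      rw [hHneg _ (by omega), hHneg _ (by omega)]
      simp
  have hgeom : Summable fun j : ℕ => (θ⁻¹) ^ (j + 1) := (summable_nat_add_iff 1).2
    (summable_geometric_of_lt_one (by positivity) (inv_lt_one_of_one_lt₀ hθ))
  -- The first-order equation for `H` is solved from `+∞`: `b m = ∑ θ^(-(j+1)) r (m+j+1)` converges,
  -- is summable in `m`, and turns `b + H` into an exact geometric sequence.
  set f : ℤ × ℕ → ℝ := fun x => (θ⁻¹) ^ (x.2 + 1) * r (x.1 + x.2 + 1) with hf
  have hfsum : Summable fun x => |f x| := by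
    have h1 : Summable fun x : ℤ × ℕ => |r x.1| * (θ⁻¹) ^ (x.2 + 1) :=
      hrsum.mul_of_nonneg hgeom (fun _ => abs_nonneg _) fun _ => by positivity
    let E : ℤ × ℕ ≃ ℤ × ℕ :=
      { toFun := fun x => (x.1 + x.2 + 1, x.2)
        invFun := fun x => (x.1 - x.2 - 1, x.2)
        left_inv := fun x => Prod.ext (by simp only; ring) rfl
        right_inv := fun x => Prod.ext (by simp only; ring) rfl }
    refine (E.summable_iff.2 h1).congr fun x => ?_
    simp only [Function.comp_apply, hf, E, Equiv.coe_fn_mk]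
    rw [abs_mul, abs_of_pos (a := θ⁻¹ ^ (x.2 + 1)) (by positivity), mul_comm]
  have hfsec : ∀ m, Summable fun j => f (m, j) := fun m =>
    (summable_abs_iff.1 hfsum).prod_factor m
  set b : ℤ → ℝ := fun m => ∑' j, f (m, j) with hb
  have hbsum : Summable fun m => |b m| := by
    refine hfsum.prod.of_nonneg_of_le (fun _ => abs_nonneg _) fun m => ?_
    simpa using norm_tsum_le_tsum_norm (f := fun j => f (m, j)) (hfsum.prod_factor m)
  have hbstep : ∀ m, b (m - 1) = θ⁻¹ * (r m + b m) := by
    intro m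
    simp only [hb]
    rw [(hfsec (m - 1)).tsum_eq_zero_add, mul_add, ← tsum_mul_left]
    congr 1
    · simp [hf]
    · refine tsum_congr fun j => ?_
      simp only [hf]
      push_cast
      rw [show m - 1 + ((j : ℤ) + 1) + 1 = m + j + 1 by ring, pow_succ]
      ring
  have hstep : ∀ m, b m + H m = θ * (b (m - 1) + H (m - 1)) := by
    intro m
    rw [hbstep]
    simp only [hr]
    field_simp
    ring
  refine ⟨H, b, b 0 + H 0, hrec, hHneg, fun m => ?_, hbsum⟩
  rw [eq_sub_iff_add_eq, add_comm]
  induction m using Int.induction_on with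
  | zero => simp
  | succ m ih =>
    rw [hstep, add_sub_cancel_right, ih, zpow_add_one₀ hθ0.ne']
    ring
  | pred m ih =>
    rw [hstep, mul_comm, ← eq_div_iff hθ0.ne'] at ih
    rw [ih, zpow_sub_one₀ hθ0.ne']
    ring

end Green

/-! ### Expansion of the reduced phases in Green sequences. -/

section Expansion

open Filter Topology

/-- The sum of the values of `b` at the integers greater than `p`. -/
noncomputable def tailSum (b : ℤ → ℝ) (p : ℤ) : ℝ := ∑' j : ℕ, b (p + 1 + j)

/-- The one-sided Green sequence with source at `p`. -/
noncomputable def greenSeq (θ : ℝ) (b : ℤ → ℝ) (p k : ℕ) : ℝ :=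
  b (p - k) + (θ - 1) / θ * tailSum b p * θ⁻¹ ^ k

/-- The argument of the `k`-th cosine factor of the `n`-th Fourier–Stieltjes coefficient. -/
noncomputable def phase (θ : ℝ) (n : ℤ) (k : ℕ) : ℝ := n * (θ - 1) * θ⁻¹ ^ (k + 1)

/-- The representative of the phase in `[-1/2, 1/2]`. -/
noncomputable def reducedPhase (θ : ℝ) (n : ℤ) (k : ℕ) : ℝ := phase θ n k - round (phase θ n k)

theorem abs_reducedPhase_le (θ : ℝ) (n : ℤ) (k : ℕ) : |reducedPhase θ n k| ≤ 1 / 2 :=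
  abs_sub_round _

/-- The total of the phases is an integer. This is the relation that later confines the coefficient
of `θ^(-k)` to a finite set. -/
theorem hasSum_phase {θ : ℝ} (hθ : 1 < θ) (n : ℤ) : HasSum (phase θ n) n := by
  have hθ0 : 0 < θ := by linarith
  have h := (hasSum_geometric_of_lt_one (by positivity) (inv_lt_one_of_one_lt₀ hθ)).mul_left
    (n * (θ - 1) * θ⁻¹)
  have h1 : (n : ℝ) * (θ - 1) * θ⁻¹ * (1 - θ⁻¹)⁻¹ = n := by
    have : θ - 1 ≠ 0 := by linarith
    have h2 : 1 - θ⁻¹ = (θ - 1) * θ⁻¹ := by field_simp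
    rw [h2, mul_assoc (n : ℝ), mul_assoc, mul_inv_cancel₀ (by positivity), mul_one]
  rw [h1] at h
  refine h.congr_fun fun k => ?_
  rw [phase, pow_succ]
  ring

section

variable {b : ℤ → ℝ} (hb : Summable fun m => |b m|)

include hb

theorem summable_tail_abs (p : ℤ) : Summable fun j : ℕ => |b (p + 1 + j)| :=
  hb.comp_injective (i := fun j : ℕ => p + 1 + (j : ℤ)) fun i j h => by simpa using h

theorem hasSum_tailSum (p : ℤ) : HasSum (fun j : ℕ => b (p + 1 + j)) (tailSum b p) :=
  (summable_abs_iff.1 (summable_tail_abs hb p)).hasSum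

theorem hasSum_sub_natCast (p : ℤ) :
    HasSum (fun k : ℕ => b (p - k)) (∑' m, b m - tailSum b p) := by
  have h1 : Summable fun k : ℕ => b (p - k) :=
    (summable_abs_iff.1 hb).comp_injective (i := fun k : ℕ => p - (k : ℤ))
      fun i j h => by simpa using h
  have h2 : HasSum (fun m : ℤ => b (p - m)) (∑' m, b m) :=
    (Equiv.subLeft p).hasSum_iff.2 (summable_abs_iff.1 hb).hasSum
  have h3 := h1.hasSum.of_nat_of_neg_add_one (f := fun m : ℤ => b (p - m)) (m' := tailSum b p) (by
    refine (hasSum_tailSum hb p).congr_fun fun k => ?_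
    congr 1
    ring)
  rw [← h3.unique h2, add_sub_cancel_right]
  exact h1.hasSum

theorem abs_tailSum_le_tail (p : ℤ) : |tailSum b p| ≤ ∑' j : ℕ, |b (p + 1 + j)| :=
  norm_tsum_le_tsum_norm (f := fun j : ℕ => b (p + 1 + j)) (summable_tail_abs hb p)

theorem abs_tailSum_le (p : ℤ) : |tailSum b p| ≤ ∑' m, |b m| :=
  (abs_tailSum_le_tail hb p).trans <| tsum_comp_le_tsum_of_inj hb (fun _ => abs_nonneg _)
    (i := fun j : ℕ => p + 1 + (j : ℤ)) fun i j h => by simpa using h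

end

/-- If the reduced phases are bounded in `ℓ²`, then they are combinations of a bounded number of
Green sequences, up to finitely many multiples of `θ ^ (-k)`. -/
theorem exists_reducedPhase_expansion {θ : ℝ} (hθ : 1 < θ) {d : ℕ} {a : ℕ → ℤ} (ha0 : a 0 = 1)
    (haθ : ∑ i ∈ Finset.range (d + 1), (a i : ℝ) * θ⁻¹ ^ i = 0) {H : ℤ → ℤ}
    (hH : ∀ m, ∑ i ∈ Finset.range (d + 1), a i * H (m - i) = if m = 0 then 1 else 0)
    (hHneg : ∀ m, m < 0 → H m = 0) {b : ℤ → ℝ} {κ : ℝ} (hHb : ∀ m, (H m : ℝ) = κ * θ ^ m - b m)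
    (hb : Summable fun m => |b m|) (c : ℝ) :
    ∃ (S : Finset ℝ) (A M : ℕ), ∀ n : ℤ,
      (∀ N, ∑ k ∈ Finset.range N, reducedPhase θ n k ^ 2 ≤ c) →
      ∃ s ∈ S, ∃ F : Finset ℕ, F.card ≤ M ∧ ∃ ε : ℕ → ℤ, (∀ p, |ε p| ≤ A) ∧
        ∀ k, reducedPhase θ n k = s * θ⁻¹ ^ k + ∑ p ∈ F, (ε p : ℝ) * greenSeq θ b p k := by
  have hθ0 : 0 < θ := by linarith
  have hθ1 : 0 < θ - 1 := by linarith
  -- None of these constants depends on `n`: `A` bounds the defects of the recurrence, `M` bounds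
  -- their number by Cauchy–Schwarz, and `R` bounds the integer sum of the reduced phases.
  set A : ℕ := ∑ i ∈ Finset.range (d + 1), (a i).natAbs with hA
  set M : ℕ := ⌈(∑ i ∈ Finset.range (d + 1), (a i : ℝ) ^ 2) * ((d + 1) * c)⌉₊ with hM
  set β : ℝ := ∑' m, |b m| with hβ
  have hβb : ∀ m, |b m| ≤ β := fun m => hb.le_tsum m fun _ _ => abs_nonneg _
  have hβ0 : 0 ≤ β := (abs_nonneg _).trans (hβb 0)
  set B : ℝ := ∑' m, b m with hB
  set R : ℝ := θ / (θ - 1) * (1 / 2 + M * (A * β)) + β * (M * A) + M * (A * β) with hR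
  refine ⟨(Finset.Icc (-⌈R⌉) ⌈R⌉ ×ˢ Finset.Icc (-(M * A : ℤ)) (M * A)).image
    (fun x : ℤ × ℤ => (θ - 1) / θ * (x.1 - B * x.2)), A, M, fun n hn => ?_⟩
  set y : ℕ → ℝ := phase θ n with hy
  set z : ℕ → ℤ := fun k => round (y k) with hz
  have hyz : ∀ k, reducedPhase θ n k = y k - z k := fun k => rfl
  obtain ⟨K, hK⟩ : ∃ K, ∀ k, K ≤ k → z k = 0 := by
    have h := (hasSum_phase hθ n).summable.tendsto_atTop_zero
    have h1 := h.abs.eventually (gt_mem_nhds (show |(0 : ℝ)| < 1 / 2 by norm_num))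
    obtain ⟨K, hK⟩ := eventually_atTop.1 h1
    refine ⟨K, fun k hk => ?_⟩
    have h2 := abs_lt.1 (hK k hk)
    exact round_eq_zero_iff.2 ⟨h2.1.le, h2.2⟩
  -- The defect of the rounded phases in the recurrence. The phases themselves satisfy it exactly,
  -- so the defect is also minus the recurrence applied to the reduced phases.
  set ε : ℕ → ℤ := fun k => ∑ i ∈ Finset.range (d + 1), a i * z (k + i) with hε
  have hεy : ∀ k, (ε k : ℝ) = -∑ i ∈ Finset.range (d + 1), (a i : ℝ) * reducedPhase θ n (k + i) := by
    intro k
    have h1 : ∑ i ∈ Finset.range (d + 1), (a i : ℝ) * y (k + i) = 0 := by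
      have h2 : ∀ i, (a i : ℝ) * y (k + i) = y k * (a i * θ⁻¹ ^ i) := by
        intro i
        simp only [hy, phase]
        rw [show k + i + 1 = (k + 1) + i by ring, pow_add]
        ring
      simp_rw [h2]
      rw [← Finset.mul_sum, haθ, mul_zero]
    simp only [hyz, mul_sub, Finset.sum_sub_distrib, h1, hε]
    push_cast
    ring
  have hεA : ∀ k, |ε k| ≤ A := by
    intro k
    have h1 : |(ε k : ℝ)| ≤ A := by
      rw [hεy, abs_neg, hA]
      push_cast
      refine (Finset.abs_sum_le_sum_abs _ _).trans (Finset.sum_le_sum fun i _ => ?_)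
      rw [abs_mul, Nat.cast_natAbs, Int.cast_abs]
      exact mul_le_of_le_one_right (abs_nonneg _)
        ((abs_reducedPhase_le θ n (k + i)).trans (by norm_num))
    exact_mod_cast h1
  set F : Finset ℕ := (Finset.range K).filter fun k => ε k ≠ 0 with hF
  have hFcard : F.card ≤ M := by
    -- A nonzero integer has square at least `1`, so the `ℓ²` bound counts the defects.
    have h1 : (F.card : ℝ) ≤ ∑ k ∈ F, (ε k : ℝ) ^ 2 := by
      rw [Finset.card_eq_sum_ones, Nat.cast_sum]
      refine Finset.sum_le_sum fun k hk => ?_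
      have h2 : (1 : ℤ) ≤ ε k ^ 2 := by
        have := sq_pos_of_ne_zero (Finset.mem_filter.1 hk).2
        omega
      exact_mod_cast h2
    have h2 : ∀ k, (ε k : ℝ) ^ 2 ≤ (∑ i ∈ Finset.range (d + 1), (a i : ℝ) ^ 2) *
        ∑ i ∈ Finset.range (d + 1), reducedPhase θ n (k + i) ^ 2 := fun k => by
      rw [hεy, neg_sq]
      exact Finset.sum_mul_sq_le_sq_mul_sq _ _ _
    have h3 : ∑ k ∈ F, ∑ i ∈ Finset.range (d + 1), reducedPhase θ n (k + i) ^ 2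
        ≤ (d + 1) * c := by
      rw [Finset.sum_comm]
      have h4 : ∀ i ∈ Finset.range (d + 1), ∑ k ∈ F, reducedPhase θ n (k + i) ^ 2 ≤ c := by
        intro i _
        refine le_trans ?_ (hn (K + i))
        rw [← Finset.sum_image (f := fun k => reducedPhase θ n k ^ 2) (g := fun k => k + i)
          fun x _ y _ h => by simpa using h]
        refine Finset.sum_le_sum_of_subset_of_nonneg (fun k hk => ?_) fun _ _ _ => sq_nonneg _
        obtain ⟨j, hj, rfl⟩ := Finset.mem_image.1 hk
        have := Finset.mem_range.1 (Finset.mem_filter.1 hj).1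
        exact Finset.mem_range.2 (by omega)
      refine (Finset.sum_le_sum h4).trans (le_of_eq ?_)
      simp
    have h5 : (F.card : ℝ) ≤ (∑ i ∈ Finset.range (d + 1), (a i : ℝ) ^ 2) * ((d + 1) * c) := by
      refine h1.trans ((Finset.sum_le_sum fun k _ => h2 k).trans ?_)
      rw [← Finset.mul_sum]
      exact mul_le_mul_of_nonneg_left h3 (Finset.sum_nonneg fun _ _ => sq_nonneg _)
    exact Nat.cast_le.1 (h5.trans (Nat.le_ceil _))
  -- Descending induction from `K`, beyond which the rounded phases vanish: the leading coefficient
  -- is `1`, so the recurrence determines `z k` from later terms and the defects.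
  have hzH' : ∀ j k, K ≤ k + j → z k = ∑ p ∈ Finset.range K, ε p * H (p - k) := by
    intro j
    induction j with
    | zero =>
      intro k hk
      rw [hK k hk, Finset.sum_eq_zero]
      intro p hp
      have := Finset.mem_range.1 hp
      rw [hHneg _ (by omega), mul_zero]
    | succ j ih =>
      intro k hk
      rcases le_or_gt K k with hk' | hk'
      · exact ih k (by omega)
      have h1 : ∑ i ∈ Finset.range (d + 1), a i * ∑ p ∈ Finset.range K, ε p * H (p - (k + i : ℕ))
          = ε k := by
        simp_rw [Finset.mul_sum]
        rw [Finset.sum_comm]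
        have h2 : ∀ p : ℕ, ∑ i ∈ Finset.range (d + 1), a i * (ε p * H (p - (k + i : ℕ)))
            = if p = k then ε p else 0 := by
          intro p
          have h3 := hH (p - k)
          rw [← mul_one (ε p), ← mul_zero (ε p), ← mul_ite]
          have h4 : (if p = k then (1 : ℤ) else 0) = if (p : ℤ) - k = 0 then 1 else 0 := by
            congr 1
            simp only [sub_eq_zero, Nat.cast_inj]
          rw [h4, ← h3, Finset.mul_sum]
          refine Finset.sum_congr rfl fun i _ => ?_
          push_cast
          rw [sub_sub]
          ring
        simp_rw [h2]
        simp [hk']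
      have h2 : ε k = ∑ i ∈ Finset.range (d + 1), a i * z (k + i) := rfl
      rw [Finset.sum_range_succ', ha0, one_mul, add_zero] at h1 h2
      rw [Finset.sum_congr rfl fun i _ => by rw [← ih (k + (i + 1)) (by omega)]] at h1
      have h3 := h1.trans h2
      exact (add_left_cancel h3).symm
  have hzH : ∀ k, z k = ∑ p ∈ F, ε p * H (p - k) := by
    intro k
    rw [hzH' K k (by omega), hF, Finset.sum_filter_of_ne]
    intro p _ h h0
    exact h (by rw [h0, zero_mul])
  set C : ℝ := y 0 - κ * ∑ p ∈ F, (ε p : ℝ) * θ ^ p with hC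
  have hexp : ∀ k : ℕ, reducedPhase θ n k
      = C * θ⁻¹ ^ k + ∑ p ∈ F, (ε p : ℝ) * b (p - k) := by
    intro k
    rw [hyz, hzH]
    push_cast
    have h1 : y k = y 0 * θ⁻¹ ^ k := by
      simp only [hy, phase, pow_succ, pow_zero]; ring
    have h2 : ∀ p : ℕ, (ε p : ℝ) * H (p - k)
        = (ε p : ℝ) * θ ^ p * (κ * θ⁻¹ ^ k) - ε p * b (p - k) := by
      intro p
      rw [hHb, zpow_sub₀ hθ0.ne', zpow_natCast, zpow_natCast, inv_pow]
      ring
    simp_rw [h2]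
    rw [Finset.sum_sub_distrib, ← Finset.sum_mul, h1, hC]
    ring
  -- Summing the reduced phases in two ways, once as an integer and once through the expansion,
  -- expresses `C` by the bounded integers `N` and `E` and the tail sums.
  have hsum1 : HasSum (reducedPhase θ n) ((n - ∑ k ∈ Finset.range K, z k : ℤ) : ℝ) := by
    have h1 : HasSum (fun k => (z k : ℝ)) (∑ k ∈ Finset.range K, (z k : ℝ)) :=
      hasSum_sum_of_ne_finset_zero fun k hk => by
        rw [hK k (by simpa using hk), Int.cast_zero]
    have h2 := (hasSum_phase hθ n).sub h1
    push_cast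
    exact h2
  have hsum2 : HasSum (reducedPhase θ n)
      (C * (θ / (θ - 1)) + ∑ p ∈ F, (ε p : ℝ) * (B - tailSum b p)) := by
    have h1 := (hasSum_geometric_of_lt_one (by positivity) (inv_lt_one_of_one_lt₀ hθ)).mul_left C
    have h2 : (1 - θ⁻¹)⁻¹ = θ / (θ - 1) := by field_simp
    rw [h2] at h1
    have h3 : HasSum (fun k : ℕ => ∑ p ∈ F, (ε p : ℝ) * b (p - k))
        (∑ p ∈ F, (ε p : ℝ) * (B - tailSum b p)) :=
      hasSum_sum fun p _ => (hasSum_sub_natCast hb p).mul_left _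
    exact (h1.add h3).congr_fun hexp
  set N : ℤ := n - ∑ k ∈ Finset.range K, z k with hN
  set E : ℤ := ∑ p ∈ F, ε p with hE
  have hNeq : (N : ℝ) = C * (θ / (θ - 1)) + B * E - ∑ p ∈ F, (ε p : ℝ) * tailSum b p := by
    rw [hsum1.unique hsum2, hE]
    push_cast
    simp_rw [mul_sub]
    rw [Finset.sum_sub_distrib, ← Finset.sum_mul]
    ring
  have hbound : ∀ t : ℕ → ℝ, (∀ p, |t p| ≤ β) → |∑ p ∈ F, (ε p : ℝ) * t p| ≤ M * (A * β) := by
    intro t ht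
    refine (Finset.abs_sum_le_sum_abs _ _).trans
      ((Finset.sum_le_sum (g := fun _ => A * β) fun p _ => ?_).trans ?_)
    · rw [abs_mul]
      refine mul_le_mul ?_ (ht p) (abs_nonneg _) (Nat.cast_nonneg _)
      exact_mod_cast hεA p
    · rw [Finset.sum_const, nsmul_eq_mul]
      refine mul_le_mul_of_nonneg_right ?_ (by positivity)
      exact_mod_cast hFcard
  have hEA : |E| ≤ M * A := by
    refine (Finset.abs_sum_le_sum_abs _ _).trans
      ((Finset.sum_le_sum fun p _ => hεA p).trans ?_)
    rw [Finset.sum_const, nsmul_eq_mul]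
    refine mul_le_mul_of_nonneg_right ?_ (by positivity)
    exact_mod_cast hFcard
  have hC' : |C| ≤ 1 / 2 + M * (A * β) := by
    have h1 : C = reducedPhase θ n 0 - ∑ p ∈ F, (ε p : ℝ) * b p := by
      have := hexp 0
      rw [pow_zero, mul_one] at this
      rw [this]
      simp
    rw [h1]
    exact (abs_sub _ _).trans (add_le_add (abs_reducedPhase_le _ _ _) (hbound _ fun p => hβb _))
  have hNR : |(N : ℝ)| ≤ R := by
    rw [hNeq]
    have hBβ : |B| ≤ β := by
      simpa using norm_tsum_le_tsum_norm (f := b) hb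
    have hEA' : |(E : ℝ)| ≤ M * A := by exact_mod_cast hEA
    refine (abs_sub _ _).trans (add_le_add ((abs_add_le _ _).trans (add_le_add ?_ ?_))
      (hbound _ fun p => abs_tailSum_le hb p))
    · rw [abs_mul, abs_of_pos (a := θ / (θ - 1)) (by positivity), mul_comm]
      gcongr
    · rw [abs_mul]
      gcongr
  refine ⟨(θ - 1) / θ * (N - B * E), Finset.mem_image.2 ⟨(N, E), Finset.mem_product.2
    ⟨Finset.mem_Icc.2 (abs_le.1 ?_), Finset.mem_Icc.2 (abs_le.1 hEA)⟩, rfl⟩, F, hFcard, ε, hεA,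
    fun k => ?_⟩
  · have h1 : (|N| : ℝ) ≤ ⌈R⌉ := hNR.trans (Int.le_ceil _)
    exact_mod_cast h1
  · rw [hexp k]
    -- The tail sums are absorbed by the correction term in `greenSeq`, which makes the total of
    -- each Green sequence over `k ≥ 0` equal to the full sum of `b`. What remains is an element of
    -- the finite set.
    have h1 : C = (θ - 1) / θ * (N - B * E) + (θ - 1) / θ * ∑ p ∈ F, (ε p : ℝ) * tailSum b p := by
      rw [hNeq]
      field_simp
      ring
    have h2 : ∑ p ∈ F, (ε p : ℝ) * greenSeq θ b p k = ∑ p ∈ F, (ε p : ℝ) * b (p - k)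
        + (θ - 1) / θ * (∑ p ∈ F, (ε p : ℝ) * tailSum b p) * θ⁻¹ ^ k := by
      rw [Finset.mul_sum, Finset.sum_mul, ← Finset.sum_add_distrib]
      refine Finset.sum_congr rfl fun p _ => ?_
      rw [greenSeq]
      ring
    rw [h2, h1]
    ring

end Expansion

/-! ### Large coefficients force `θ` to be a Pisot number. -/

section CoefficientNorm

open Filter Topology

/-- The extension by zero of a sequence to the negative integers. -/
noncomputable def extendNat (f : ℕ → ℝ) (k : ℤ) : ℝ := if 0 ≤ k then f k.toNat else 0

theorem extendNat_natCast (f : ℕ → ℝ) (k : ℕ) : extendNat f k = f k := by simp [extendNat]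

theorem extendNat_of_neg (f : ℕ → ℝ) {k : ℤ} (hk : k < 0) : extendNat f k = 0 := by
  simp [extendNat, hk]

theorem notMem_range_natCast {k : ℤ} (hk : k ∉ Set.range ((↑) : ℕ → ℤ)) : k < 0 := by
  by_contra h
  exact hk ⟨k.toNat, by simp; omega⟩

theorem hasProd_cosProd_extendNat (f : ℕ → ℝ) :
    HasProd (fun k => cosAbs (f k)) (cosProd (extendNat f)) := by
  have h : HasProd (fun k : ℤ => cosAbs (extendNat f k)) (cosProd (extendNat f)) := by
    simpa [HasProd] using tendsto_cosProd (extendNat f)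
  have h1 := (Nat.cast_injective (R := ℤ)).hasProd_iff (f := fun k : ℤ => cosAbs (extendNat f k))
    (a := cosProd (extendNat f)) fun k hk => by
      rw [extendNat_of_neg f (notMem_range_natCast hk), cosAbs_zero]
  simpa [Function.comp_def, extendNat_natCast] using h1.2 h

theorem cosProd_extendNat_le (f : ℕ → ℝ) (N : ℕ) :
    cosProd (extendNat f) ≤ ∏ k ∈ Finset.range N, cosAbs (f k) := by
  refine (ciInf_le ⟨0, ?_⟩ ((Finset.range N).map Nat.castEmbedding)).trans_eq ?_
  · rintro _ ⟨s, rfl⟩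
    exact Finset.prod_nonneg fun k _ => (cosAbs_mem _).1
  · simp [extendNat_natCast]

theorem norm_fourierStieltjesCoeff_cantorLebesgueCircle {θ : ℝ} (hθ : 1 < θ) (n : ℤ) :
    ‖fourierStieltjesCoeff (cantorLebesgueCircle θ) n‖ = cosProd (extendNat (reducedPhase θ n)) := by
  refine tendsto_nhds_unique (tendsto_prod_cos_fourierStieltjesCoeff hθ n).norm
    ((hasProd_cosProd_extendNat (reducedPhase θ n)).tendsto_prod_nat.congr fun N => ?_)
  rw [norm_mul, norm_prod]
  have h1 : ‖Complex.exp (-(n * Real.pi) * Complex.I)‖ = 1 := by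
    simpa using Complex.norm_exp_ofReal_mul_I (-(n * Real.pi))
  rw [h1, one_mul]
  refine Finset.prod_congr rfl fun k _ => ?_
  rw [Complex.norm_real, reducedPhase, cosAbs_sub_intCast]
  rfl

theorem fourierStieltjesCoeff_cantorLebesgueCircle_im {θ : ℝ} (hθ : 1 < θ) (n : ℤ) :
    (fourierStieltjesCoeff (cantorLebesgueCircle θ) n).im = 0 := by
  refine tendsto_nhds_unique ((Complex.continuous_im.tendsto _).comp
    (tendsto_prod_cos_fourierStieltjesCoeff hθ n)) (tendsto_const_nhds.congr fun N => ?_)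
  have h1 : Complex.exp (-(n * Real.pi) * Complex.I) = (Real.cos (n * Real.pi) : ℂ) := by
    rw [← Complex.cos_add_sin_I, Complex.cos_neg, Complex.sin_neg, Complex.sin_int_mul_pi]
    push_cast
    ring
  simp only [Function.comp_apply]
  rw [h1, ← Complex.ofReal_prod, ← Complex.ofReal_mul, Complex.ofReal_im]

/-- Square the product and use `cos² = 1 - sin² ≤ exp (-sin²)`. -/
theorem sum_sin_sq_le_of_le_prod_cosAbs {δ : ℝ} (hδ : 0 < δ) {f : ℕ → ℝ} {N : ℕ}
    (h : δ ≤ ∏ k ∈ Finset.range N, cosAbs (f k)) :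
    ∑ k ∈ Finset.range N, Real.sin (Real.pi * f k) ^ 2 ≤ -(2 * Real.log δ) := by
  have h1 : δ ^ 2 ≤ Real.exp (-∑ k ∈ Finset.range N, Real.sin (Real.pi * f k) ^ 2) := by
    refine (pow_le_pow_left₀ hδ.le h 2).trans ?_
    rw [← Finset.prod_pow, ← Finset.sum_neg_distrib, Real.exp_sum]
    refine Finset.prod_le_prod (fun k _ => sq_nonneg _) fun k _ => ?_
    rw [cosAbs, sq_abs, Real.cos_sq']
    have := Real.add_one_le_exp (-Real.sin (Real.pi * f k) ^ 2)
    linarith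
  have h2 := (Real.log_le_iff_le_exp (by positivity)).2 h1
  rw [Real.log_pow] at h2
  push_cast at h2
  linarith

theorem sin_sq_pi_mul_sub_intCast (x : ℝ) (n : ℤ) :
    Real.sin (Real.pi * (x - n)) ^ 2 = Real.sin (Real.pi * x) ^ 2 := by
  rw [mul_sub, mul_comm Real.pi (n : ℝ), Real.sin_sub_int_mul_pi, mul_pow, ← zpow_natCast,
    ← zpow_mul, mul_comm n, zpow_mul]
  simp

/-- Jordan's inequality `sin u ≥ 2u/π` on `[0, π/2]`, applied to the distance to the nearest
integer. -/
theorem four_mul_sub_round_sq_le (x : ℝ) :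
    4 * (x - round x) ^ 2 ≤ Real.sin (Real.pi * x) ^ 2 := by
  rw [← sin_sq_pi_mul_sub_intCast x (round x)]
  set y := x - round x with hy
  have h1 : |y| ≤ 1 / 2 := abs_sub_round x
  have h2 := Real.mul_le_sin (x := Real.pi * |y|) (by positivity)
    (by nlinarith [Real.pi_pos])
  have h3 : 2 / Real.pi * (Real.pi * |y|) = 2 * |y| := by field_simp
  rw [h3] at h2
  have h4 := pow_le_pow_left₀ (by positivity) h2 2
  have h5 : Real.sin (Real.pi * |y|) ^ 2 = Real.sin (Real.pi * y) ^ 2 := by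
    rcases abs_choice y with h | h <;> rw [h]
    rw [mul_neg, Real.sin_neg, neg_sq]
  rw [h5, mul_pow, sq_abs] at h4
  linarith

/-- If infinitely many Fourier–Stieltjes coefficients are bounded away from zero, then some
sequence `x θ ^ k` is close to the integers in the sense of `ℓ²`. -/
theorem exists_sum_sin_sq_mul_pow_le {θ : ℝ} (hθ : 1 < θ) {U : Ultrafilter ℤ}
    (hU : Tendsto id (U : Filter ℤ) cofinite) {c : ℝ} (h : ∀ᶠ n in (U : Filter ℤ), ∀ N,
      ∑ k ∈ Finset.range N, Real.sin (Real.pi * phase θ n k) ^ 2 ≤ c) :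
    ∃ x : ℝ, x ≠ 0 ∧ ∀ N, ∑ k ∈ Finset.range N, Real.sin (Real.pi * (x * θ ^ k)) ^ 2 ≤ c := by
  have hθ0 : 0 < θ := by linarith
  have hex : ∀ n, ∃ k, |phase θ n k| < 1 := fun n => by
    have h1 := (hasSum_phase hθ n).summable.tendsto_atTop_zero.abs.eventually
      (gt_mem_nhds (show |(0 : ℝ)| < 1 by norm_num))
    exact h1.exists
  have hstep : ∀ n k, phase θ n (k + 1) * θ = phase θ n k := fun n k => by
    rw [phase, phase, pow_succ _ (k + 1), mul_assoc, mul_assoc (θ⁻¹ ^ (k + 1)),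
      inv_mul_cancel₀ hθ0.ne', mul_one]
  have hmul : ∀ n m k, phase θ n (m + k) * θ ^ k = phase θ n m := fun n m k => by
    induction k with
    | zero => simp
    | succ k ih => rw [← ih, pow_succ', ← mul_assoc, ← add_assoc, hstep]
  classical
  -- Rescale at the first index where the phase is below `1` in absolute value. Unless this index is
  -- `0`, the phase there is at least `1/θ`, so its limit `x` is nonzero; going back `k` steps
  -- multiplies it by `θ^k`.
  set m : ℤ → ℕ := fun n => Nat.find (hex n) with hm
  have hm1 : ∀ n, |phase θ n (m n)| < 1 := fun n => Nat.find_spec (hex n)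
  have hm2 : ∀ n k, k < m n → 1 ≤ |phase θ n k| := fun n k hk => not_lt.1 (Nat.find_min (hex n) hk)
  have hmN : ∀ N : ℕ, ∀ᶠ n in (U : Filter ℤ), N ≤ m n := by
    intro N
    have hfin : {n : ℤ | m n < N}.Finite := by
      set C := θ ^ (N + 1) / (θ - 1) with hC
      have hθ1 : 0 < θ - 1 := by linarith
      refine (Set.finite_Icc (-⌈C⌉) ⌈C⌉).subset fun n (hn : m n < N) => ?_
      have h1 : |phase θ n (m n)| < 1 := hm1 n
      rw [phase, abs_mul, abs_mul, abs_of_pos hθ1, abs_of_pos (by positivity : 0 < θ⁻¹ ^ (m n + 1)),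
        inv_pow, ← div_eq_mul_inv, div_lt_one (by positivity)] at h1
      have h2 : θ ^ (m n + 1) ≤ θ ^ (N + 1) := pow_le_pow_right₀ hθ.le (by omega)
      have h3 : (|n| : ℝ) ≤ ⌈C⌉ := by
        refine le_trans ?_ (Int.le_ceil _)
        rw [hC, le_div_iff₀ hθ1]
        linarith
      exact Set.mem_Icc.2 (abs_le.1 (by exact_mod_cast h3))
    have := hU hfin.compl_mem_cofinite
    filter_upwards [this] with n hn
    simpa using hn
  set X : ℤ → ℝ := fun n => phase θ n (m n) with hX
  have hXmem : ∀ n, X n ∈ Set.Icc (-1 : ℝ) 1 := fun n =>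
    ⟨(abs_lt.1 (hm1 n)).1.le, (abs_lt.1 (hm1 n)).2.le⟩
  obtain ⟨x, hx, hlim⟩ := (isCompact_Icc (a := (-1 : ℝ)) (b := 1)).ultrafilter_le_nhds (U.map X)
    (by
      rw [le_principal_iff, Ultrafilter.coe_map]
      exact mem_map.2 (univ_mem' hXmem))
  have hlim' : Tendsto X U (𝓝 x) := hlim
  have hX1 : ∀ᶠ n in (U : Filter ℤ), θ⁻¹ ≤ |X n| := by
    filter_upwards [hmN 1] with n hn
    have h1 := hm2 n (m n - 1) (by omega)
    have h2 := hstep n (m n - 1)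
    rw [show m n - 1 + 1 = m n by omega] at h2
    rw [← h2, abs_mul, abs_of_pos hθ0] at h1
    exact (inv_le_iff_one_le_mul₀ hθ0).2 h1
  refine ⟨x, fun hx0 => ?_, fun N => ?_⟩
  · have h1 := ge_of_tendsto hlim'.abs hX1
    rw [hx0, abs_zero] at h1
    exact absurd h1 (not_le.2 (by positivity))
  · have hcont : Tendsto (fun n => ∑ k ∈ Finset.range N, Real.sin (Real.pi * (X n * θ ^ k)) ^ 2) U
        (𝓝 (∑ k ∈ Finset.range N, Real.sin (Real.pi * (x * θ ^ k)) ^ 2)) :=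
      ((by fun_prop : Continuous fun x : ℝ =>
        ∑ k ∈ Finset.range N, Real.sin (Real.pi * (x * θ ^ k)) ^ 2).tendsto x).comp hlim'
    refine le_of_tendsto hcont ?_
    filter_upwards [h, hmN N] with n h1 h2
    refine le_trans (le_of_eq ?_) ((Finset.sum_le_sum_of_subset_of_nonneg
      (s := (Finset.range N).image fun k => m n - k) (fun j hj => ?_)
      fun _ _ _ => sq_nonneg _).trans (h1 (m n + 1)))
    · rw [Finset.sum_image]
      · refine Finset.sum_congr rfl fun k hk => ?_
        have hk' := Finset.mem_range.1 hk
        rw [← hmul n (m n - k) k, show m n - k + k = m n by omega]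
      · intro i hi j hj hij
        have hi' := Finset.mem_range.1 hi
        have hj' := Finset.mem_range.1 hj
        simp only at hij
        omega
    · obtain ⟨k, _, rfl⟩ := Finset.mem_image.1 hj
      exact Finset.mem_range.2 (by omega)

/-- A number `θ > 1` for which infinitely many Fourier–Stieltjes coefficients are bounded away from
zero is a Pisot number. -/
theorem isIntegral_and_conjugates_of_sum_sin_sq_le {θ : ℝ} (hθ : 1 < θ) {x c : ℝ} (hx : x ≠ 0)
    (h : ∀ N, ∑ k ∈ Finset.range N, Real.sin (Real.pi * (x * θ ^ k)) ^ 2 ≤ c) :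
    IsIntegral ℤ θ ∧ ∀ w : ℂ, Polynomial.aeval w (minpoly ℤ θ) = 0 → w ≠ θ → ‖w‖ < 1 := by
  have hsum : Summable fun k : ℕ => (x * θ ^ k - round (x * θ ^ k)) ^ 2 := by
    refine Summable.of_nonneg_of_le (fun _ => sq_nonneg _) (fun k => ?_)
      (summable_of_sum_range_le (fun _ => sq_nonneg _) h)
    have := four_mul_sub_round_sq_le (x * θ ^ k)
    nlinarith [sq_nonneg (x * θ ^ k - round (x * θ ^ k))]
  have hz : ∀ k : ℕ, ((round (x * θ ^ k) : ℤ) : ℝ)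
      = x * θ ^ k - (x * θ ^ k - round (x * θ ^ k)) := fun k => by ring
  have hint := isIntegral_of_summable_sq hθ hx hz hsum
  exact ⟨hint, fun w hw hne =>
    norm_conjugate_lt_one hθ hx hz (tendsto_zero_of_summable_sq hsum) hint hw hne⟩

end CoefficientNorm

/-! ### Countable families of profiles and their asymptotic sums. -/

section Profiles

open Filter Topology

/-- The additive monoid generated by the integer multiples of translates of the elements of `B`. -/
def translateSpan (B : Set (ℤ → ℝ)) : AddSubmonoid (ℤ → ℝ) :=
  AddSubmonoid.closure {f | ∃ g ∈ B, ∃ a c : ℤ, f = fun k => a * g (k - c)}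

theorem countable_translateSpan {B : Set (ℤ → ℝ)} (hB : B.Countable) :
    (translateSpan B : Set (ℤ → ℝ)).Countable := by
  refine AddSubmonoid.countable_closure ((hB.biUnion (t := fun g _ =>
    Set.range fun x : ℤ × ℤ => fun k => (x.1 : ℝ) * g (k - x.2))
    fun g _ => Set.countable_range _).mono ?_)
  rintro _ ⟨g, hg, a, c, rfl⟩
  exact Set.mem_biUnion hg ⟨(a, c), rfl⟩

theorem summable_abs_of_mem_translateSpan {B : Set (ℤ → ℝ)}
    (hB : ∀ g ∈ B, Summable fun k => |g k|) {f : ℤ → ℝ} (hf : f ∈ translateSpan B) :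
    Summable fun k => |f k| := by
  induction hf using AddSubmonoid.closure_induction with
  | mem f hf =>
    obtain ⟨g, hg, a, c, rfl⟩ := hf
    simp_rw [abs_mul]
    exact ((Equiv.subRight c).summable_iff.2 (hB g hg)).mul_left _
  | zero => simp
  | add f g _ _ hf hg =>
    exact (hf.add hg).of_nonneg_of_le (fun _ => abs_nonneg _) fun _ => abs_add_le _ _

theorem translateSpan_shift {B : Set (ℤ → ℝ)} {f : ℤ → ℝ} (hf : f ∈ translateSpan B) (t : ℤ) :
    (fun k => f (k - t)) ∈ translateSpan B := by
  induction hf using AddSubmonoid.closure_induction with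
  | mem f hf =>
    obtain ⟨g, hg, a, c, rfl⟩ := hf
    refine AddSubmonoid.subset_closure ⟨g, hg, a, t + c, ?_⟩
    simp_rw [sub_add_eq_sub_sub]
  | zero => exact zero_mem _
  | add f g _ _ hf hg => exact add_mem hf hg

theorem intCast_mul_mem_translateSpan {B : Set (ℤ → ℝ)} {g : ℤ → ℝ} (hg : g ∈ B) (a : ℤ) :
    (fun k => a * g k) ∈ translateSpan B :=
  AddSubmonoid.subset_closure ⟨g, hg, a, 0, by simp⟩

theorem summable_abs_extendNat {f : ℕ → ℝ} (hf : Summable fun k => |f k|) :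
    Summable fun k => |extendNat f k| := by
  refine ((Nat.cast_injective (R := ℤ)).summable_iff fun k hk => ?_).1 ?_
  · rw [extendNat_of_neg f (notMem_range_natCast hk), abs_zero]
  · simpa [Function.comp_def, extendNat_natCast] using hf

theorem summable_abs_const_mul_inv_pow {θ : ℝ} (hθ : 1 < θ) (s : ℝ) :
    Summable fun k : ℕ => |s * θ⁻¹ ^ k| :=
  ((summable_geometric_of_lt_one (by positivity) (inv_lt_one_of_one_lt₀ hθ)).mul_left s).abs

theorem summable_abs_greenSeq {θ : ℝ} (hθ : 1 < θ) {b : ℤ → ℝ} (hb : Summable fun m => |b m|)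
    (p : ℕ) : Summable fun k => |greenSeq θ b p k| :=
  ((hasSum_sub_natCast hb p).summable.add (summable_abs_iff.1
    (summable_abs_const_mul_inv_pow hθ ((θ - 1) / θ * tailSum b p)))).abs

/-- Far from the origin, the one-sided Green sequence is close to the two-sided one. -/
theorem summable_tsum_extendNat_greenSeq_sub_le {θ : ℝ} (hθ : 1 < θ) {b : ℤ → ℝ}
    (hb : Summable fun m => |b m|) (p : ℕ) :
    (Summable fun k : ℤ => |extendNat (greenSeq θ b p) k - b (p - k)|) ∧
      ∑' k : ℤ, |extendNat (greenSeq θ b p) k - b (p - k)| ≤ 2 * ∑' j : ℕ, |b (p + 1 + j)| := by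
  have hθ0 : 0 < θ := by linarith
  have hθ1 : 0 < θ - 1 := by linarith
  -- On `k ≥ 0` the error is the correction term, of total mass `|tailSum b p|`; on `k < 0` it is
  -- the cut-off part of `b`. Both are controlled by the tail of `b` beyond `p`.
  have h1 : HasSum (fun k : ℕ => |extendNat (greenSeq θ b p) k - b (p - k)|) |tailSum b p| := by
    have h := (hasSum_geometric_of_lt_one (by positivity) (inv_lt_one_of_one_lt₀ hθ)).mul_left
      ((θ - 1) / θ * |tailSum b p|)
    have h2 : (θ - 1) / θ * |tailSum b p| * (1 - θ⁻¹)⁻¹ = |tailSum b p| := by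
      have h3 : 1 - θ⁻¹ = (θ - 1) / θ := by field_simp
      rw [h3]
      field_simp
    rw [h2] at h
    refine h.congr_fun fun k => ?_
    rw [extendNat_natCast, greenSeq, add_sub_cancel_left, abs_mul, abs_mul,
      abs_of_pos (div_pos hθ1 hθ0), abs_of_pos (by positivity : 0 < θ⁻¹ ^ k)]
  have h2 : HasSum (fun k : ℕ => |extendNat (greenSeq θ b p) (-(k + 1 : ℤ)) - b (p - -(k + 1 : ℤ))|)
      (∑' j : ℕ, |b (p + 1 + j)|) := by
    refine (summable_tail_abs hb p).hasSum.congr_fun fun k => ?_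
    rw [extendNat_of_neg _ (show -((k : ℤ) + 1) < 0 by omega), zero_sub, abs_neg]
    congr 2
    ring
  have h3 := HasSum.of_nat_of_neg_add_one
    (f := fun k : ℤ => |extendNat (greenSeq θ b p) k - b (p - k)|) h1 h2
  refine ⟨h3.summable, ?_⟩
  rw [h3.tsum_eq]
  linarith [abs_tailSum_le_tail hb p]

theorem tendsto_tsum_extendNat_greenSeq_sub {θ : ℝ} (hθ : 1 < θ) {b : ℤ → ℝ}
    (hb : Summable fun m => |b m|) :
    Tendsto (fun p : ℕ => ∑' k : ℤ, |extendNat (greenSeq θ b p) k - b (p - k)|) cofinite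
      (𝓝 0) := by
  rw [Nat.cofinite_eq_atTop]
  have h := (tendsto_sum_nat_add fun j : ℕ => |b (j + 1)|).const_mul 2
  rw [mul_zero] at h
  refine squeeze_zero (fun p => tsum_nonneg fun _ => abs_nonneg _)
    (fun p => (summable_tsum_extendNat_greenSeq_sub_le hθ hb p).2) (h.congr fun p => ?_)
  congr 1
  refine tsum_congr fun j => ?_
  congr 2
  push_cast
  ring

variable {J : Type*} {U : Ultrafilter J} {𝒢 : Set (ℤ → ℝ)}

theorem Ultrafilter.exists_eventually_eq_of_eventually_mem_finite {α : Type*} {t : J → α}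
    {s : Set α} (hs : s.Finite) (h : ∀ᶠ j in (U : Filter J), t j ∈ s) :
    ∃ c ∈ s, ∀ᶠ j in (U : Filter J), t j = c := by
  obtain ⟨c, hc⟩ := Ultrafilter.exists_eventually_eq_of_not_tendsto_cofinite (U := U) (t := t)
    fun ht => by
      obtain ⟨j, hj, hj'⟩ := (h.and (ht hs.compl_mem_cofinite)).exists
      exact hj' hj
  obtain ⟨j, hj, hj'⟩ := (h.and hc).exists
  exact ⟨c, hj' ▸ hj, hc⟩

theorem IsAsymptoticSum.congr {x y : J → ℤ → ℝ} (hx : IsAsymptoticSum U 𝒢 x)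
    (h : ∀ᶠ j in (U : Filter J), ∀ k, x j k = y j k) : IsAsymptoticSum U 𝒢 y := by
  obtain ⟨T, G, hG, hT, hs, h0⟩ := hx
  refine ⟨T, G, hG, hT, ?_, h0.congr' ?_⟩
  · filter_upwards [hs, h] with j h1 h2
    simpa only [h2] using h1
  · filter_upwards [h] with j h2
    simp only [h2]

theorem IsAsymptoticSum.zero : IsAsymptoticSum U 𝒢 fun _ _ => 0 :=
  ⟨∅, fun _ => 0, by simp, by simp, by simp, by simp⟩

/-- Adding a bounded number of Green sequences with bounded coefficients preserves asymptotic
sums. -/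
theorem IsAsymptoticSum.add_sum_greenSeq {θ : ℝ} (hθ : 1 < θ) {b : ℤ → ℝ}
    (hb : Summable fun m => |b m|) {B : Set (ℤ → ℝ)} (hBg : ∀ p, extendNat (greenSeq θ b p) ∈ B)
    (hBb : (fun k => b (-k)) ∈ B) {x : J → ℤ → ℝ} (hx : IsAsymptoticSum U (translateSpan B) x)
    {A : ℤ} {M : ℕ} {F : J → Finset ℕ} {ε : J → ℕ → ℤ}
    (hF : ∀ᶠ j in (U : Filter J), (F j).card ≤ M)
    (hε : ∀ᶠ j in (U : Filter J), ∀ p, |ε j p| ≤ A) :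
    IsAsymptoticSum U (translateSpan B)
      fun j k => x j k + ∑ p ∈ F j, ε j p * extendNat (greenSeq θ b p) k := by
  classical
  induction M generalizing F with
  | zero =>
    refine hx.congr ?_
    filter_upwards [hF] with j hj k
    rw [Finset.card_eq_zero.1 (Nat.le_zero.1 hj), Finset.sum_empty, add_zero]
  | succ M ih =>
    by_cases hM : ∀ᶠ j in (U : Filter J), (F j).card ≤ M
    · exact ih hM
    have hne : ∀ᶠ j in (U : Filter J), (F j).Nonempty := by
      filter_upwards [Ultrafilter.eventually_not.2 hM] with j hj
      exact Finset.card_pos.1 (by omega)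
    -- One source is taken out of each `F j` so that the induction hypothesis applies to the rest;
    -- its coefficient, ranging over a finite set, is constant along the ultrafilter.
    set p : J → ℕ := fun j => if h : (F j).Nonempty then h.choose else 0 with hp
    have hpF : ∀ᶠ j in (U : Filter J), p j ∈ F j := by
      filter_upwards [hne] with j hj
      simp only [hp, dif_pos hj]
      exact hj.choose_spec
    have h1 : IsAsymptoticSum U (translateSpan B) fun j k =>
        x j k + ∑ q ∈ (F j).erase (p j), ε j q * extendNat (greenSeq θ b q) k := by
      refine ih ?_
      filter_upwards [hF, hpF] with j hj hj'
      rw [Finset.card_erase_of_mem hj']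
      omega
    obtain ⟨a, -, ha⟩ := Ultrafilter.exists_eventually_eq_of_eventually_mem_finite
      (U := U) (t := fun j => ε j (p j)) (Set.finite_Icc (-A) A) (by
        filter_upwards [hε] with j hj
        exact abs_le.1 (hj _))
    have key : ∀ (g : ℤ → ℝ) (hg : g ∈ translateSpan B) (p₀ : J → ℤ),
        (∀ᶠ j in (U : Filter J), Summable fun k =>
          |a * extendNat (greenSeq θ b (p j)) k - g (k - p₀ j)|) →
        Tendsto (fun j => ∑' k, |a * extendNat (greenSeq θ b (p j)) k - g (k - p₀ j)|) U (𝓝 0) →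
        IsAsymptoticSum U (translateSpan B)
          fun j k => x j k + ∑ p ∈ F j, ε j p * extendNat (greenSeq θ b p) k := by
      intro g hg p₀ hs h0
      refine (h1.add (fun _ hu _ hv => add_mem hu hv) (fun _ hu c => translateSpan_shift hu c)
        g hg p₀ hs h0).congr ?_
      filter_upwards [hpF, ha] with j hj hj' k
      rw [← Finset.add_sum_erase _ _ hj, hj']
      ring
    -- An escaping source loses sight of the boundary at `0` and contributes a translate of the
    -- two-sided profile `b (-k)`; a source that does not escape is eventually fixed and keeps its
    -- one-sided profile.
    by_cases hcof : Tendsto p U cofinite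
    · have herr : ∀ j k, |a * extendNat (greenSeq θ b (p j)) k - a * b (-(k - (p j : ℤ)))|
          = |(a : ℝ)| * |extendNat (greenSeq θ b (p j)) k - b ((p j : ℤ) - k)| := fun j k => by
        rw [neg_sub, ← mul_sub, abs_mul]
      refine key _ (intCast_mul_mem_translateSpan hBb a) (fun j => p j)
        (Eventually.of_forall fun j => ?_) ?_
      · simp_rw [herr]
        exact (summable_tsum_extendNat_greenSeq_sub_le hθ hb (p j)).1.mul_left _
      · simp_rw [herr, tsum_mul_left]
        simpa using ((tendsto_tsum_extendNat_greenSeq_sub hθ hb).comp hcof).const_mul |(a : ℝ)|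
    · obtain ⟨q, hq⟩ := Ultrafilter.exists_eventually_eq_of_not_tendsto_cofinite hcof
      have herr : ∀ᶠ j in (U : Filter J), ∀ k, |a * extendNat (greenSeq θ b (p j)) k
          - a * extendNat (greenSeq θ b q) (k - 0)| = 0 := by
        filter_upwards [hq] with j hj k
        rw [hj, sub_zero, sub_self, abs_zero]
      refine key _ (intCast_mul_mem_translateSpan (hBg q) a) (fun _ => 0) ?_
        (tendsto_const_nhds.congr' ?_)
      · filter_upwards [herr] with j hj
        simpa only [hj] using summable_zero
      · filter_upwards [herr] with j hj
        simp only [hj, tsum_zero]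

end Profiles

/-! ### Countability of the closure of the coefficients. -/

section Countability

open Filter Topology

theorem exists_ultrafilter_tendsto_of_mem_closure_range {ι X : Type*} [TopologicalSpace X]
    {f : ι → X} {z : X} (hz : z ∈ closure (Set.range f)) :
    ∃ U : Ultrafilter ι, Tendsto f U (𝓝 z) := by
  have : NeBot (comap f (𝓝 z)) := by
    refine comap_neBot_iff.2 fun t ht => ?_
    obtain ⟨_, hy, i, rfl⟩ := mem_closure_iff_nhds.1 hz t ht
    exact ⟨i, hy⟩
  exact ⟨Ultrafilter.of _, tendsto_iff_comap.2 (Ultrafilter.of_le _)⟩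

/-- For a Pisot number `θ`, the limits of the absolute values of the Fourier–Stieltjes coefficients
along sequences where the phases are bounded in `ℓ²` lie in a countable set. -/
theorem exists_countable_limits_norm_coeff {θ : ℝ} (hθ : 1 < θ) (hint : IsIntegral ℤ θ)
    (hconj : ∀ w : ℂ, Polynomial.aeval w (minpoly ℤ θ) = 0 → w ≠ θ → ‖w‖ < 1) :
    ∃ D : Set ℝ, D.Countable ∧ ∀ (U : Ultrafilter ℤ) (c : ℝ) (r : ℝ),
      (∀ᶠ n in (U : Filter ℤ), ∀ N, ∑ k ∈ Finset.range N, reducedPhase θ n k ^ 2 ≤ c) →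
      Tendsto (fun n => ‖fourierStieltjesCoeff (cantorLebesgueCircle θ) n‖) U (𝓝 r) → r ∈ D := by
  have hθ0 : 0 < θ := by linarith
  obtain ⟨H, b, κ, hH, hHneg, hHb, hb⟩ := exists_fundamental_solution hθ hint hconj
  have hmonic := minpoly.monic hint
  have haθ : ∑ i ∈ Finset.range ((minpoly ℤ θ).natDegree + 1),
      ((minpoly ℤ θ).coeff ((minpoly ℤ θ).natDegree - i) : ℝ) * θ⁻¹ ^ i = 0 := by
    set d := (minpoly ℤ θ).natDegree with hd
    have h := minpoly.aeval ℤ θ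
    rw [Polynomial.aeval_eq_sum_range, ← Finset.sum_range_reflect, ← hd] at h
    have h2 : ∑ i ∈ Finset.range (d + 1), ((minpoly ℤ θ).coeff (d - i) : ℝ) * θ⁻¹ ^ i
        = θ⁻¹ ^ d * ∑ j ∈ Finset.range (d + 1),
          (minpoly ℤ θ).coeff (d + 1 - 1 - j) • θ ^ (d + 1 - 1 - j) := by
      rw [Finset.mul_sum]
      refine Finset.sum_congr rfl fun i hi => ?_
      have hi' := Finset.mem_range.1 hi
      have h3 : θ⁻¹ ^ d * θ ^ (d - i) = θ⁻¹ ^ i := by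
        rw [show d = i + (d - i) by omega, pow_add, show i + (d - i) - i = d - i by omega,
          mul_assoc, ← mul_pow, inv_mul_cancel₀ hθ0.ne', one_pow, mul_one]
      rw [Nat.add_sub_cancel, zsmul_eq_mul, mul_left_comm, h3]
    rw [h2, h, mul_zero]
  choose S A M hexp using exists_reducedPhase_expansion hθ (a := fun i =>
    (minpoly ℤ θ).coeff ((minpoly ℤ θ).natDegree - i)) hmonic haθ hH hHneg
    hHb hb
  -- The `ℓ²` bound is rounded up to a natural number `m`, so only countably many finite sets `S m`
  -- occur and the base profiles form a countable set.
  set B : Set (ℤ → ℝ) := ((⋃ m : ℕ, (fun s : ℝ => extendNat fun k => s * θ⁻¹ ^ k) '' S m) ∪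
    Set.range fun p => extendNat (greenSeq θ b p)) ∪ {fun k => b (-k)} with hB
  have hBc : B.Countable := ((Set.countable_iUnion fun m : ℕ =>
    (S m).countable_toSet.image _).union (Set.countable_range _)).union (Set.countable_singleton _)
  have hBs : ∀ g ∈ B, Summable fun k => |g k| := by
    rintro g ((hg | ⟨p, rfl⟩) | rfl)
    · obtain ⟨m, s, -, rfl⟩ := Set.mem_iUnion.1 hg
      exact summable_abs_extendNat (summable_abs_const_mul_inv_pow hθ s)
    · exact summable_abs_extendNat (summable_abs_greenSeq hθ hb p)
    · exact (Equiv.neg ℤ).summable_iff.2 hb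
  refine ⟨Submonoid.closure (cosProd '' (translateSpan B : Set (ℤ → ℝ))),
    Submonoid.countable_closure ((countable_translateSpan hBc).image _), fun U c r hU hr => ?_⟩
  obtain ⟨m, hm⟩ := exists_nat_ge c
  have hU' : ∀ᶠ n in (U : Filter ℤ), ∃ s ∈ S m, ∃ F : Finset ℕ, F.card ≤ M m ∧ ∃ ε : ℕ → ℤ,
      (∀ p, |ε p| ≤ A m) ∧
      ∀ k, reducedPhase θ n k = s * θ⁻¹ ^ k + ∑ p ∈ F, (ε p : ℝ) * greenSeq θ b p k := by
    filter_upwards [hU] with n hn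
    exact hexp m n fun N => (hn N).trans hm
  obtain ⟨s, hs⟩ := hU'.choice
  obtain ⟨F, hF⟩ := (hs.mono fun n h => h.2).choice
  obtain ⟨ε, hε⟩ := (hF.mono fun n h => h.2).choice
  obtain ⟨s₀, hs₀, hss₀⟩ := Ultrafilter.exists_eventually_eq_of_eventually_mem_finite
    (S m).finite_toSet (hs.mono fun n h => h.1)
  have hs₀B : (extendNat fun k => s₀ * θ⁻¹ ^ k) ∈ B :=
    Or.inl (Or.inl (Set.mem_iUnion.2 ⟨m, s₀, hs₀, rfl⟩))
  have h0 : IsAsymptoticSum U (translateSpan B)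
      fun _ k => 0 + extendNat (fun k => s₀ * θ⁻¹ ^ k) k :=
    IsAsymptoticSum.zero.add (fun _ hu _ hv => add_mem hu hv)
      (fun _ hu c => translateSpan_shift hu c) _
      (by simpa using intCast_mul_mem_translateSpan hs₀B 1) (fun _ => 0)
      (by simp) (by simp)
  have h1 := (h0.add_sum_greenSeq hθ hb (fun p => Or.inl (Or.inr ⟨p, rfl⟩)) (Or.inr rfl)
    (hF.mono fun n h => h.1) (hε.mono fun n h => h.1)).congr
    (y := fun n => extendNat (reducedPhase θ n)) (by
      filter_upwards [hε, hss₀] with n hn hn' k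
      rw [zero_add]
      rcases lt_or_ge k 0 with hk | hk
      · simp [extendNat_of_neg _ hk]
      · lift k to ℕ using hk
        simp only [extendNat_natCast]
        rw [hn.2 k, hn'])
  obtain ⟨L, hL, hLlim⟩ := h1.tendsto_cosProd fun g hg => summable_abs_of_mem_translateSpan hBs hg
  simp_rw [norm_fourierStieltjesCoeff_cantorLebesgueCircle hθ] at hr
  rwa [tendsto_nhds_unique hr hLlim]

/-- A nonzero limit that is not a coefficient bounds infinitely many coefficients away from zero,
which makes `θ` a Pisot number. Otherwise the closure adds at most `0` to the coefficients; in the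
Pisot case the additional limits have moduli in a countable set. -/
theorem countable_norm_image_closure_range_coeff {θ : ℝ} (hθ : 1 < θ) :
    ((fun z => ‖z‖) '' closure (Set.range
      (fourierStieltjesCoeff (cantorLebesgueCircle θ)))).Countable := by
  set f := fourierStieltjesCoeff (cantorLebesgueCircle θ) with hf
  have hdich : ∀ (U : Ultrafilter ℤ) (z : ℂ), Tendsto f U (𝓝 z) → z ≠ 0 → z ∉ Set.range f →
      ∃ c, (∀ᶠ n in (U : Filter ℤ), ∀ N, ∑ k ∈ Finset.range N, reducedPhase θ n k ^ 2 ≤ c) ∧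
        IsIntegral ℤ θ ∧ ∀ w : ℂ, Polynomial.aeval w (minpoly ℤ θ) = 0 → w ≠ θ → ‖w‖ < 1 := by
    intro U z hz hz0 hzr
    have hpos : 0 < ‖z‖ / 2 := by positivity
    have hsin : ∀ᶠ n in (U : Filter ℤ), ∀ N,
        ∑ k ∈ Finset.range N, Real.sin (Real.pi * phase θ n k) ^ 2
          ≤ -(2 * Real.log (‖z‖ / 2)) := by
      filter_upwards [hz.norm.eventually (lt_mem_nhds (show ‖z‖ / 2 < ‖z‖ by linarith))] with n hn N
      refine sum_sin_sq_le_of_le_prod_cosAbs hpos (hn.le.trans ?_)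
      rw [hf, norm_fourierStieltjesCoeff_cantorLebesgueCircle hθ]
      refine (cosProd_extendNat_le _ N).trans_eq (Finset.prod_congr rfl fun k _ => ?_)
      rw [reducedPhase, cosAbs_sub_intCast]
    -- If the index did not escape, the ultrafilter would sit at a single `n` and `z` would be the
    -- coefficient there.
    have hcof : Tendsto id (U : Filter ℤ) cofinite := by
      by_contra h
      obtain ⟨c, hc⟩ := Ultrafilter.exists_eventually_eq_of_not_tendsto_cofinite h
      refine hzr ⟨c, tendsto_nhds_unique (tendsto_const_nhds.congr' ?_) hz⟩
      filter_upwards [hc] with n hn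
      rw [← hn, id]
    obtain ⟨x, hx, hxsum⟩ := exists_sum_sin_sq_mul_pow_le hθ hcof hsin
    refine ⟨-(2 * Real.log (‖z‖ / 2)), ?_, isIntegral_and_conjugates_of_sum_sin_sq_le hθ hx hxsum⟩
    filter_upwards [hsin] with n hn N
    refine (Finset.sum_le_sum fun k _ => ?_).trans (hn N)
    have := four_mul_sub_round_sq_le (phase θ n k)
    rw [reducedPhase]
    nlinarith [sq_nonneg (phase θ n k - round (phase θ n k))]
  have hbase : ({0} ∪ Set.range fun n => ‖f n‖ : Set ℝ).Countable :=
    (Set.countable_singleton _).union (Set.countable_range _)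
  by_cases hP : IsIntegral ℤ θ ∧
      ∀ w : ℂ, Polynomial.aeval w (minpoly ℤ θ) = 0 → w ≠ θ → ‖w‖ < 1
  · obtain ⟨D, hD, hlim⟩ := exists_countable_limits_norm_coeff hθ hP.1 hP.2
    refine (hbase.union hD).mono ?_
    rintro _ ⟨z, hz, rfl⟩
    obtain ⟨U, hU⟩ := exists_ultrafilter_tendsto_of_mem_closure_range hz
    by_cases hz0 : z = 0
    · simp [hz0]
    by_cases hzr : z ∈ Set.range f
    · obtain ⟨n, rfl⟩ := hzr
      exact Or.inl (Or.inr ⟨n, rfl⟩)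
    obtain ⟨c, hc, -⟩ := hdich U z hU hz0 hzr
    exact Or.inr (hlim U c _ hc hU.norm)
  · refine hbase.mono ?_
    rintro _ ⟨z, hz, rfl⟩
    obtain ⟨U, hU⟩ := exists_ultrafilter_tendsto_of_mem_closure_range hz
    by_cases hz0 : z = 0
    · simp [hz0]
    by_cases hzr : z ∈ Set.range f
    · obtain ⟨n, rfl⟩ := hzr
      exact Or.inr ⟨n, rfl⟩
    obtain ⟨c, -, h⟩ := hdich U z hU hz0 hzr
    exact absurd h hP

/-- The coefficients are real, hence so are their limits, and a real number is determined by its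
modulus up to sign. -/
theorem countable_closure_range_coeff {θ : ℝ} (hθ : 1 < θ) :
    (closure (Set.range (fourierStieltjesCoeff (cantorLebesgueCircle θ)))).Countable := by
  have h := countable_norm_image_closure_range_coeff hθ
  set K := closure (Set.range (fourierStieltjesCoeff (cantorLebesgueCircle θ))) with hK
  have him : ∀ z ∈ K, z.im = 0 := fun z hz => by
    refine closure_minimal (t := {z : ℂ | z.im = 0}) ?_
      (isClosed_eq Complex.continuous_im continuous_const) hz
    rintro _ ⟨n, rfl⟩
    exact fourierStieltjesCoeff_cantorLebesgueCircle_im hθ n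
  refine ((h.image fun r : ℝ => (r : ℂ)).union (h.image fun r : ℝ => -(r : ℂ))).mono fun z hz => ?_
  have hz' : z = (z.re : ℂ) := Complex.ext rfl (by simpa using him z hz)
  have hnorm : ‖z‖ = |z.re| := by
    conv_lhs => rw [hz']
    rw [Complex.norm_real, Real.norm_eq_abs]
  rcases abs_choice z.re with h1 | h1
  · exact Or.inl ⟨‖z‖, ⟨z, hz, rfl⟩, by rw [hnorm, h1]; exact hz'.symm⟩
  · exact Or.inr ⟨‖z‖, ⟨z, hz, rfl⟩, by
      simp only [hnorm, h1, Complex.ofReal_neg, neg_neg]; exact hz'.symm⟩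

theorem isProbabilityMeasure_cantorLebesgueCircle {θ : ℝ} (hθ : 1 < θ) :
    IsProbabilityMeasure (cantorLebesgueCircle θ) := by
  have h1 : IsProbabilityMeasure (bernoulliConvolution θ) :=
    Measure.isProbabilityMeasure_map (measurable_signSeries hθ).aemeasurable
  have h2 : IsProbabilityMeasure (cantorLebesgue θ) :=
    Measure.isProbabilityMeasure_map (by fun_prop)
  exact Measure.isProbabilityMeasure_map AddCircle.measurable_mk'.aemeasurable

end Countability

/-- For every `θ > 2` and `1 < p < ∞`, the spectrum of the operator of convolution with the
Cantor–Lebesgue measure of constant dissection ratio `θ` on `[0,1) ≃ ℝ/ℤ`, acting on `L^p` of the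
circle, is countable. -/
theorem mainTheorem3 (θ : ℝ) (hθ : 2 < θ) (p : ℝ≥0∞) [Fact (1 ≤ p)] (hp : 1 < p)
    (hp_top : p ≠ ∞) :
    (spectrum ℂ (convOperator (cantorLebesgueCircle θ) p)).Countable := by
  have hθ1 : 1 < θ := by linarith
  have := isProbabilityMeasure_cantorLebesgueCircle hθ1
  have hc := countable_closure_range_coeff hθ1
  exact hc.mono (spectrum_convOperator_subset (cantorLebesgueCircle θ) p hp hp_top hc)
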